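/- **Setting.** Let $\mathcal D'$ be the space of complex-valued Schwartz distributions on $\mathbb R$. A function on $\mathbb R$ is *piecewise smooth* if it is $C^\infty$ except on a finite set, at the points of which it and all its derivatives have finite one-sided limits. Let $\mathcal A\subset\mathcal D'$ be the set of all piecewise smooth functions (regarded as distributions) and all their distributional derivatives of all orders. For $F,G\in\mathcal A$ put $$F*G=\lim_{\epsilon\downarrow 0}F(x)\cdot G(x+\epsilon)$$ (limit in $\mathcal D'$), where $\cdot$ is the Hörmander product of distributions with disjoint singular supports: on every open set on which one factor is a smooth function $g$, it is the usual product of the other factor by $g$. The order $\operatorname{ord}F$ is the least $k$ such that $F$ is the $k$-th distributional derivative of a locally integrable function. Let $n\ge 0$ and $a_0,\dots,a_n,b_0,\dots,b_n\in\mathcal A$. For $f\in C^\infty(\mathbb R)$ consider $$\sum_{i=0}^n\bigl(a_i*\psi^{(i)}+\psi^{(i)}*b_i\bigr)=f .\tag{1}$$ A *solution* is a $\psi\in\mathcal A$ that satisfies (1) in $\mathcal D'$. Let the singular set $I=\bigcup_{i=0}^n(\operatorname{sing\,supp}a_i\cup\operatorname{sing\,supp}b_i)$ be $\{\xi_1<\dots<\xi_m\}$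 ($m\ge0$), put $\xi_0=-\infty$, $\xi_{m+1}=+\infty$ and $\Omega_k=(\xi_k,\xi_{k+1})$ for $k=0,\dots,m$. For an open interval $\Omega$ disjoint from $I$ let $a_{i\overline\Omega},b_{i\overline\Omega}\in C^\infty(\overline\Omega)$ be the smooth extensions to $\overline\Omega$ of the restrictions of $a_i,b_i$ to $\Omega$. Assume * (C1) $a_n(\xi^-)+b_n(\xi^+)\ne0$ for every $\xi\in I$ (one-sided limits); * (C2) $a_{n\overline\Omega}(x)+b_{n\overline\Omega}(x)\neq0$ for every open interval $\Omega$ disjoint from $I$ and every $x\in\overline\Omega$; * $M:=\max\{\operatorname{ord}a_i,\operatorname{ord}b_i: 0\le i\le n\}\le n$. For a function $g$ write $\overline{g(x)}=(g(x),g'(x),\dots,g^{(n-1)}(x))^T$, with one-sided derivatives at the endpoints of a closed interval on which $g$ is smooth. **Theorem 2.11.** There are matrices $\mathbf A_k,\mathbf B_k,\mathbf D_k\in\mathbb C^{n\times n}$, $k=1,\dots,m$, depending only on the coefficients $a_i,b_i$, such that for every $f\in C^\infty(\mathbb R)$ the following hold. 1. A distribution $\psi$ is a solution of (1) if and only if $$\psi=\sum_{k=0}^m\chi_{\Omega_k}\psi_k$$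 for some $\psi_k\in C^\infty(\overline{\Omega_k})$ such that $$\sum_{i=0}^n(a_{i\overline{\Omega_k}}+b_{i\overline{\Omega_k}})\,\psi_k^{(i)}=f\quad\text{on }\overline{\Omega_k},\qquad k=0,\dots,m,$$ and $$\mathbf A_k\,\overline{\psi_{k-1}(\xi_k)}=\mathbf B_k\,\overline{\psi_k(\xi_k)}+\mathbf D_k\,\overline{f(\xi_k)},\qquad k=1,\dots,m .$$ In particular every solution is piecewise smooth, and for $f=0$ the interface conditions are $\mathbf A_k\overline{\psi_{k-1}(\xi_k)}=\mathbf B_k\overline{\psi_k(\xi_k)}$. 2. For every $k\in\{0,\dots,m\}$, $x_0\in(\xi_k,\xi_{k+1})$ and $C\in\mathbb C^n$, there is exactly one solution $\psi$ of (1) with $\overline{\psi(x_0)}=C$ (meaning that $\psi$ coincides on an open interval around $x_0$ with a function $\phi\in C^\infty(\mathbb R)$ with $\overline{\phi(x_0)}=C$) if and only if $\det\mathbf B_s\neq0$ for all $s$ with $k+1\le s\le m$ and $\det\mathbf A_r\ne0$ for all $r$ with $1\le r\le k$. -/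

import Mathlib

open Set Filter Topology MeasureTheory TopologicalSpace
open scoped Distributions ContDiff

noncomputable section

namespace SingularODE

/-- Test functions on the real line. (Mathlib's distributions are tested against real-valued test
functions; the extension to complex test functions is `pair` below.) -/
abbrev Test : Type := 𝓓((⊤ : Opens ℝ), ℝ)

/-- Complex-valued Schwartz distributions on the real line. -/
abbrev Distr : Type := 𝓓'((⊤ : Opens ℝ), ℂ)

/-! ### Basic operations on distributions -/

/-- The regular distribution `t ↦ ∫ t(x) g(x) dx` of a locally integrable function `g`. -/
def ofFun (g : ℝ → ℂ) : Distr :=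
  TestFunction.integralAgainstBilinCLM (ContinuousLinearMap.lsmul ℝ ℝ) volume g

theorem ofFun_apply {g : ℝ → ℂ} (hg : LocallyIntegrable g) (t : Test) :
    ofFun g t = ∫ x, (t x : ℂ) * g x := by
  have hg' : LocallyIntegrableOn g ((⊤ : Opens ℝ) : Set ℝ) volume := hg.locallyIntegrableOn _
  have h := TestFunction.integralAgainstBilinCLM_eq_integral (Ω := (⊤ : Opens ℝ)) (n := ⊤)
    (B := (ContinuousLinearMap.lsmul ℝ ℝ : ℝ →L[ℝ] ℂ →L[ℝ] ℂ)) hg' (f := t)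
  exact h

/-- The `k`-th distributional derivative. -/
def distDeriv (k : ℕ) (F : Distr) : Distr :=
  (fun G : Distr => LineDeriv.lineDerivOp (1 : ℝ) G)^[k] F

/-- The translated test function `x ↦ t (x - ε)`, on test functions supported in `K`. -/
def shiftSupportedIn (ε : ℝ) (K : Compacts ℝ) :
    𝓓_{K}(ℝ, ℝ) →L[ℝ] 𝓓_{K.map (fun x => x + ε) (by fun_prop)}(ℝ, ℝ) :=
  ContDiffMapSupportedIn.mkCLM ℝ (fun t x => t (x - ε))
    (fun _ _ _ => rfl) (fun _ _ _ => rfl)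
    (fun t => t.contDiff.comp (contDiff_id.sub contDiff_const))
    (fun t x hx => t.zero_on_compl (fun h => hx ⟨x - ε, h, by simp⟩))
    (fun i _ => ⟨{i}, 1, zero_le_one, fun t x _ => by
      have h : iteratedFDeriv ℝ i (fun y => t (y - ε)) x = iteratedFDeriv ℝ i t (x - ε) := by
        rw [iteratedFDeriv_comp_sub]
      rw [h]
      simpa using ContDiffMapSupportedIn.norm_iteratedFDeriv_apply_le_seminorm_top ℝ
        (f := t) (x := x - ε) (i := i)⟩)

/-- The translated test function `x ↦ t (x - ε)`. -/
def shiftTest (ε : ℝ) : Test →L[ℝ] Test :=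
  TestFunction.limitCLM ℝ
    (fun t => ⟨fun x => t (x - ε), t.contDiff.comp (contDiff_id.sub contDiff_const),
      t.hasCompactSupport.comp_homeomorph (Homeomorph.subRight ε), fun _ _ => trivial⟩)
    (fun K _ => TestFunction.ofSupportedInCLM ℝ (fun _ _ => trivial) ∘L shiftSupportedIn ε K)
    (fun _ _ _ => rfl)

@[simp] theorem shiftTest_apply (ε : ℝ) (t : Test) (x : ℝ) : shiftTest ε t x = t (x - ε) := rfl

/-- The translated distribution `G(x + ε)`, given by `⟨G(x + ε), t⟩ = ⟨G, t(x - ε)⟩`. -/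
def shift (ε : ℝ) (G : Distr) : Distr :=
  (shiftTest ε).precompCompactConvergenceCLM ℂ G

@[simp] theorem shift_apply (ε : ℝ) (G : Distr) (t : Test) :
    shift ε G t = G (shiftTest ε t) := rfl

/-- The real part of a complex test function. -/
def reTest (h : ℝ → ℂ) (h₁ : ContDiff ℝ ∞ h) (h₂ : HasCompactSupport h) : Test :=
  ⟨fun x => (h x).re, Complex.reCLM.contDiff.comp h₁,
    h₂.comp_left (g := Complex.re) Complex.zero_re, fun _ _ => trivial⟩

/-- The imaginary part of a complex test function. -/
def imTest (h : ℝ → ℂ) (h₁ : ContDiff ℝ ∞ h) (h₂ : HasCompactSupport h) : Test :=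
  ⟨fun x => (h x).im, Complex.imCLM.contDiff.comp h₁,
    h₂.comp_left (g := Complex.im) Complex.zero_im, fun _ _ => trivial⟩

open Classical in
/-- The pairing `⟨F, h⟩` of a distribution with a complex test function `h`, i.e. the
complex-linear extension of `F`. (It is `0` if `h` is not a test function.) -/
def pair (F : Distr) (h : ℝ → ℂ) : ℂ :=
  if H : ContDiff ℝ ∞ h ∧ HasCompactSupport h then
    F (reTest h H.1 H.2) + Complex.I * F (imTest h H.1 H.2)
  else 0

/-- On the open set `U`, the distribution `F` is given by the function `g`. -/
def AgreesOn (F : Distr) (g : ℝ → ℂ) (U : Set ℝ) : Prop :=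
  ∀ t : Test, tsupport t ⊆ U → F t = ∫ x, (t x : ℂ) * g x

/-- The singular support: the complement of the largest open set on which `F` is smooth. -/
def singSupp (F : Distr) : Set ℝ :=
  {x | ¬ ∃ U : Set ℝ, IsOpen U ∧ x ∈ U ∧ ∃ g : ℝ → ℂ, ContDiffOn ℝ ∞ g U ∧ AgreesOn F g U}

/-- The order of a distribution: the least `k` such that `F` is the `k`-th distributional
derivative of a regular distribution (`⊤` if there is none). -/
def order (F : Distr) : ℕ∞ :=
  ⨅ k ∈ {k : ℕ | ∃ g : ℝ → ℂ, LocallyIntegrable g ∧ F = distDeriv k (ofFun g)}, (k : ℕ∞)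

/-! ### The space `𝒜` -/

/-- Piecewise smooth functions: smooth off a finite set, at the points of which they and all
their derivatives have finite one-sided limits. -/
def IsPiecewiseSmooth (g : ℝ → ℂ) : Prop :=
  ∃ S : Finset ℝ, ContDiffOn ℝ ∞ g (S : Set ℝ)ᶜ ∧
    ∀ s ∈ S, ∀ j : ℕ, (∃ l : ℂ, Tendsto (iteratedDeriv j g) (𝓝[<] s) (𝓝 l)) ∧
      (∃ r : ℂ, Tendsto (iteratedDeriv j g) (𝓝[>] s) (𝓝 r))

/-- The space `𝒜` of all piecewise smooth functions together with all their distributional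
derivatives of all orders. -/
def spaceA : Set Distr :=
  {F | ∃ (k : ℕ) (g : ℝ → ℂ), IsPiecewiseSmooth g ∧ F = distDeriv k (ofFun g)}

/-! ### The product `*` -/

/-- `P` is the Hörmander product of `F` and `G`: their singular supports are disjoint and, on
every open set where one of the factors is a smooth function, `P` is the dual product of the
other factor by that function. -/
def IsHormanderProduct (F G P : Distr) : Prop :=
  Disjoint (singSupp F) (singSupp G) ∧
    ∀ (U : Set ℝ) (g : ℝ → ℂ), IsOpen U → ContDiffOn ℝ ∞ g U →
      (AgreesOn G g U → ∀ t : Test, tsupport t ⊆ U → P t = pair F (fun x => g x * t x)) ∧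
      (AgreesOn F g U → ∀ t : Test, tsupport t ⊆ U → P t = pair G (fun x => g x * t x))

/-- `P` is the distributional limit, as `ε ↓ 0`, of the Hörmander products `F(x) · G(x + ε)`
(which are required to exist for all small `ε > 0`). -/
def IsStarProduct (F G P : Distr) : Prop :=
  ∃ H : ℝ → Distr, (∀ᶠ ε in 𝓝[>] (0 : ℝ), IsHormanderProduct F (shift ε G) (H ε)) ∧
    ∀ t : Test, Tendsto (fun ε => H ε t) (𝓝[>] (0 : ℝ)) (𝓝 (P t))

open Classical in
/-- The product `F * G` (always defined when `F` and `G` lie in `𝒜`; it is `0` where the limit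
does not exist). -/
def starProd (F G : Distr) : Distr :=
  if h : ∃ P : Distr, IsStarProduct F G P then h.choose else 0

/-! ### The differential equation -/

variable {n : ℕ}

/-- `ψ` is a solution of `∑ i ≤ n, (a i * ψ⁽ⁱ⁾ + ψ⁽ⁱ⁾ * b i) = f`. -/
def IsSolution (a b : Fin (n + 1) → Distr) (f : ℝ → ℂ) (ψ : Distr) : Prop :=
  ψ ∈ spaceA ∧
    ∑ i : Fin (n + 1), (starProd (a i) (distDeriv i ψ) + starProd (distDeriv i ψ) (b i)) = ofFun f

/-- `ψ` satisfies the conditions `ψ(x₀) = C 0, …, ψ⁽ⁿ⁻¹⁾(x₀) = C (n - 1)`. -/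
def HasData (ψ : Distr) (x₀ : ℝ) (C : Fin n → ℂ) : Prop :=
  ∃ (l u : ℝ) (φ : ℝ → ℂ), x₀ ∈ Ioo l u ∧ ContDiff ℝ ∞ φ ∧ AgreesOn ψ φ (Ioo l u) ∧
    ∀ j : Fin n, iteratedDeriv j φ x₀ = C j

/-- The singular set of the equation. -/
def singularSet (a b : Fin (n + 1) → Distr) : Set ℝ :=
  ⋃ i, (singSupp (a i) ∪ singSupp (b i))

/-- The maximal order of the coefficients. -/
def maxOrder (a b : Fin (n + 1) → Distr) : ℕ∞ :=
  ⨆ i, max (order (a i)) (order (b i))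

/-- `F(x⁻) = c`: to the left of `x` and close to `x`, `F` is a smooth function with limit `c`. -/
def HasLeftValue (F : Distr) (x : ℝ) (c : ℂ) : Prop :=
  ∃ (ε : ℝ) (g : ℝ → ℂ), 0 < ε ∧ ContDiffOn ℝ ∞ g (Ioo (x - ε) x) ∧
    AgreesOn F g (Ioo (x - ε) x) ∧ Tendsto g (𝓝[<] x) (𝓝 c)

/-- `F(x⁺) = c`: to the right of `x` and close to `x`, `F` is a smooth function with limit `c`. -/
def HasRightValue (F : Distr) (x : ℝ) (c : ℂ) : Prop :=
  ∃ (ε : ℝ) (g : ℝ → ℂ), 0 < ε ∧ ContDiffOn ℝ ∞ g (Ioo x (x + ε)) ∧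
    AgreesOn F g (Ioo x (x + ε)) ∧ Tendsto g (𝓝[>] x) (𝓝 c)

/-- `g` is a smooth extension to the closed interval `closure Ω` of the restriction of `F` to the
open interval `Ω`. -/
def IsClosedExtension (F : Distr) (Ω : Set ℝ) (g : ℝ → ℂ) : Prop :=
  ContDiffOn ℝ ∞ g (closure Ω) ∧ AgreesOn F g Ω

/-- `a_n(x⁻) + b_n(x⁺) ≠ 0` at every singular point `x`. -/
def NondegenerateAtSingular (a b : Fin (n + 1) → Distr) : Prop :=
  ∀ x ∈ singularSet a b, ∃ c d : ℂ,
    HasLeftValue (a (Fin.last n)) x c ∧ HasRightValue (b (Fin.last n)) x d ∧ c + d ≠ 0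

/-- For every open interval `Ω` without singular points, the sum of the smooth extensions of
`a_n` and `b_n` from `Ω` to the closure of `Ω` has no zero there. -/
def NondegenerateOnRegular (a b : Fin (n + 1) → Distr) : Prop :=
  ∀ Ω : Set ℝ, IsOpen Ω → Ω.OrdConnected → Disjoint Ω (singularSet a b) →
    ∃ α β : ℝ → ℂ, IsClosedExtension (a (Fin.last n)) Ω α ∧
      IsClosedExtension (b (Fin.last n)) Ω β ∧ ∀ x ∈ closure Ω, α x + β x ≠ 0

variable {m : ℕ}

/-- The `k`-th of the `m + 1` open intervals cut out by the points `ξ 0 < … < ξ (m - 1)`: it lies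
to the right of `ξ j` for `j < k` and to the left of `ξ j` for `j ≥ k`. -/
def piece (ξ : Fin m → ℝ) (k : Fin (m + 1)) : Set ℝ :=
  {x | ∀ j : Fin m, ((j : ℕ) < k → ξ j < x) ∧ ((k : ℕ) ≤ j → x < ξ j)}

/-- The regular distribution `∑ k, χ_{Ω_k} p_k`, where `Ω_k = piece ξ k`. -/
def glue (ξ : Fin m → ℝ) (p : Fin (m + 1) → ℝ → ℂ) : Distr :=
  ofFun (fun x => ∑ k, (piece ξ k).indicator (p k) x)

/-- `(g(x), g'(x), …, g⁽ⁿ⁻¹⁾(x))` for a function `g` on the set `s` (one-sided derivatives at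
boundary points of a closed interval). -/
def jet (n : ℕ) (g : ℝ → ℂ) (s : Set ℝ) (x : ℝ) : Fin n → ℂ :=
  fun j => iteratedDerivWithin j g s x

/-- `q` solves the regular equation `∑ i ≤ n, (a_i + b_i) q⁽ⁱ⁾ = f` on the closure of the open
interval `Ω`, the coefficients being extended smoothly from `Ω` to its closure. -/
def SolvesOnClosure (a b : Fin (n + 1) → Distr) (f : ℝ → ℂ) (Ω : Set ℝ) (q : ℝ → ℂ) : Prop :=
  ∃ α β : Fin (n + 1) → ℝ → ℂ, (∀ i, IsClosedExtension (a i) Ω (α i)) ∧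
    (∀ i, IsClosedExtension (b i) Ω (β i)) ∧
    ∀ x ∈ closure Ω,
      ∑ i : Fin (n + 1), (α i x + β i x) * iteratedDerivWithin i q (closure Ω) x = f x

end SingularODE

end

/-!
Every element of `𝒜` is the sum of a piecewise smooth function (its regular part) and a combination
of derivatives of Dirac distributions at finitely many points (its point part), see
`exists_hasRep_of_mem_spaceA`. Both parts are unique (`HasRep.eqOn_of_agreesOn`), and they can be
followed through differentiation (`HasRep.deriv`) and through the product `*`
(`HasRep.starProd`): in the product `F * G`, the point part of `F` is multiplied by the right jets
of the regular part of `G`, and the point part of `G` by the left jets of the regular part of `F`. The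
equation therefore splits into an ordinary differential equation for the regular part of `ψ` and the
vanishing of certain coefficients `eqnCoeff` at every point (`CoeffRep.equation_iff`).

A distribution of order at most `n` contains no derivatives of order `n` or more of a Dirac
distribution (`HasRep.coeff_eq_zero_of_order_le`). Hence the coefficients of index `n` and more come
only from the point parts of the `ψ⁽ⁱ⁾`, the highest one from `ψ⁽ⁿ⁾`, multiplied by
`a_n(x⁻) + b_n(x⁺) ≠ 0`. By descending induction `ψ` has no point part
(`coeff_eq_zero_of_eqnCoeff`). The same argument shows that the derivatives of order less than `n`
do not jump at a regular point (`jump_eq_zero_of_eqnCoeff`), and then no derivative does, because the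
differential equation determines the higher ones. So `ψ` consists of functions smooth on the closed
intervals `closure Ω_k` (`IsSolution.exists_eq_glue`). What is left of the equation at a singular
point are `n` linear relations between left and right jets of `ψ`. The differential equation
eliminates all derivatives of order at least `n` from them, which yields the interface matrices
(`exists_interface_matrices`, `exists_interface_conditions`).

On a closed interval the solutions of the differential equation are parametrized by their data at
any point of it, end points included (`exists_scalar_solution`, `scalar_solution_unique`). If the
matrices leading away from the `k`-th interval are invertible, data given there determine the
solutions on the neighbouring intervals one after the other. If one of them is singular, the one
farthest from the `k`-th interval, with a kernel vector added to the data beyond it, gives a second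
solution (`existsUnique_transmission_iff`).
-/

noncomputable section

namespace SingularODE

/-! ### Test functions and derivatives of the Dirac distribution -/

theorem contDiff_ofReal_test (t : Test) : ContDiff ℝ ∞ (fun x => (t x : ℂ)) :=
  Complex.ofRealCLM.contDiff.comp t.contDiff

theorem hasCompactSupport_ofReal_test (t : Test) : HasCompactSupport (fun x => (t x : ℂ)) :=
  t.hasCompactSupport.comp_left (g := fun y : ℝ => (y : ℂ)) Complex.ofReal_zero

/-- A smooth compactly supported real function as a test function. -/
def mkTest (h : ℝ → ℝ) (h₁ : ContDiff ℝ ∞ h) (h₂ : HasCompactSupport h) : Test :=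
  ⟨h, h₁, h₂, fun _ _ => trivial⟩

@[simp] theorem mkTest_apply (h : ℝ → ℝ) (h₁ : ContDiff ℝ ∞ h) (h₂ : HasCompactSupport h) (x : ℝ) :
    mkTest h h₁ h₂ x = h x := rfl

/-- The derivative of a test function. -/
def testDeriv (t : Test) : Test := LineDeriv.lineDerivOp (1 : ℝ) t

theorem testDeriv_apply (t : Test) (x : ℝ) : testDeriv t x = deriv t x := by
  have h : testDeriv t x = lineDeriv ℝ t x 1 := by
    unfold testDeriv
    rw [TestFunction.lineDerivOp_eq_lineDerivCLM ℝ, TestFunction.lineDerivCLM_apply]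
    simp
  rw [h, DifferentiableAt.lineDeriv_eq_fderiv
    ((t.contDiff.differentiable (by simp)) x), fderiv_eq_smul_deriv]
  simp

theorem lineDerivOp_apply_test (G : Distr) (t : Test) :
    (LineDeriv.lineDerivOp (1 : ℝ) G : Distr) t = -G (testDeriv t) := by
  rw [Distribution.lineDerivOp_apply_apply, map_neg]; rfl

theorem hasDerivAt_ofReal_test (t : Test) (x : ℝ) :
    HasDerivAt (fun x => (t x : ℂ)) (testDeriv t x : ℂ) x := by
  rw [testDeriv_apply]
  exact ((t.contDiff.differentiable (by simp)) x).hasDerivAt.ofReal_comp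

theorem iteratedDeriv_testDeriv (t : Test) (j : ℕ) (s : ℝ) :
    iteratedDeriv j (fun x => (testDeriv t x : ℂ)) s =
      iteratedDeriv (j + 1) (fun x => (t x : ℂ)) s := by
  rw [iteratedDeriv_succ']
  congr 1
  funext x
  exact (hasDerivAt_ofReal_test t x).deriv.symm

theorem iteratedDeriv_ofReal_test (t : Test) (j : ℕ) (s : ℝ) :
    iteratedDeriv j (fun x => (t x : ℂ)) s = (iteratedDeriv j t s : ℝ) := by
  induction j generalizing t with
  | zero => simp
  | succ j ih =>
    rw [← iteratedDeriv_testDeriv, ih, iteratedDeriv_succ']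
    have h : (testDeriv t : ℝ → ℝ) = deriv t := funext (testDeriv_apply t)
    rw [h]

theorem exists_distr_iteratedDeriv (s : ℝ) (j : ℕ) (z : ℂ) :
    ∃ F : Distr, ∀ t : Test, F t = z * iteratedDeriv j (fun x => (t x : ℂ)) s := by
  induction j with
  | zero =>
    refine ⟨Distribution.mapCLM ((ContinuousLinearMap.id ℝ ℝ).smulRight z)
      (Distribution.delta s), fun t => ?_⟩
    simp [mul_comm]
  | succ j ih =>
    obtain ⟨F, hF⟩ := ih
    refine ⟨-(LineDeriv.lineDerivOp (1 : ℝ) F), fun t => ?_⟩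
    have : (-(LineDeriv.lineDerivOp (1 : ℝ) F : Distr)) t =
      -((LineDeriv.lineDerivOp (1 : ℝ) F : Distr) t) := rfl
    rw [this, lineDerivOp_apply_test, neg_neg, hF, iteratedDeriv_testDeriv]

/-- The combination `∑ s ∈ T, ∑ j < N, c s j * τ⁽ʲ⁾(s)` of point evaluations of derivatives: the
value at `τ` of a distribution supported in the finite set `T`. (The signs of the derivatives of
the Dirac distributions are absorbed into the coefficients.) -/
def pointPart (T : Finset ℝ) (N : ℕ) (c : ℝ → ℕ → ℂ) (τ : ℝ → ℂ) : ℂ :=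
  ∑ s ∈ T, ∑ j ∈ Finset.range N, c s j * iteratedDeriv j τ s

theorem distr_sum_apply {ι : Type*} (A : Finset ι) (F : ι → Distr) (t : Test) :
    (∑ i ∈ A, F i) t = ∑ i ∈ A, F i t := by
  classical
  induction A using Finset.induction_on with
  | empty => rfl
  | insert i A hi ih =>
    rw [Finset.sum_insert hi, Finset.sum_insert hi, ← ih]
    rfl

theorem exists_distr_pointPart (T : Finset ℝ) (N : ℕ) (c : ℝ → ℕ → ℂ) :
    ∃ F : Distr, ∀ t : Test, F t = pointPart T N c (fun x => (t x : ℂ)) := by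
  choose F hF using exists_distr_iteratedDeriv
  refine ⟨∑ s ∈ T, ∑ j ∈ Finset.range N, F s j (c s j), fun t => ?_⟩
  simp only [distr_sum_apply, hF, pointPart]

theorem pointPart_mono {T T' : Finset ℝ} {N N' : ℕ} {c : ℝ → ℕ → ℂ} (hT : T ⊆ T') (hN : N ≤ N')
    (hcT : ∀ s ∉ T, ∀ j, c s j = 0) (hcN : ∀ s j, N ≤ j → c s j = 0) (τ : ℝ → ℂ) :
    pointPart T' N' c τ = pointPart T N c τ := by
  unfold pointPart
  symm
  rw [Finset.sum_subset hT (fun s _ hs => Finset.sum_eq_zero fun j _ => by rw [hcT s hs, zero_mul])]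
  refine Finset.sum_congr rfl fun s _ => ?_
  refine Finset.sum_subset (Finset.range_mono hN) fun j _ hj => ?_
  rw [hcN s j (by simpa using hj), zero_mul]

theorem pointPart_congr {T : Finset ℝ} {N : ℕ} {c : ℝ → ℕ → ℂ} {τ σ : ℝ → ℂ}
    (h : ∀ s ∈ T, τ =ᶠ[𝓝 s] σ ∨ ∀ j, c s j = 0) : pointPart T N c τ = pointPart T N c σ := by
  refine Finset.sum_congr rfl fun s hs => Finset.sum_congr rfl fun j _ => ?_
  rcases h s hs with h | h
  · rw [h.iteratedDeriv_eq]
  · rw [h, zero_mul, zero_mul]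

/-! ### Test functions with prescribed derivatives at a point -/

theorem contDiff_pow_mul_bump (j : ℕ) (χ : ContDiffBump (0 : ℝ)) :
    ContDiff ℝ ∞ (fun x : ℝ => x ^ j / (j.factorial : ℝ) * χ x) :=
  ((contDiff_id.pow j).div_const _).mul χ.contDiff

theorem exists_test_monomial (j : ℕ) : ∃ θ : Test, tsupport θ ⊆ Icc (-1) 1 ∧
    ∀ i, iteratedDeriv i θ 0 = if i = j then 1 else 0 := by
  let χ : ContDiffBump (0 : ℝ) := ⟨1 / 2, 1, by norm_num, by norm_num⟩
  refine ⟨mkTest _ (contDiff_pow_mul_bump j χ) (χ.hasCompactSupport.mul_left), ?_, fun i => ?_⟩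
  · refine (tsupport_mul_subset_right (f := fun x : ℝ => x ^ j / (j.factorial : ℝ))
      (g := χ)).trans ?_
    rw [χ.tsupport_eq, Real.closedBall_eq_Icc]
    simp [χ]
  · have h : (mkTest _ (contDiff_pow_mul_bump j χ) (χ.hasCompactSupport.mul_left) : ℝ → ℝ)
        =ᶠ[𝓝 0] fun x => x ^ j / (j.factorial : ℝ) := by
      filter_upwards [χ.eventuallyEq_one] with x hx
      simp [hx]
    rw [h.iteratedDeriv_eq, iteratedDeriv_div_const]
    have h2 : iteratedDeriv i (fun x : ℝ => x ^ j) 0 = if i = j then (j.factorial : ℝ) else 0 := by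
      rw [iteratedDeriv_fun_pow_zero]; push_cast; rfl
    rw [h2]
    split_ifs
    · field_simp
    · simp

/-- The rescaled test function `x ↦ r⁻ʲ θ (r (x - s))`. -/
def scaleTest (θ : Test) (j : ℕ) (s r : ℝ) (hr : 0 < r) : Test :=
  mkTest (fun x => (r ^ j)⁻¹ * θ (r * (x - s)))
    (contDiff_const.mul
      (θ.contDiff.comp (contDiff_const.mul (contDiff_id.sub contDiff_const))))
    ((θ.hasCompactSupport.comp_homeomorph
      ((Homeomorph.subRight s).trans (Homeomorph.mulLeft₀ r hr.ne'))).mul_left)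

theorem scaleTest_apply (θ : Test) (j : ℕ) (s r : ℝ) (hr : 0 < r) (x : ℝ) :
    scaleTest θ j s r hr x = (r ^ j)⁻¹ * θ (r * (x - s)) := rfl

theorem iteratedDeriv_scaleTest (θ : Test) (j : ℕ) (s r : ℝ) (hr : 0 < r) (i : ℕ) (x : ℝ) :
    iteratedDeriv i (scaleTest θ j s r hr) x =
      (r ^ j)⁻¹ * (r ^ i * iteratedDeriv i θ (r * (x - s))) := by
  have h1 : (scaleTest θ j s r hr : ℝ → ℝ) =
      fun x => (r ^ j)⁻¹ * (fun y => (fun z => θ (r * z)) (y - s)) x := rfl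
  have hc : ContDiff ℝ i θ := θ.contDiff.of_le (by exact_mod_cast le_top)
  rw [h1, iteratedDeriv_const_mul_field,
    congrFun (iteratedDeriv_comp_sub_const i (fun z => θ (r * z)) s) x,
    iteratedDeriv_comp_const_mul hc]

theorem tsupport_scaleTest {θ : Test} (hθ : tsupport θ ⊆ Icc (-1) 1) (j : ℕ) (s r : ℝ)
    (hr : 0 < r) : tsupport (scaleTest θ j s r hr) ⊆ Icc (s - 1 / r) (s + 1 / r) := by
  refine closure_minimal (fun x hx => ?_) isClosed_Icc
  have h : θ (r * (x - s)) ≠ 0 := fun h => hx (by simp [scaleTest_apply, h])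
  have h2 := hθ (subset_tsupport _ h)
  have hr' : r * (1 / r) = 1 := by field_simp
  constructor <;> nlinarith [h2.1, h2.2]

/-- There are test functions with small support and with a prescribed unit jet at a point. -/
theorem exists_test_jet {U : Set ℝ} (hU : IsOpen U) {s : ℝ} (hs : s ∈ U) (j : ℕ) :
    ∃ t : Test, tsupport t ⊆ U ∧
      ∀ i, iteratedDeriv i (fun x => (t x : ℂ)) s = if i = j then 1 else 0 := by
  obtain ⟨θ, hθ, hj⟩ := exists_test_monomial j
  obtain ⟨δ, hδ, hU'⟩ := Metric.isOpen_iff.1 hU s hs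
  have hr : 0 < 2 / δ := by positivity
  refine ⟨scaleTest θ j s (2 / δ) hr, (tsupport_scaleTest hθ _ _ _ hr).trans
    (fun x hx => hU' ?_), fun i => ?_⟩
  · rw [Real.ball_eq_Ioo]
    rw [one_div_div] at hx
    constructor <;> linarith [hx.1, hx.2]
  · rw [iteratedDeriv_ofReal_test, iteratedDeriv_scaleTest, sub_self, mul_zero, hj]
    split_ifs with h
    · subst h
      rw [mul_one, inv_mul_cancel₀ (pow_ne_zero _ hr.ne')]
      simp
    · simp

/-! ### Products of test functions with functions smooth near their support -/

theorem contDiff_mul_of_tsupport_subset {U : Set ℝ} (hU : IsOpen U) {g τ : ℝ → ℂ}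
    (hg : ContDiffOn ℝ ∞ g U) (hτ : ContDiff ℝ ∞ τ) (h : tsupport τ ⊆ U) :
    ContDiff ℝ ∞ (fun x => g x * τ x) := by
  rw [contDiff_iff_contDiffAt]
  intro x
  by_cases hx : x ∈ U
  · exact (hg.contDiffAt (hU.mem_nhds hx)).mul hτ.contDiffAt
  · have : (fun x => g x * τ x) =ᶠ[𝓝 x] fun _ => 0 := by
      filter_upwards [(isClosed_tsupport τ).isOpen_compl.mem_nhds fun hx' => hx (h hx')] with y hy
      rw [image_eq_zero_of_notMem_tsupport hy, mul_zero]
    exact contDiffAt_const.congr_of_eventuallyEq this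

/-- A smooth cut-off function separating two disjoint finite sets. -/
theorem exists_cutoff {T T' : Finset ℝ} (h : Disjoint T T') :
    ∃ χ : ℝ → ℝ, ContDiff ℝ ∞ χ ∧ (∀ s ∈ T, χ =ᶠ[𝓝 s] 0) ∧ ∀ s ∈ T', χ =ᶠ[𝓝 s] 1 := by
  have hd : Disjoint (T : Set ℝ) (T' : Set ℝ) := by exact_mod_cast h
  obtain ⟨χ, h0, h1, -⟩ := exists_contMDiffMap_zero_one_nhds_of_isClosed
    (n := ⊤) (modelWithCornersSelf ℝ ℝ) T.finite_toSet.isClosed T'.finite_toSet.isClosed hd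
  refine ⟨χ, χ.contMDiff.contDiff, fun s hs => ?_, fun s hs => ?_⟩
  · exact h0.filter_mono (nhds_le_nhdsSet hs)
  · exact h1.filter_mono (nhds_le_nhdsSet hs)

/-! ### Pairing with complex test functions -/

theorem contDiff_re {τ : ℝ → ℂ} (hτ : ContDiff ℝ ∞ τ) : ContDiff ℝ ∞ fun x => ((τ x).re : ℂ) :=
  Complex.ofRealCLM.contDiff.comp (Complex.reCLM.contDiff.comp hτ)

theorem contDiff_im {τ : ℝ → ℂ} (hτ : ContDiff ℝ ∞ τ) : ContDiff ℝ ∞ fun x => ((τ x).im : ℂ) :=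
  Complex.ofRealCLM.contDiff.comp (Complex.imCLM.contDiff.comp hτ)

theorem pointPart_re_add_im (T : Finset ℝ) (N : ℕ) (c : ℝ → ℕ → ℂ) {τ : ℝ → ℂ}
    (hτ : ContDiff ℝ ∞ τ) :
    pointPart T N c (fun x => ((τ x).re : ℂ)) +
      Complex.I * pointPart T N c (fun x => ((τ x).im : ℂ)) = pointPart T N c τ := by
  unfold pointPart
  rw [Finset.mul_sum, ← Finset.sum_add_distrib]
  refine Finset.sum_congr rfl fun s _ => ?_
  rw [Finset.mul_sum, ← Finset.sum_add_distrib]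
  refine Finset.sum_congr rfl fun j _ => ?_
  have h : τ = (fun x => ((τ x).re : ℂ)) + fun x => Complex.I * ((τ x).im : ℂ) := by
    funext x
    simp only [Pi.add_apply]
    rw [mul_comm, Complex.re_add_im]
  have hj : ((j : ℕ∞) : WithTop ℕ∞) ≤ ∞ := by exact_mod_cast le_top
  have hre : ContDiffAt ℝ j (fun x => ((τ x).re : ℂ)) s :=
    ((contDiff_re hτ).of_le hj).contDiffAt
  have him : ContDiffAt ℝ j (fun x => ((τ x).im : ℂ)) s :=
    ((contDiff_im hτ).of_le hj).contDiffAt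
  conv_rhs => rw [h, iteratedDeriv_add hre (contDiffAt_const.mul him),
    iteratedDeriv_const_mul_field]
  ring

/-- The values on complex test functions of a distribution with given regular and point parts. -/
theorem pair_eq {F : Distr} {T : Finset ℝ} {N : ℕ} {h : ℝ → ℂ} {c : ℝ → ℕ → ℂ}
    (hh : LocallyIntegrable h)
    (hF : ∀ t : Test, F t = (∫ x, (t x : ℂ) * h x) + pointPart T N c (fun x => (t x : ℂ)))
    {τ : ℝ → ℂ} (h₁ : ContDiff ℝ ∞ τ) (h₂ : HasCompactSupport τ) :
    pair F τ = (∫ x, τ x * h x) + pointPart T N c τ := by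
  rw [pair, dif_pos ⟨h₁, h₂⟩, hF, hF]
  have e1 : (fun x => (reTest τ h₁ h₂ x : ℂ)) = fun x => ((τ x).re : ℂ) := rfl
  have e2 : (fun x => (imTest τ h₁ h₂ x : ℂ)) = fun x => ((τ x).im : ℂ) := rfl
  have i1 : Integrable (fun x => ((τ x).re : ℂ) * h x) :=
    hh.integrable_smul_left_of_hasCompactSupport (contDiff_re h₁).continuous
      (hasCompactSupport_ofReal_test (reTest τ h₁ h₂))
  have i2 : Integrable (fun x => ((τ x).im : ℂ) * h x) :=
    hh.integrable_smul_left_of_hasCompactSupport (contDiff_im h₁).continuous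
      (hasCompactSupport_ofReal_test (imTest τ h₁ h₂))
  rw [e1, e2, ← pointPart_re_add_im T N c h₁, mul_add]
  have e3 : ∫ x, τ x * h x = (∫ x, ((τ x).re : ℂ) * h x) +
      Complex.I * ∫ x, ((τ x).im : ℂ) * h x := by
    rw [← integral_const_mul, ← integral_add i1 (i2.const_mul _)]
    refine integral_congr_ae (Eventually.of_forall fun x => ?_)
    change τ x * h x = ((τ x).re : ℂ) * h x + Complex.I * (((τ x).im : ℂ) * h x)
    conv_lhs => rw [← Complex.re_add_im (τ x)]
    ring
  have e4 : ∫ x, (reTest τ h₁ h₂ x : ℂ) * h x = ∫ x, ((τ x).re : ℂ) * h x := rfl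
  have e5 : ∫ x, (imTest τ h₁ h₂ x : ℂ) * h x = ∫ x, ((τ x).im : ℂ) * h x := rfl
  rw [e3, e4, e5]
  ring

/-! ### Uniqueness of the regular part and of the point part -/

theorem point_coeff_eq_zero {T : Finset ℝ} {N : ℕ} {c : ℝ → ℕ → ℂ} {U : Set ℝ} (hU : IsOpen U)
    (hcT : ∀ s ∉ T, ∀ j, c s j = 0) (hcN : ∀ s j, N ≤ j → c s j = 0)
    (h : ∀ t : Test, tsupport t ⊆ U → pointPart T N c (fun x => (t x : ℂ)) = 0)
    {s : ℝ} (hs : s ∈ U) (j : ℕ) : c s j = 0 := by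
  by_cases hsT : s ∈ T
  swap
  · exact hcT s hsT j
  by_cases hjN : j < N
  swap
  · exact hcN s j (not_lt.1 hjN)
  -- a test function whose support contains no other point of `T`
  have hV : IsOpen (U ∩ ((T.erase s : Finset ℝ) : Set ℝ)ᶜ) :=
    hU.inter (T.erase s).finite_toSet.isClosed.isOpen_compl
  obtain ⟨t, ht, hjet⟩ := exists_test_jet hV (s := s) ⟨hs, by simp⟩ j
  have h0 := h t (ht.trans inter_subset_left)
  unfold pointPart at h0
  rw [Finset.sum_eq_single s, Finset.sum_eq_single j] at h0
  · simpa [hjet] using h0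
  · intro i _ hij
    rw [hjet, if_neg hij, mul_zero]
  · intro hj
    exact absurd (Finset.mem_range.2 hjN) hj
  · intro r hr hrs
    refine Finset.sum_eq_zero fun i _ => ?_
    have : (fun x => (t x : ℂ)) =ᶠ[𝓝 r] fun _ => 0 := by
      have hrt : r ∉ tsupport t := fun hrt => (ht hrt).2 (by simp [hr, hrs])
      filter_upwards [(isClosed_tsupport t).isOpen_compl.mem_nhds hrt] with y hy
      rw [image_eq_zero_of_notMem_tsupport hy, Complex.ofReal_zero]
    rw [this.iteratedDeriv_eq]
    simp [iteratedDeriv_fun_const_zero]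
  · intro hs'
    exact absurd hsT hs'

theorem eqOn_of_agreesOn {F : Distr} {T : Finset ℝ} {N : ℕ} {h g : ℝ → ℂ} {c : ℝ → ℕ → ℂ}
    {U : Set ℝ} (hU : IsOpen U) (hh : LocallyIntegrable h)
    (hhc : ContinuousOn h (T : Set ℝ)ᶜ) (hg : ContinuousOn g U)
    (hF : ∀ t : Test, F t = (∫ x, (t x : ℂ) * h x) + pointPart T N c (fun x => (t x : ℂ)))
    (hFg : AgreesOn F g U) : ∀ x ∈ U, x ∉ T → h x = g x := by
  set V : Set ℝ := U ∩ (T : Set ℝ)ᶜ with hVdef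
  have hV : IsOpen V := hU.inter T.finite_toSet.isClosed.isOpen_compl
  have hcont : ContinuousOn (fun x => h x - g x) V :=
    (hhc.mono inter_subset_right).sub (hg.mono inter_subset_left)
  have hae : ∀ᵐ x, x ∈ V → h x - g x = 0 := by
    refine hV.ae_eq_zero_of_integral_contDiff_smul_eq_zero
      (hcont.locallyIntegrableOn hV.measurableSet) fun φ h₁ h₂ h₃ => ?_
    have e := hFg (mkTest φ h₁ h₂) (h₃.trans inter_subset_left)
    have hpp : pointPart T N c (fun x => ((mkTest φ h₁ h₂) x : ℂ)) = 0 := by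
      rw [pointPart_congr (σ := fun _ => 0)]
      · simp [pointPart, iteratedDeriv_fun_const_zero]
      · refine fun s hs => Or.inl ?_
        have hst : s ∉ tsupport φ := fun hst => (h₃ hst).2 hs
        filter_upwards [(isClosed_tsupport φ).isOpen_compl.mem_nhds hst] with y hy
        rw [mkTest_apply, image_eq_zero_of_notMem_tsupport hy, Complex.ofReal_zero]
    rw [hF, hpp, add_zero] at e
    have hφ : Continuous φ := h₁.continuous
    have i1 : Integrable (fun x => φ x • h x) :=
      hh.integrable_smul_left_of_hasCompactSupport hφ h₂
    have hsub : Integrable (fun x => φ x • (h x - g x)) := by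
      have hc : Continuous (fun x => φ x • (h x - g x)) := by
        rw [continuous_iff_continuousAt]
        intro x
        by_cases hx : x ∈ V
        · exact hφ.continuousAt.smul (hcont.continuousAt (hV.mem_nhds hx))
        · have : (fun x => φ x • (h x - g x)) =ᶠ[𝓝 x] fun _ => 0 := by
            filter_upwards [(isClosed_tsupport φ).isOpen_compl.mem_nhds fun hx' => hx (h₃ hx')]
              with y hy
            rw [image_eq_zero_of_notMem_tsupport hy, zero_smul]
          exact continuousAt_const.congr this.symm
      exact hc.integrable_of_hasCompactSupport h₂.smul_right
    have i2 : Integrable (fun x => φ x • g x) := by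
      refine (i1.sub hsub).congr (Eventually.of_forall fun x => ?_)
      simp only [Pi.sub_apply, smul_sub, sub_sub_cancel]
    simp only [smul_sub]
    rw [integral_sub i1 i2, sub_eq_zero]
    simpa using e
  have hE : EqOn (fun x => h x - g x) (fun _ => 0) V := by
    refine Measure.eqOn_open_of_ae_eq (μ := volume) ?_ hV hcont continuousOn_const
    rw [Filter.EventuallyEq, ae_restrict_iff' hV.measurableSet]
    exact hae
  intro x hx hxT
  exact sub_eq_zero.1 (hE ⟨hx, hxT⟩)

/-- A distribution that is a continuous function in `U` has no point part in `U`. -/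
theorem coeff_eq_zero_of_agreesOn {F : Distr} {T : Finset ℝ} {N : ℕ} {h g : ℝ → ℂ}
    {c : ℝ → ℕ → ℂ} {U : Set ℝ} (hU : IsOpen U) (hh : LocallyIntegrable h)
    (hhc : ContinuousOn h (T : Set ℝ)ᶜ) (hg : ContinuousOn g U)
    (hcT : ∀ s ∉ T, ∀ j, c s j = 0) (hcN : ∀ s j, N ≤ j → c s j = 0)
    (hF : ∀ t : Test, F t = (∫ x, (t x : ℂ) * h x) + pointPart T N c (fun x => (t x : ℂ)))
    (hFg : AgreesOn F g U) : ∀ s ∈ U, ∀ j, c s j = 0 := by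
  have heq := eqOn_of_agreesOn hU hh hhc hg hF hFg
  intro s hs j
  refine point_coeff_eq_zero hU hcT hcN (fun t ht => ?_) hs j
  have e := hFg t ht
  have hint : ∫ x, (t x : ℂ) * h x = ∫ x, (t x : ℂ) * g x := by
    refine integral_congr_ae ?_
    have hT : ∀ᵐ x, x ∉ (T : Set ℝ) := T.finite_toSet.countable.ae_notMem volume
    filter_upwards [hT] with x hx
    by_cases hxt : x ∈ tsupport t
    · rw [heq x (ht hxt) hx]
    · simp [image_eq_zero_of_notMem_tsupport hxt]
  rw [hF, hint] at e
  simpa using e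

/-! ### Piecewise smooth functions and their one-sided jets -/

/-- The limit at `s` from the left of the `j`-th derivative of `h` (meaningful only if the limit
exists, as it does for the functions in `PSmooth`). -/
def leftLim (h : ℝ → ℂ) (s : ℝ) (j : ℕ) : ℂ := limUnder (𝓝[<] s) (iteratedDeriv j h)

/-- The limit at `s` from the right of the `j`-th derivative of `h`. -/
def rightLim (h : ℝ → ℂ) (s : ℝ) (j : ℕ) : ℂ := limUnder (𝓝[>] s) (iteratedDeriv j h)

/-- `h` is smooth off the finite set `T`, and all its derivatives have one-sided limits
everywhere. The values at the points of `T` are immaterial, and points of `T` may be regular: this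
allows a common exceptional set for several functions. -/
structure PSmooth (T : Finset ℝ) (h : ℝ → ℂ) : Prop where
  smooth : ContDiffOn ℝ ∞ h (T : Set ℝ)ᶜ
  tendsto_left : ∀ s j, Tendsto (iteratedDeriv j h) (𝓝[<] s) (𝓝 (leftLim h s j))
  tendsto_right : ∀ s j, Tendsto (iteratedDeriv j h) (𝓝[>] s) (𝓝 (rightLim h s j))

theorem isOpen_compl_finset (T : Finset ℝ) : IsOpen (T : Set ℝ)ᶜ :=
  T.finite_toSet.isClosed.isOpen_compl

theorem eventually_notMem_finset_left (T : Finset ℝ) (s : ℝ) : ∀ᶠ x in 𝓝[<] s, x ∉ T := by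
  have h : ((T.erase s : Finset ℝ) : Set ℝ)ᶜ ∈ 𝓝 s :=
    (isOpen_compl_finset _).mem_nhds (by simp)
  filter_upwards [nhdsWithin_le_nhds h, self_mem_nhdsWithin] with x hx hxs hxT
  exact hx (by simp [hxT, (mem_Iio.1 hxs).ne])

theorem eventually_notMem_finset_right (T : Finset ℝ) (s : ℝ) : ∀ᶠ x in 𝓝[>] s, x ∉ T := by
  have h : ((T.erase s : Finset ℝ) : Set ℝ)ᶜ ∈ 𝓝 s :=
    (isOpen_compl_finset _).mem_nhds (by simp)
  filter_upwards [nhdsWithin_le_nhds h, self_mem_nhdsWithin] with x hx hxs hxT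
  exact hx (by simp [hxT, (mem_Ioi.1 hxs).ne'])

theorem contDiffAt_of_contDiffOn_compl {T : Finset ℝ} {h : ℝ → ℂ}
    (H : ContDiffOn ℝ ∞ h (T : Set ℝ)ᶜ) {x : ℝ} (hx : x ∉ T) : ContDiffAt ℝ ∞ h x :=
  H.contDiffAt ((isOpen_compl_finset T).mem_nhds hx)

theorem contDiffAt_iteratedDeriv {h : ℝ → ℂ} {x : ℝ} (H : ContDiffAt ℝ ∞ h x) (j : ℕ) :
    ContDiffAt ℝ ∞ (iteratedDeriv j h) x := by
  induction j with
  | zero => simpa using H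
  | succ j ih =>
    rw [iteratedDeriv_succ]
    exact (ih.fderiv_right (m := ∞) (by simp)).clm_apply contDiffAt_const

theorem continuousAt_iteratedDeriv {h : ℝ → ℂ} {x : ℝ} (H : ContDiffAt ℝ ∞ h x) (j : ℕ) :
    ContinuousAt (iteratedDeriv j h) x :=
  (contDiffAt_iteratedDeriv H j).continuousAt

namespace PSmooth

variable {T T' : Finset ℝ} {g h : ℝ → ℂ}

theorem of_tendsto (hs : ContDiffOn ℝ ∞ h (T : Set ℝ)ᶜ)
    (hl : ∀ s ∈ T, ∀ j, ∃ l, Tendsto (iteratedDeriv j h) (𝓝[<] s) (𝓝 l))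
    (hr : ∀ s ∈ T, ∀ j, ∃ r, Tendsto (iteratedDeriv j h) (𝓝[>] s) (𝓝 r)) : PSmooth T h := by
  refine ⟨hs, fun s j => ?_, fun s j => ?_⟩
  · by_cases hsT : s ∈ T
    · exact tendsto_nhds_limUnder (hl s hsT j)
    · exact tendsto_nhds_limUnder ⟨_, (continuousAt_iteratedDeriv
        (contDiffAt_of_contDiffOn_compl hs hsT) j).mono_left nhdsWithin_le_nhds⟩
  · by_cases hsT : s ∈ T
    · exact tendsto_nhds_limUnder (hr s hsT j)
    · exact tendsto_nhds_limUnder ⟨_, (continuousAt_iteratedDeriv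
        (contDiffAt_of_contDiffOn_compl hs hsT) j).mono_left nhdsWithin_le_nhds⟩

theorem contDiffAt (H : PSmooth T h) {x : ℝ} (hx : x ∉ T) : ContDiffAt ℝ ∞ h x :=
  contDiffAt_of_contDiffOn_compl H.smooth hx

theorem mono (H : PSmooth T h) (hT : T ⊆ T') : PSmooth T' h :=
  ⟨H.smooth.mono (compl_subset_compl.2 (by exact_mod_cast hT)), H.tendsto_left, H.tendsto_right⟩

end PSmooth

theorem leftLim_eq {h : ℝ → ℂ} {s : ℝ} {j : ℕ} {l : ℂ}
    (H : Tendsto (iteratedDeriv j h) (𝓝[<] s) (𝓝 l)) : leftLim h s j = l :=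
  H.limUnder_eq

theorem rightLim_eq {h : ℝ → ℂ} {s : ℝ} {j : ℕ} {l : ℂ}
    (H : Tendsto (iteratedDeriv j h) (𝓝[>] s) (𝓝 l)) : rightLim h s j = l :=
  H.limUnder_eq

theorem leftLim_of_contDiffAt {h : ℝ → ℂ} {s : ℝ} (H : ContDiffAt ℝ ∞ h s) (j : ℕ) :
    leftLim h s j = iteratedDeriv j h s :=
  leftLim_eq ((continuousAt_iteratedDeriv H j).mono_left nhdsWithin_le_nhds)

theorem rightLim_of_contDiffAt {h : ℝ → ℂ} {s : ℝ} (H : ContDiffAt ℝ ∞ h s) (j : ℕ) :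
    rightLim h s j = iteratedDeriv j h s :=
  rightLim_eq ((continuousAt_iteratedDeriv H j).mono_left nhdsWithin_le_nhds)

theorem leftLim_congr {g h : ℝ → ℂ} {s : ℝ} (H : ∀ᶠ x in 𝓝[<] s, g =ᶠ[𝓝 x] h) (j : ℕ) :
    leftLim g s j = leftLim h s j := by
  have : iteratedDeriv j g =ᶠ[𝓝[<] s] iteratedDeriv j h :=
    H.mono fun x hx => hx.iteratedDeriv_eq j
  unfold leftLim limUnder
  rw [Filter.map_congr this]

theorem rightLim_congr {g h : ℝ → ℂ} {s : ℝ} (H : ∀ᶠ x in 𝓝[>] s, g =ᶠ[𝓝 x] h) (j : ℕ) :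
    rightLim g s j = rightLim h s j := by
  have : iteratedDeriv j g =ᶠ[𝓝[>] s] iteratedDeriv j h :=
    H.mono fun x hx => hx.iteratedDeriv_eq j
  unfold rightLim limUnder
  rw [Filter.map_congr this]

theorem iteratedDeriv_iteratedDeriv (i j : ℕ) (h : ℝ → ℂ) :
    iteratedDeriv j (iteratedDeriv i h) = iteratedDeriv (i + j) h := by
  simp only [iteratedDeriv_eq_iterate]
  rw [← Function.iterate_add_apply, add_comm]

theorem leftLim_iteratedDeriv (h : ℝ → ℂ) (i : ℕ) (s : ℝ) (j : ℕ) :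
    leftLim (iteratedDeriv i h) s j = leftLim h s (i + j) := by
  unfold leftLim
  rw [iteratedDeriv_iteratedDeriv]

theorem rightLim_iteratedDeriv (h : ℝ → ℂ) (i : ℕ) (s : ℝ) (j : ℕ) :
    rightLim (iteratedDeriv i h) s j = rightLim h s (i + j) := by
  unfold rightLim
  rw [iteratedDeriv_iteratedDeriv]

namespace PSmooth

variable {T T' : Finset ℝ} {g h : ℝ → ℂ}

theorem iterDeriv (H : PSmooth T h) (i : ℕ) : PSmooth T (iteratedDeriv i h) := by
  refine of_tendsto (fun x hx => ((contDiffAt_iteratedDeriv (H.contDiffAt hx) i)).contDiffWithinAt)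
    (fun s _ j => ?_) (fun s _ j => ?_)
  · rw [iteratedDeriv_iteratedDeriv]
    exact ⟨_, H.tendsto_left s _⟩
  · rw [iteratedDeriv_iteratedDeriv]
    exact ⟨_, H.tendsto_right s _⟩

theorem iteratedDeriv_add_tendsto (hg : PSmooth T g) (hh : PSmooth T h) {l : Filter ℝ}
    (hl : ∀ᶠ x in l, x ∉ T) {j : ℕ} {a b : ℂ}
    (ha : Tendsto (iteratedDeriv j g) l (𝓝 a))
    (hb : Tendsto (iteratedDeriv j h) l (𝓝 b)) :
    Tendsto (iteratedDeriv j (fun x => g x + h x)) l (𝓝 (a + b)) := by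
  refine (ha.add hb).congr' ?_
  filter_upwards [hl] with x hx
  exact (iteratedDeriv_add ((hg.contDiffAt hx).of_le (by exact_mod_cast le_top))
    ((hh.contDiffAt hx).of_le (by exact_mod_cast le_top))).symm

theorem add (hg : PSmooth T g) (hh : PSmooth T h) : PSmooth T (fun x => g x + h x) :=
  of_tendsto (hg.smooth.add hh.smooth)
    (fun s _ j => ⟨_, hg.iteratedDeriv_add_tendsto hh (eventually_notMem_finset_left T s)
      (hg.tendsto_left s j) (hh.tendsto_left s j)⟩)
    (fun s _ j => ⟨_, hg.iteratedDeriv_add_tendsto hh (eventually_notMem_finset_right T s)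
      (hg.tendsto_right s j) (hh.tendsto_right s j)⟩)

theorem leftLim_add (hg : PSmooth T g) (hh : PSmooth T h) (s : ℝ) (j : ℕ) :
    leftLim (fun x => g x + h x) s j = leftLim g s j + leftLim h s j :=
  leftLim_eq (hg.iteratedDeriv_add_tendsto hh (eventually_notMem_finset_left T s)
      (hg.tendsto_left s j) (hh.tendsto_left s j))

theorem rightLim_add (hg : PSmooth T g) (hh : PSmooth T h) (s : ℝ) (j : ℕ) :
    rightLim (fun x => g x + h x) s j = rightLim g s j + rightLim h s j :=
  rightLim_eq (hg.iteratedDeriv_add_tendsto hh (eventually_notMem_finset_right T s)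
      (hg.tendsto_right s j) (hh.tendsto_right s j))

theorem iteratedDeriv_mul_tendsto (hg : PSmooth T g) (hh : PSmooth T h) {l : Filter ℝ}
    (hl : ∀ᶠ x in l, x ∉ T) {a b : ℕ → ℂ}
    (ha : ∀ j, Tendsto (iteratedDeriv j g) l (𝓝 (a j)))
    (hb : ∀ j, Tendsto (iteratedDeriv j h) l (𝓝 (b j))) (j : ℕ) :
    Tendsto (iteratedDeriv j (fun x => g x * h x)) l
      (𝓝 (∑ i ∈ Finset.range (j + 1), (j.choose i : ℂ) * a i * b (j - i))) := by
  have := tendsto_finsetSum (Finset.range (j + 1)) fun i _ =>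
    ((ha i).const_mul (j.choose i : ℂ)).mul (hb (j - i))
  refine this.congr' ?_
  filter_upwards [hl] with x hx
  exact (iteratedDeriv_mul ((hg.contDiffAt hx).of_le (by exact_mod_cast le_top))
    ((hh.contDiffAt hx).of_le (by exact_mod_cast le_top))).symm

theorem mul (hg : PSmooth T g) (hh : PSmooth T h) : PSmooth T (fun x => g x * h x) :=
  of_tendsto (hg.smooth.mul hh.smooth)
    (fun s _ j => ⟨_, hg.iteratedDeriv_mul_tendsto hh (eventually_notMem_finset_left T s)
      (hg.tendsto_left s) (hh.tendsto_left s) j⟩)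
    (fun s _ j => ⟨_, hg.iteratedDeriv_mul_tendsto hh (eventually_notMem_finset_right T s)
      (hg.tendsto_right s) (hh.tendsto_right s) j⟩)

theorem leftLim_mul (hg : PSmooth T g) (hh : PSmooth T h) (s : ℝ) (j : ℕ) :
    leftLim (fun x => g x * h x) s j =
      ∑ i ∈ Finset.range (j + 1), (j.choose i : ℂ) * leftLim g s i * leftLim h s (j - i) :=
  leftLim_eq (hg.iteratedDeriv_mul_tendsto hh (eventually_notMem_finset_left T s)
      (hg.tendsto_left s) (hh.tendsto_left s) j)

theorem rightLim_mul (hg : PSmooth T g) (hh : PSmooth T h) (s : ℝ) (j : ℕ) :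
    rightLim (fun x => g x * h x) s j =
      ∑ i ∈ Finset.range (j + 1), (j.choose i : ℂ) * rightLim g s i * rightLim h s (j - i) :=
  rightLim_eq (hg.iteratedDeriv_mul_tendsto hh (eventually_notMem_finset_right T s)
      (hg.tendsto_right s) (hh.tendsto_right s) j)

theorem of_contDiff (hh : ContDiff ℝ ∞ h) : PSmooth T h :=
  of_tendsto hh.contDiffOn
    (fun s _ j => ⟨_, (continuousAt_iteratedDeriv (hh.contDiffAt (x := s)) j).mono_left
      nhdsWithin_le_nhds⟩)
    (fun s _ j => ⟨_, (continuousAt_iteratedDeriv (hh.contDiffAt (x := s)) j).mono_left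
      nhdsWithin_le_nhds⟩)

theorem sum {ι : Type*} (A : Finset ι) {f : ι → ℝ → ℂ} (hf : ∀ i ∈ A, PSmooth T (f i)) :
    PSmooth T (fun x => ∑ i ∈ A, f i x) := by
  classical
  induction A using Finset.induction_on with
  | empty => simpa using of_contDiff contDiff_const
  | insert i A hi ih =>
    simp only [Finset.sum_insert hi]
    exact (hf i (by simp)).add (ih fun j hj => hf j (by simp [hj]))

theorem shift (H : PSmooth T h) (ε : ℝ) :
    PSmooth (T.image (fun x => x - ε)) (fun x => h (x + ε)) := by
  have hmap : ∀ s, Tendsto (fun x : ℝ => x + ε) (𝓝 s) (𝓝 (s + ε)) := fun s =>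
    (continuous_id.add continuous_const).tendsto s
  refine of_tendsto (fun x hx => ?_) (fun s _ j => ⟨leftLim h (s + ε) j, ?_⟩)
    (fun s _ j => ⟨rightLim h (s + ε) j, ?_⟩)
  · have hx' : x + ε ∉ T := fun h => hx (by simpa using ⟨x + ε, h, by ring⟩)
    exact ((H.contDiffAt hx').comp x (contDiffAt_id.add contDiffAt_const)).contDiffWithinAt
  · rw [iteratedDeriv_comp_add_const]
    refine (H.tendsto_left (s + ε) j).comp
      (tendsto_nhdsWithin_of_tendsto_nhds_of_eventually_within _
        ((hmap s).mono_left nhdsWithin_le_nhds) ?_)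
    filter_upwards [self_mem_nhdsWithin] with x hx
    simpa using hx
  · rw [iteratedDeriv_comp_add_const]
    refine (H.tendsto_right (s + ε) j).comp
      (tendsto_nhdsWithin_of_tendsto_nhds_of_eventually_within _
        ((hmap s).mono_left nhdsWithin_le_nhds) ?_)
    filter_upwards [self_mem_nhdsWithin] with x hx
    simpa using hx

theorem locallyIntegrable (H : PSmooth T h) : LocallyIntegrable h := by
  have hm : AEStronglyMeasurable h volume := by
    have h1 : AEStronglyMeasurable h (volume.restrict (T : Set ℝ)ᶜ) :=
      H.smooth.continuousOn.aestronglyMeasurable T.measurableSet.compl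
    have h2 : volume.restrict (T : Set ℝ)ᶜ = volume :=
      Measure.restrict_eq_self_of_ae_mem (T.finite_toSet.countable.ae_notMem volume)
    rwa [h2] at h1
  intro x
  have hx : 𝓝 x = 𝓝[<] x ⊔ (pure x ⊔ 𝓝[>] x) := by
    rw [← nhdsNE_sup_pure, ← nhdsLT_sup_nhdsGT, sup_assoc, sup_comm (pure x)]
  have h0 := H.tendsto_left x 0
  have h1 := H.tendsto_right x 0
  rw [iteratedDeriv_zero] at h0 h1
  rw [hx, IntegrableAtFilter.sup_iff, IntegrableAtFilter.sup_iff]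
  refine ⟨?_, ⟨{x}, mem_pure.2 rfl, by simp⟩, ?_⟩
  · exact (volume.finiteAt_nhdsWithin x _).integrableAtFilter_of_tendsto
      (hm.stronglyMeasurableAtFilter) h0
  · exact (volume.finiteAt_nhdsWithin x _).integrableAtFilter_of_tendsto
      (hm.stronglyMeasurableAtFilter) h1

theorem exists_bound (H : PSmooth T h) {K : Set ℝ} (hK : IsCompact K) :
    ∃ C : ℝ, ∀ x ∈ K, ‖h x‖ ≤ C := by
  refine hK.induction_on (p := fun K => ∃ C : ℝ, ∀ x ∈ K, ‖h x‖ ≤ C) ⟨0, by simp⟩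
    (fun s t hst ⟨C, hC⟩ => ⟨C, fun x hx => hC x (hst hx)⟩)
    (fun s t ⟨C, hC⟩ ⟨D, hD⟩ => ⟨max C D, fun x hx => hx.elim
      (fun hx => (hC x hx).trans (le_max_left _ _))
      (fun hx => (hD x hx).trans (le_max_right _ _))⟩) fun x _ => ?_
  have h0 := (H.tendsto_left x 0).norm.eventually_le_const (lt_add_one _)
  have h1 := (H.tendsto_right x 0).norm.eventually_le_const (lt_add_one _)
  rw [iteratedDeriv_zero] at h0 h1
  refine ⟨{y | ‖h y‖ ≤ max (max (‖leftLim h x 0‖ + 1) (‖rightLim h x 0‖ + 1)) ‖h x‖},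
    mem_nhdsWithin_of_mem_nhds ?_, _, fun y hy => hy⟩
  have hx : 𝓝 x = 𝓝[<] x ⊔ (pure x ⊔ 𝓝[>] x) := by
    rw [← nhdsNE_sup_pure, ← nhdsLT_sup_nhdsGT, sup_assoc, sup_comm (pure x)]
  rw [hx]
  refine mem_sup.2 ⟨?_, mem_sup.2 ⟨mem_pure.2 ?_, ?_⟩⟩
  · exact h0.mono fun y hy => le_max_of_le_left (le_max_of_le_left hy)
  · exact (le_max_right _ _ : ‖h x‖ ≤ max _ ‖h x‖)
  · exact h1.mono fun y hy => le_max_of_le_left (le_max_of_le_right hy)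

end PSmooth

theorem IsPiecewiseSmooth.exists_pSmooth {g : ℝ → ℂ} (hg : IsPiecewiseSmooth g) :
    ∃ T, PSmooth T g := by
  obtain ⟨T, h1, h2⟩ := hg
  exact ⟨T, .of_tendsto h1 (fun s hs j => (h2 s hs j).1) (fun s hs j => (h2 s hs j).2)⟩

theorem PSmooth.isPiecewiseSmooth {T : Finset ℝ} {g : ℝ → ℂ} (hg : PSmooth T g) :
    IsPiecewiseSmooth g :=
  ⟨T, hg.smooth, fun s _ j => ⟨⟨_, hg.tendsto_left s j⟩, ⟨_, hg.tendsto_right s j⟩⟩⟩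

/-! ### Distributional derivatives of piecewise smooth functions -/

/-- The distribution `F` has regular part `h`, piecewise smooth with exceptional points in `T`,
and point part `∑ s ∈ T, ∑ j < N, c s j * t⁽ʲ⁾(s)`. Superfluous coefficients are required to vanish,
so that `T` and `N` can be enlarged without changing `h` and `c`. -/
structure HasRep (F : Distr) (T : Finset ℝ) (N : ℕ) (h : ℝ → ℂ) (c : ℝ → ℕ → ℂ) : Prop where
  pSmooth : PSmooth T h
  coeff_notMem : ∀ s ∉ T, ∀ j, c s j = 0
  coeff_le : ∀ s j, N ≤ j → c s j = 0
  apply_eq : ∀ t : Test, F t = (∫ x, (t x : ℂ) * h x) + pointPart T N c (fun x => (t x : ℂ))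

theorem HasRep.mono {F : Distr} {T T' : Finset ℝ} {N N' : ℕ} {h : ℝ → ℂ} {c : ℝ → ℕ → ℂ}
    (H : HasRep F T N h c) (hT : T ⊆ T') (hN : N ≤ N') : HasRep F T' N' h c :=
  ⟨H.pSmooth.mono hT, fun s hs => H.coeff_notMem s fun h => hs (hT h),
    fun s j hj => H.coeff_le s j (hN.trans hj), fun t => by
      rw [H.apply_eq, pointPart_mono hT hN H.coeff_notMem H.coeff_le]⟩

theorem HasRep.of_pSmooth {T : Finset ℝ} {h : ℝ → ℂ} (H : PSmooth T h) :
    HasRep (ofFun h) T 0 h 0 :=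
  ⟨H, fun _ _ _ => rfl, fun _ _ _ => rfl, fun t => by
    rw [ofFun_apply H.locallyIntegrable]; simp [pointPart]⟩

/-- The jump at `s` of the `j`-th derivative of `h`. -/
def jump (h : ℝ → ℂ) (s : ℝ) (j : ℕ) : ℂ := rightLim h s j - leftLim h s j

theorem PSmooth.jump_eq_zero {T : Finset ℝ} {h : ℝ → ℂ} (H : PSmooth T h) {s : ℝ} (hs : s ∉ T)
    (j : ℕ) : jump h s j = 0 := by
  rw [jump, rightLim_of_contDiffAt (H.contDiffAt hs), leftLim_of_contDiffAt (H.contDiffAt hs),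
    sub_self]

theorem jump_iteratedDeriv (h : ℝ → ℂ) (i : ℕ) (s : ℝ) (j : ℕ) :
    jump (iteratedDeriv i h) s j = jump h s (i + j) := by
  rw [jump, jump, rightLim_iteratedDeriv, leftLim_iteratedDeriv]

/-- A continuous function, differentiable off a finite set and vanishing outside a bounded
interval, has a derivative of integral zero. -/
theorem integral_deriv_eq_zero {T : Finset ℝ} {u v : ℝ → ℂ} (hu : Continuous u)
    (hd : ∀ x ∉ T, HasDerivAt u (v x) x) (hv : Integrable v) {R : ℝ} (hR : 0 < R)
    (hsu : ∀ x, R ≤ |x| → u x = 0) (hsv : ∀ x, R < |x| → v x = 0) : ∫ x, v x = 0 := by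
  have h1 : ∫ x in (-R)..R, v x = u R - u (-R) := by
    refine MeasureTheory.integral_eq_of_hasDerivAt_off_countable u v T.finite_toSet.countable
      hu.continuousOn (fun x hx => hd x hx.2) hv.intervalIntegrable
  rw [hsu R (le_abs_self R), hsu (-R) (by rw [abs_neg]; exact le_abs_self R), sub_self,
    intervalIntegral.integral_of_le (by linarith), ← integral_Icc_eq_integral_Ioc] at h1
  rw [← h1, setIntegral_eq_integral_of_forall_compl_eq_zero]
  intro x hx
  refine hsv x (not_le.1 fun h => hx (abs_le.1 h))

theorem exists_abs_bound (t : Test) : ∃ R : ℝ, 0 < R ∧ ∀ x, R ≤ |x| → t x = 0 := by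
  obtain ⟨R, hR⟩ := t.hasCompactSupport.isCompact.isBounded.subset_closedBall 0
  refine ⟨max R 0 + 1, by positivity, fun x hx => ?_⟩
  refine image_eq_zero_of_notMem_tsupport fun hxt => ?_
  have := hR hxt
  rw [mem_closedBall_zero_iff, Real.norm_eq_abs] at this
  linarith [le_max_left R 0]

/-- Integration by parts on a half-line. -/
theorem integral_Ioi_testDeriv (t : Test) (s : ℝ) :
    ∫ x in Ioi s, (testDeriv t x : ℂ) = -(t s : ℂ) := by
  obtain ⟨R, hR, hRt⟩ := exists_abs_bound t
  have h := integral_Ioi_of_hasDerivAt_of_tendsto' (a := s) (m := 0)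
    (f := fun x => (t x : ℂ)) (f' := fun x => (testDeriv t x : ℂ))
    (fun x _ => hasDerivAt_ofReal_test t x)
    (((contDiff_ofReal_test (testDeriv t)).continuous.integrable_of_hasCompactSupport
      (hasCompactSupport_ofReal_test _)).integrableOn) ?_
  · rw [h, zero_sub]
  · refine tendsto_const_nhds.congr' ?_
    filter_upwards [eventually_ge_atTop R] with x hx
    rw [hRt x (hx.trans (le_abs_self x)), Complex.ofReal_zero]

theorem integral_by_parts_of_continuous {T : Finset ℝ} {h h' : ℝ → ℂ} (hc : Continuous h)
    (hd : ∀ x ∉ T, HasDerivAt h (h' x) x) (hh' : LocallyIntegrable h') (t : Test) :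
    -∫ x, (testDeriv t x : ℂ) * h x = ∫ x, (t x : ℂ) * h' x := by
  obtain ⟨R, hR, hRt⟩ := exists_abs_bound t
  have i1 : Integrable (fun x => (testDeriv t x : ℂ) * h x) :=
    hc.locallyIntegrable.integrable_smul_left_of_hasCompactSupport
      (contDiff_ofReal_test _).continuous (hasCompactSupport_ofReal_test (testDeriv t))
  have i2 : Integrable (fun x => (t x : ℂ) * h' x) :=
    hh'.integrable_smul_left_of_hasCompactSupport
      (contDiff_ofReal_test _).continuous (hasCompactSupport_ofReal_test t)
  have key := integral_deriv_eq_zero (T := T) (u := fun x => (t x : ℂ) * h x)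
    (v := fun x => (testDeriv t x : ℂ) * h x + (t x : ℂ) * h' x)
    ((contDiff_ofReal_test _).continuous.mul hc)
    (fun x hx => (hasDerivAt_ofReal_test t x).mul (hd x hx)) (i1.add i2) hR
    (fun x hx => by simp [hRt x hx]) (fun x hx => ?_)
  · rw [integral_add i1 i2] at key
    linear_combination -key
  · have ht : t =ᶠ[𝓝 x] fun _ => 0 := by
      filter_upwards [continuous_abs.continuousAt.eventually (lt_mem_nhds hx)] with y hy
      exact hRt y hy.le
    rw [testDeriv_apply, ht.deriv_eq, ht.eq_of_nhds]
    simp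

theorem hasDerivAt_of_contDiffAt {h : ℝ → ℂ} {x : ℝ} (H : ContDiffAt ℝ ∞ h x) :
    HasDerivAt h (deriv h x) x :=
  (H.differentiableAt (by simp)).hasDerivAt

/-- The step function with jumps `z s` at the points `s ∈ T`. -/
def stepFun (T : Finset ℝ) (z : ℝ → ℂ) (x : ℝ) : ℂ := ∑ s ∈ T, (Ioi s).indicator (fun _ => z s) x

theorem tendsto_stepFun_left (T : Finset ℝ) (z : ℝ → ℂ) (x : ℝ) :
    Tendsto (stepFun T z) (𝓝[<] x) (𝓝 (∑ s ∈ T, if s < x then z s else 0)) := by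
  refine tendsto_finsetSum T fun s _ => ?_
  refine tendsto_const_nhds.congr' ?_
  split_ifs with h
  · filter_upwards [nhdsWithin_le_nhds (lt_mem_nhds h)] with y hy
    rw [indicator_of_mem (mem_Ioi.2 hy)]
  · filter_upwards [self_mem_nhdsWithin] with y hy
    rw [indicator_of_notMem (fun h' => h ((mem_Ioi.1 h').trans hy))]

theorem tendsto_stepFun_right (T : Finset ℝ) (z : ℝ → ℂ) (x : ℝ) :
    Tendsto (stepFun T z) (𝓝[>] x) (𝓝 (∑ s ∈ T, if s ≤ x then z s else 0)) := by
  refine tendsto_finsetSum T fun s _ => ?_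
  refine tendsto_const_nhds.congr' ?_
  split_ifs with h
  · filter_upwards [self_mem_nhdsWithin] with y hy
    rw [indicator_of_mem (mem_Ioi.2 (h.trans_lt hy))]
  · filter_upwards [nhdsWithin_le_nhds (gt_mem_nhds (not_le.1 h))] with y hy
    rw [indicator_of_notMem (fun h' => (lt_asymm (mem_Ioi.1 h') hy))]

theorem hasDerivAt_stepFun {T : Finset ℝ} (z : ℝ → ℂ) {x : ℝ} (hx : x ∉ T) :
    HasDerivAt (stepFun T z) 0 x := by
  have h : HasDerivAt (fun x => ∑ s ∈ T, (Ioi s).indicator (fun _ => z s) x)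
      (∑ s ∈ T, (0 : ℂ)) x := by
    refine HasDerivAt.fun_sum fun s hs => ?_
    rcases lt_or_gt_of_ne (fun h : x = s => hx (h ▸ hs)) with h | h
    · refine (hasDerivAt_const x (0 : ℂ)).congr_of_eventuallyEq ?_
      filter_upwards [gt_mem_nhds h] with y hy
      rw [indicator_of_notMem (fun h' => (lt_asymm (mem_Ioi.1 h') hy))]
    · refine (hasDerivAt_const x (z s)).congr_of_eventuallyEq ?_
      filter_upwards [lt_mem_nhds h] with y hy
      rw [indicator_of_mem (mem_Ioi.2 hy)]
  rwa [Finset.sum_const_zero] at h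

theorem integral_testDeriv_mul_stepFun (T : Finset ℝ) (z : ℝ → ℂ) (t : Test) :
    Integrable (fun x => (testDeriv t x : ℂ) * stepFun T z x) ∧
      ∫ x, (testDeriv t x : ℂ) * stepFun T z x = -∑ s ∈ T, z s * (t s : ℂ) := by
  have hi : Integrable (fun x => (testDeriv t x : ℂ)) :=
    (contDiff_ofReal_test (testDeriv t)).continuous.integrable_of_hasCompactSupport
      (hasCompactSupport_ofReal_test _)
  have e : (fun x => (testDeriv t x : ℂ) * stepFun T z x) =
      fun x => ∑ s ∈ T, (Ioi s).indicator (fun x => (testDeriv t x : ℂ) * z s) x := by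
    funext x
    rw [stepFun, Finset.mul_sum]
    refine Finset.sum_congr rfl fun s _ => ?_
    by_cases h : x ∈ Ioi s
    · rw [indicator_of_mem h, indicator_of_mem h]
    · rw [indicator_of_notMem h, indicator_of_notMem h, mul_zero]
  have hi' : ∀ s ∈ T, Integrable ((Ioi s).indicator (fun x => (testDeriv t x : ℂ) * z s)) :=
    fun s _ => (hi.mul_const (z s)).indicator measurableSet_Ioi
  rw [e]
  refine ⟨integrable_finsetSum T hi', ?_⟩
  rw [integral_finsetSum T hi', ← Finset.sum_neg_distrib]
  refine Finset.sum_congr rfl fun s _ => ?_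
  rw [integral_indicator measurableSet_Ioi, integral_mul_const, integral_Ioi_testDeriv]
  ring

/-- Subtracting the jumps makes a piecewise smooth function continuous. -/
theorem PSmooth.exists_continuous {T : Finset ℝ} {h : ℝ → ℂ} (H : PSmooth T h) :
    ∃ u : ℝ → ℂ, Continuous u ∧ ∀ x ∉ T, u x = h x - stepFun T (fun s => jump h s 0) x := by
  set w : ℝ → ℂ := fun x => h x - stepFun T (fun s => jump h s 0) x with hw
  have hlim : ∀ x, ∃ y, Tendsto w (𝓝[(T : Set ℝ)ᶜ] x) (𝓝 y) := by
    intro x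
    by_cases hx : x ∈ T
    · have hl := (by simpa using H.tendsto_left x 0 : Tendsto h _ _).sub
        (tendsto_stepFun_left T (fun s => jump h s 0) x)
      have hr := (by simpa using H.tendsto_right x 0 : Tendsto h _ _).sub
        (tendsto_stepFun_right T (fun s => jump h s 0) x)
      have hsum : (∑ s ∈ T, if s ≤ x then jump h s 0 else 0) =
          (∑ s ∈ T, if s < x then jump h s 0 else 0) + jump h x 0 := by
        have : ∀ s ∈ T, (if s ≤ x then jump h s 0 else 0) =
            (if s < x then jump h s 0 else 0) + if s = x then jump h s 0 else 0 := by
          intro s _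
          rcases lt_trichotomy s x with h | h | h
          · simp [h, h.le, h.ne]
          · simp [h]
          · simp [h.ne', h.not_ge, h.le.not_gt]
        rw [Finset.sum_congr rfl this, Finset.sum_add_distrib, Finset.sum_ite_eq' T x, if_pos hx]
      have heq : rightLim h x 0 - (∑ s ∈ T, if s ≤ x then jump h s 0 else 0) =
          leftLim h x 0 - ∑ s ∈ T, if s < x then jump h s 0 else 0 := by
        rw [hsum, jump]; ring
      rw [heq] at hr
      refine ⟨_, (hl.sup hr).mono_left ?_⟩
      rw [nhdsLT_sup_nhdsGT]
      exact nhdsWithin_mono _ fun y hy h => hy (by rw [mem_singleton_iff.1 h]; exact hx)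
    · exact ⟨w x, (((H.contDiffAt hx).continuousAt.sub
        (hasDerivAt_stepFun _ hx).continuousAt).mono_left nhdsWithin_le_nhds)⟩
  refine ⟨extendFrom (T : Set ℝ)ᶜ w, continuous_extendFrom
    (T.finite_toSet.countable.dense_compl ℝ) hlim, fun x hx => ?_⟩
  refine extendFrom_extends (fun y hy => ?_) x hx
  exact ((H.contDiffAt hy).continuousAt.sub
    (hasDerivAt_stepFun _ hy).continuousAt).continuousWithinAt

/-- The distributional derivative of a piecewise smooth function consists of the pointwise
derivative and of point masses at the jumps. -/
theorem PSmooth.integral_by_parts {T : Finset ℝ} {h : ℝ → ℂ} (H : PSmooth T h) (t : Test) :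
    -∫ x, (testDeriv t x : ℂ) * h x =
      (∫ x, (t x : ℂ) * iteratedDeriv 1 h x) + ∑ s ∈ T, jump h s 0 * (t s : ℂ) := by
  obtain ⟨u, hu, hun⟩ := H.exists_continuous
  have hd : ∀ x ∉ T, HasDerivAt u (iteratedDeriv 1 h x) x := by
    intro x hx
    have h1 := (hasDerivAt_of_contDiffAt (H.contDiffAt hx)).sub
      (hasDerivAt_stepFun (fun s => jump h s 0) hx)
    rw [iteratedDeriv_one]
    rw [sub_zero] at h1
    refine h1.congr_of_eventuallyEq ?_
    filter_upwards [(isOpen_compl_finset T).mem_nhds hx] with y hy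
    exact hun y hy
  have hloc := (H.iterDeriv 1).locallyIntegrable
  have key := integral_by_parts_of_continuous hu hd hloc t
  obtain ⟨i2, e2⟩ := integral_testDeriv_mul_stepFun T (fun s => jump h s 0) t
  have i1 : Integrable (fun x => (testDeriv t x : ℂ) * h x) :=
    H.locallyIntegrable.integrable_smul_left_of_hasCompactSupport
      (contDiff_ofReal_test _).continuous (hasCompactSupport_ofReal_test (testDeriv t))
  have e3 : ∫ x, (testDeriv t x : ℂ) * u x = (∫ x, (testDeriv t x : ℂ) * h x) -
      ∫ x, (testDeriv t x : ℂ) * stepFun T (fun s => jump h s 0) x := by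
    rw [← integral_sub i1 i2]
    refine integral_congr_ae ?_
    have hT : ∀ᵐ x, x ∉ (T : Set ℝ) := T.finite_toSet.countable.ae_notMem volume
    filter_upwards [hT] with x hx
    rw [hun x hx]
    ring
  rw [e3, e2] at key
  rw [← key]
  ring

theorem distDeriv_succ (k : ℕ) (F : Distr) :
    distDeriv (k + 1) F = LineDeriv.lineDerivOp (1 : ℝ) (distDeriv k F) :=
  Function.iterate_succ_apply' _ _ _

theorem distDeriv_zero (F : Distr) : distDeriv 0 F = F := rfl

/-- The coefficients of the point part of the `i`-th derivative of a distribution with regular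
part `h` and point part with coefficients `c`. -/
def derivCoeff (h : ℝ → ℂ) (c : ℝ → ℕ → ℂ) (i : ℕ) (s : ℝ) (j : ℕ) : ℂ :=
  if i ≤ j then (-1) ^ i * c s (j - i) else (-1) ^ j * jump h s (i - 1 - j)

theorem derivCoeff_succ_zero (h : ℝ → ℂ) (c : ℝ → ℕ → ℂ) (i : ℕ) (s : ℝ) :
    derivCoeff h c (i + 1) s 0 = jump (iteratedDeriv i h) s 0 := by
  rw [derivCoeff, if_neg (by omega), jump_iteratedDeriv]
  simp

theorem derivCoeff_succ_succ (h : ℝ → ℂ) (c : ℝ → ℕ → ℂ) (i : ℕ) (s : ℝ) (j : ℕ) :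
    derivCoeff h c (i + 1) s (j + 1) = -derivCoeff h c i s j := by
  unfold derivCoeff
  by_cases hij : i ≤ j
  · rw [if_pos hij, if_pos (by omega), Nat.add_sub_add_right]
    ring
  · rw [if_neg hij, if_neg (by omega), show i + 1 - 1 - (j + 1) = i - 1 - j by omega]
    ring

/-- Differentiation of regular and point parts. As the point part is written in terms of derivatives
of the test function, every integration by parts shifts its coefficients up and changes their
sign; the jumps of the regular part enter at index `0`. -/
theorem HasRep.deriv {F : Distr} {T : Finset ℝ} {N : ℕ} {h : ℝ → ℂ} {c : ℝ → ℕ → ℂ}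
    (H : HasRep F T N h c) (i : ℕ) :
    HasRep (distDeriv i F) T (N + i) (iteratedDeriv i h) (derivCoeff h c i) := by
  refine ⟨H.pSmooth.iterDeriv i, fun s hs j => ?_, fun s j hj => ?_, ?_⟩
  · unfold derivCoeff
    rw [H.coeff_notMem s hs, H.pSmooth.jump_eq_zero hs]
    simp
  · rw [derivCoeff, if_pos (by omega), H.coeff_le s _ (by omega), mul_zero]
  induction i with
  | zero =>
    intro t
    have : derivCoeff h c 0 = c := by
      funext s j
      simp [derivCoeff]
    rw [this, iteratedDeriv_zero, distDeriv_zero, add_zero, H.apply_eq]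
  | succ i ih =>
    intro t
    rw [distDeriv_succ, lineDerivOp_apply_test, ih, neg_add,
      (H.pSmooth.iterDeriv i).integral_by_parts, iteratedDeriv_iteratedDeriv, add_assoc]
    congr 1
    unfold pointPart
    rw [← Finset.sum_neg_distrib, ← Finset.sum_add_distrib]
    refine Finset.sum_congr rfl fun s _ => ?_
    rw [← add_assoc, Finset.sum_range_succ', add_comm, derivCoeff_succ_zero, iteratedDeriv_zero,
      ← Finset.sum_neg_distrib]
    congr 1
    refine Finset.sum_congr rfl fun j _ => ?_
    rw [derivCoeff_succ_succ, iteratedDeriv_testDeriv]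
    ring

/-- Every element of `𝒜` is the sum of a piecewise smooth function and a distribution with finite
support. -/
theorem exists_hasRep_of_mem_spaceA {F : Distr} (hF : F ∈ spaceA) :
    ∃ T N h c, HasRep F T N h c := by
  obtain ⟨k, g, hg, rfl⟩ := hF
  obtain ⟨T, hT⟩ := hg.exists_pSmooth
  exact ⟨T, _, _, _, (HasRep.of_pSmooth hT).deriv k⟩

/-! ### The Hörmander product -/

/-- Leibniz' rule for point parts: if `γ j` are the derivatives of `g` at a point, then multiplying
the test function by `g` turns the coefficients `c` into `mulCoeff N γ c`. The terms with `j < q`,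
where `j - q` is truncated, have binomial coefficient `0`. -/
def mulCoeff (N : ℕ) (γ c : ℕ → ℂ) (q : ℕ) : ℂ :=
  ∑ j ∈ Finset.range N, c j * ((j.choose q : ℂ) * γ (j - q))

theorem mulCoeff_zero (N : ℕ) (γ : ℕ → ℂ) (q : ℕ) : mulCoeff N γ 0 q = 0 := by
  simp [mulCoeff]

theorem mulCoeff_eq_zero_of_le {N q : ℕ} (hq : N ≤ q) (γ c : ℕ → ℂ) : mulCoeff N γ c q = 0 := by
  refine Finset.sum_eq_zero fun j hj => ?_
  rw [Nat.choose_eq_zero_of_lt ((Finset.mem_range.1 hj).trans_le hq)]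
  simp

theorem sum_leibniz (N : ℕ) (γ c σ : ℕ → ℂ) :
    ∑ j ∈ Finset.range N, c j *
        ∑ i ∈ Finset.range (j + 1), (j.choose i : ℂ) * σ i * γ (j - i) =
      ∑ q ∈ Finset.range N, mulCoeff N γ c q * σ q := by
  have h : ∀ j ∈ Finset.range N,
      c j * ∑ i ∈ Finset.range (j + 1), (j.choose i : ℂ) * σ i * γ (j - i) =
        ∑ q ∈ Finset.range N, c j * ((j.choose q : ℂ) * γ (j - q)) * σ q := by
    intro j hj
    rw [Finset.mul_sum, Finset.sum_subset (Finset.range_mono (Finset.mem_range.1 hj) :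
      Finset.range (j + 1) ⊆ Finset.range N)]
    · exact Finset.sum_congr rfl fun i _ => by ring
    · intro q _ hq
      rw [Nat.choose_eq_zero_of_lt (by simpa using hq)]
      simp
  rw [Finset.sum_congr rfl h, Finset.sum_comm]
  refine Finset.sum_congr rfl fun q _ => ?_
  rw [mulCoeff, Finset.sum_mul]

theorem iteratedDeriv_mul_smooth {g τ : ℝ → ℂ} {s : ℝ} (hg : ContDiffAt ℝ ∞ g s)
    (hτ : ContDiffAt ℝ ∞ τ s) (j : ℕ) :
    iteratedDeriv j (fun x => g x * τ x) s = ∑ i ∈ Finset.range (j + 1),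
      (j.choose i : ℂ) * iteratedDeriv i τ s * iteratedDeriv (j - i) g s := by
  have h : (fun x => g x * τ x) = τ * g := by
    funext x
    exact mul_comm _ _
  rw [h, iteratedDeriv_mul (hτ.of_le (by exact_mod_cast le_top))
    (hg.of_le (by exact_mod_cast le_top))]

theorem pointPart_mul {T : Finset ℝ} {N : ℕ} {c : ℝ → ℕ → ℂ} {g τ : ℝ → ℂ}
    (hg : ∀ s ∈ T, ContDiffAt ℝ ∞ g s) (hτ : ContDiff ℝ ∞ τ) :
    pointPart T N c (fun x => g x * τ x) =
      pointPart T N (fun s => mulCoeff N (fun j => iteratedDeriv j g s) (c s)) τ := by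
  refine Finset.sum_congr rfl fun s hs => ?_
  rw [← sum_leibniz]
  refine Finset.sum_congr rfl fun j _ => ?_
  rw [iteratedDeriv_mul_smooth (hg s hs) hτ.contDiffAt]

theorem eventuallyEq_zero_of_notMem_tsupport {t : Test} {s : ℝ} (hs : s ∉ tsupport t) :
    ∀ᶠ x in 𝓝 s, t x = 0 := by
  filter_upwards [(isClosed_tsupport t).isOpen_compl.mem_nhds hs] with y hy
  exact image_eq_zero_of_notMem_tsupport hy

theorem tsupport_ofReal_subset (t : Test) : tsupport (fun x => (t x : ℂ)) ⊆ tsupport t :=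
  closure_mono fun x hx h => hx (by simpa using h)

theorem HasRep.agreesOn {F : Distr} {T : Finset ℝ} {N : ℕ} {h : ℝ → ℂ} {c : ℝ → ℕ → ℂ}
    (H : HasRep F T N h c) : AgreesOn F h (T : Set ℝ)ᶜ := by
  intro t ht
  rw [H.apply_eq, pointPart_congr (σ := fun _ => 0)]
  · simp [pointPart, iteratedDeriv_fun_const_zero]
  · intro s hs
    refine Or.inl ?_
    filter_upwards [eventuallyEq_zero_of_notMem_tsupport (t := t) fun h => ht h hs] with x hx
    rw [hx, Complex.ofReal_zero]

theorem HasRep.singSupp_subset {F : Distr} {T : Finset ℝ} {N : ℕ} {h : ℝ → ℂ} {c : ℝ → ℕ → ℂ}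
    (H : HasRep F T N h c) : singSupp F ⊆ T := by
  intro x hx
  by_contra hxT
  exact hx ⟨(T : Set ℝ)ᶜ, isOpen_compl_finset T, hxT, h, H.pSmooth.smooth, H.agreesOn⟩

theorem HasRep.eqOn_of_agreesOn {F : Distr} {T : Finset ℝ} {N : ℕ} {h g : ℝ → ℂ}
    {c : ℝ → ℕ → ℂ} (H : HasRep F T N h c) {U : Set ℝ} (hU : IsOpen U) (hg : ContinuousOn g U)
    (hFg : AgreesOn F g U) : (∀ x ∈ U, x ∉ T → h x = g x) ∧ ∀ s ∈ U, ∀ j, c s j = 0 :=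
  ⟨SingularODE.eqOn_of_agreesOn hU H.pSmooth.locallyIntegrable H.pSmooth.smooth.continuousOn hg
    H.apply_eq hFg,
  coeff_eq_zero_of_agreesOn hU H.pSmooth.locallyIntegrable H.pSmooth.smooth.continuousOn hg
    H.coeff_notMem H.coeff_le H.apply_eq hFg⟩

/-- The value of the Hörmander product of two distributions with disjoint exceptional sets, as a
dual product in an open set where the second factor is smooth. -/
theorem HasRep.pair_mul {F G : Distr} {T T' : Finset ℝ} {N N' : ℕ} {f g : ℝ → ℂ}
    {c d : ℝ → ℕ → ℂ} (hF : HasRep F T N f c) (hG : HasRep G T' N' g d) (hd : Disjoint T T')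
    {U : Set ℝ} {u : ℝ → ℂ} (hU : IsOpen U) (hu : ContDiffOn ℝ ∞ u U) (hGu : AgreesOn G u U)
    {t : Test} (ht : tsupport t ⊆ U) :
    pair F (fun x => u x * t x) = (∫ x, (t x : ℂ) * (f x * g x)) +
      pointPart T N c (fun x => g x * t x) + pointPart T' N' d (fun x => f x * t x) := by
  obtain ⟨h1, h2⟩ := hG.eqOn_of_agreesOn hU hu.continuousOn hGu
  have hcd : ContDiff ℝ ∞ (fun x => u x * (t x : ℂ)) := contDiff_mul_of_tsupport_subset hU hu
    (contDiff_ofReal_test t) ((tsupport_ofReal_subset t).trans ht)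
  rw [pair_eq hF.pSmooth.locallyIntegrable hF.apply_eq hcd
    (hasCompactSupport_ofReal_test t).mul_left]
  have e1 : ∫ x, u x * (t x : ℂ) * f x = ∫ x, (t x : ℂ) * (f x * g x) := by
    refine integral_congr_ae ?_
    have hT : ∀ᵐ x, x ∉ (T' : Set ℝ) := T'.finite_toSet.countable.ae_notMem volume
    filter_upwards [hT] with x hx
    by_cases hxt : x ∈ tsupport t
    · rw [h1 x (ht hxt) hx]; ring
    · simp [image_eq_zero_of_notMem_tsupport hxt]
  have e2 : pointPart T N c (fun x => u x * t x) = pointPart T N c (fun x => g x * t x) := by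
    refine pointPart_congr fun s hs => Or.inl ?_
    by_cases hst : s ∈ tsupport t
    · have hs' : s ∉ T' := Finset.disjoint_left.1 hd hs
      filter_upwards [hU.mem_nhds (ht hst), (isOpen_compl_finset T').mem_nhds hs'] with x hx hx'
      rw [h1 x hx hx']
    · filter_upwards [eventuallyEq_zero_of_notMem_tsupport hst] with x hx
      simp [hx]
  have e3 : pointPart T' N' d (fun x => f x * t x) = 0 := by
    rw [pointPart_congr (σ := fun _ => 0)]
    · simp [pointPart, iteratedDeriv_fun_const_zero]
    · intro s hs
      by_cases hst : s ∈ tsupport t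
      · exact Or.inr (h2 s (ht hst))
      · refine Or.inl ?_
        filter_upwards [eventuallyEq_zero_of_notMem_tsupport hst] with x hx
        simp [hx]
  rw [e1, e2, e3, add_zero]

/-- Existence of the Hörmander product of two distributions with disjoint exceptional sets: each
point part is multiplied by the regular part of the other factor, which is smooth there. -/
theorem HasRep.exists_isHormanderProduct {F G : Distr} {T T' : Finset ℝ} {N N' : ℕ}
    {f g : ℝ → ℂ} {c d : ℝ → ℕ → ℂ} (hF : HasRep F T N f c) (hG : HasRep G T' N' g d)
    (hd : Disjoint T T') :
    ∃ P : Distr, IsHormanderProduct F G P ∧ ∀ t : Test, P t = (∫ x, (t x : ℂ) * (f x * g x)) +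
      pointPart T N c (fun x => g x * t x) + pointPart T' N' d (fun x => f x * t x) := by
  have hfg : LocallyIntegrable (fun x => f x * g x) :=
    ((hF.pSmooth.mono Finset.subset_union_left).mul
      (hG.pSmooth.mono (Finset.subset_union_right (s₁ := T)))).locallyIntegrable
  obtain ⟨P₁, hP₁⟩ := exists_distr_pointPart T N
    (fun s => mulCoeff N (fun j => iteratedDeriv j g s) (c s))
  obtain ⟨P₂, hP₂⟩ := exists_distr_pointPart T' N'
    (fun s => mulCoeff N' (fun j => iteratedDeriv j f s) (d s))
  have hval : ∀ t : Test, (ofFun (fun x => f x * g x) + P₁ + P₂ : Distr) t =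
      (∫ x, (t x : ℂ) * (f x * g x)) + pointPart T N c (fun x => g x * t x) +
        pointPart T' N' d (fun x => f x * t x) := by
    intro t
    have : (ofFun (fun x => f x * g x) + P₁ + P₂ : Distr) t =
      ofFun (fun x => f x * g x) t + P₁ t + P₂ t := rfl
    rw [this, ofFun_apply hfg, hP₁, hP₂,
      pointPart_mul (fun s hs => hG.pSmooth.contDiffAt (Finset.disjoint_left.1 hd hs))
        (contDiff_ofReal_test t),
      pointPart_mul (fun s hs => hF.pSmooth.contDiffAt (Finset.disjoint_right.1 hd hs))
        (contDiff_ofReal_test t)]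
  refine ⟨_, ⟨?_, fun U u hU hu => ⟨fun hGu t ht => ?_, fun hFu t ht => ?_⟩⟩, hval⟩
  · exact Disjoint.mono hF.singSupp_subset hG.singSupp_subset (by exact_mod_cast hd)
  · rw [hval, hF.pair_mul hG hd hU hu hGu ht]
  · rw [hval, hG.pair_mul hF hd.symm hU hu hFu ht]
    simp only [mul_comm (g _) (f _)]
    ring

theorem IsHormanderProduct.unique {F G P P' : Distr} {T T' : Finset ℝ} {N N' : ℕ}
    {f g : ℝ → ℂ} {c d : ℝ → ℕ → ℂ} (hF : HasRep F T N f c) (hG : HasRep G T' N' g d)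
    (hd : Disjoint T T') (hP : IsHormanderProduct F G P) (hP' : IsHormanderProduct F G P') :
    P = P' := by
  obtain ⟨χ, hχ, hχT, hχT'⟩ := exists_cutoff hd
  refine DFunLike.ext _ _ fun t => ?_
  -- split `t` into parts supported away from `T` and away from `T'`
  have h1 : ContDiff ℝ ∞ fun x => χ x * t x := hχ.mul t.contDiff
  have h2 : ContDiff ℝ ∞ fun x => (1 - χ x) * t x := (contDiff_const.sub hχ).mul t.contDiff
  set t₁ := mkTest _ h1 t.hasCompactSupport.mul_left
  set t₂ := mkTest _ h2 t.hasCompactSupport.mul_left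
  have ht : t = t₁ + t₂ := by
    refine DFunLike.ext _ _ fun x => ?_
    change t x = χ x * t x + (1 - χ x) * t x
    ring
  have s1 : tsupport t₁ ⊆ (T : Set ℝ)ᶜ := by
    intro x hx hxT
    refine (notMem_tsupport_iff_eventuallyEq.2 ?_) hx
    filter_upwards [hχT x hxT] with y hy
    simp [t₁, hy]
  have s2 : tsupport t₂ ⊆ (T' : Set ℝ)ᶜ := by
    intro x hx hxT
    refine (notMem_tsupport_iff_eventuallyEq.2 ?_) hx
    filter_upwards [hχT' x hxT] with y hy
    simp [t₂, hy]
  have e1 := (hP.2 _ _ (isOpen_compl_finset T) hF.pSmooth.smooth).2 hF.agreesOn t₁ s1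
  have e1' := (hP'.2 _ _ (isOpen_compl_finset T) hF.pSmooth.smooth).2 hF.agreesOn t₁ s1
  have e2 := (hP.2 _ _ (isOpen_compl_finset T') hG.pSmooth.smooth).1 hG.agreesOn t₂ s2
  have e2' := (hP'.2 _ _ (isOpen_compl_finset T') hG.pSmooth.smooth).1 hG.agreesOn t₂ s2
  rw [ht, map_add, map_add, e1, e1', e2, e2']

/-! ### The product `*` -/

theorem HasRep.shift {G : Distr} {T : Finset ℝ} {N : ℕ} {g : ℝ → ℂ} {d : ℝ → ℕ → ℂ}
    (H : HasRep G T N g d) (ε : ℝ) :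
    HasRep (shift ε G) (T.image (fun x => x - ε)) N (fun x => g (x + ε))
      (fun s => d (s + ε)) := by
  refine ⟨H.pSmooth.shift ε, fun s hs j => H.coeff_notMem _ (fun h => hs ?_) j,
    fun s j hj => H.coeff_le _ j hj, fun t => ?_⟩
  · exact Finset.mem_image.2 ⟨_, h, by ring⟩
  · rw [shift_apply, H.apply_eq]
    congr 1
    · rw [← integral_add_right_eq_self _ ε]
      simp
    · unfold pointPart
      rw [Finset.sum_image (fun x _ y _ h => sub_left_injective h)]
      refine Finset.sum_congr rfl fun s _ => Finset.sum_congr rfl fun j _ => ?_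
      simp only [sub_add_cancel, shiftTest_apply]
      congr 1
      rw [congrFun (iteratedDeriv_comp_sub_const j (fun x => (t x : ℂ)) ε) s]

theorem tendsto_add_nhdsGT (s : ℝ) : Tendsto (fun ε => s + ε) (𝓝[>] 0) (𝓝[>] s) := by
  refine tendsto_nhdsWithin_of_tendsto_nhds_of_eventually_within _ ?_ ?_
  · have : Tendsto (fun ε => s + ε) (𝓝 0) (𝓝 (s + 0)) :=
      (continuous_const.add continuous_id).tendsto 0
    rw [add_zero] at this
    exact this.mono_left nhdsWithin_le_nhds
  · filter_upwards [self_mem_nhdsWithin] with x hx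
    simpa using hx

theorem tendsto_sub_nhdsLT (s : ℝ) : Tendsto (fun ε => s - ε) (𝓝[>] 0) (𝓝[<] s) := by
  refine tendsto_nhdsWithin_of_tendsto_nhds_of_eventually_within _ ?_ ?_
  · have : Tendsto (fun ε => s - ε) (𝓝 0) (𝓝 (s - 0)) :=
      (continuous_const.sub continuous_id).tendsto 0
    rw [sub_zero] at this
    exact this.mono_left nhdsWithin_le_nhds
  · filter_upwards [self_mem_nhdsWithin] with x hx
    simpa using hx

theorem eventually_disjoint_shift (T : Finset ℝ) :
    ∀ᶠ ε in 𝓝[>] (0 : ℝ), Disjoint T (T.image (fun x => x - ε)) := by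
  filter_upwards [eventually_notMem_finset_right
    ((T ×ˢ T).image fun p : ℝ × ℝ => p.1 - p.2) 0] with ε hε
  rw [Finset.disjoint_left]
  intro s hs hs'
  obtain ⟨r, hr, hrs⟩ := Finset.mem_image.1 hs'
  exact hε (Finset.mem_image.2 ⟨(r, s), Finset.mem_product.2 ⟨hr, hs⟩, by
    change r - s = ε
    rw [← hrs]; ring⟩)

theorem PSmooth.tendsto_integral_shift {T : Finset ℝ} {f g : ℝ → ℂ} (hf : PSmooth T f)
    (hg : PSmooth T g) (t : Test) :
    Tendsto (fun ε => ∫ x, (t x : ℂ) * (f x * g (x + ε))) (𝓝[>] 0)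
      (𝓝 (∫ x, (t x : ℂ) * (f x * g x))) := by
  obtain ⟨R, hR, hRt⟩ := exists_abs_bound t
  obtain ⟨C, hC⟩ := hf.exists_bound (isCompact_Icc (a := -R) (b := R))
  obtain ⟨D, hD⟩ := hg.exists_bound (isCompact_Icc (a := -R) (b := R + 1))
  have hti : Integrable (fun x => (t x : ℂ)) :=
    (contDiff_ofReal_test t).continuous.integrable_of_hasCompactSupport
      (hasCompactSupport_ofReal_test t)
  refine tendsto_integral_filter_of_dominated_convergence (fun x => ‖(t x : ℂ)‖ * (C * D)) ?_ ?_
    (hti.norm.mul_const _) ?_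
  · refine Eventually.of_forall fun ε => ?_
    exact (contDiff_ofReal_test t).continuous.aestronglyMeasurable.mul
      (hf.locallyIntegrable.aestronglyMeasurable.mul
        (hg.shift ε).locallyIntegrable.aestronglyMeasurable)
  · have h1 : ∀ᶠ ε in 𝓝[>] (0 : ℝ), ε < 1 := nhdsWithin_le_nhds (gt_mem_nhds one_pos)
    filter_upwards [h1, self_mem_nhdsWithin] with ε hε hε0
    refine Eventually.of_forall fun x => ?_
    by_cases hx : R ≤ |x|
    · simp [hRt x hx]
    · have hx' := abs_le.1 (not_le.1 hx).le
      have hε0' : 0 < ε := hε0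
      rw [norm_mul, norm_mul]
      have a1 := hC x ⟨hx'.1, hx'.2⟩
      have a2 := hD (x + ε) ⟨by linarith [hx'.1], by linarith [hx'.2]⟩
      gcongr
      exact (norm_nonneg _).trans a1
  · have hT : ∀ᵐ x, x ∉ (T : Set ℝ) := T.finite_toSet.countable.ae_notMem volume
    filter_upwards [hT] with x hx
    refine tendsto_const_nhds.mul (tendsto_const_nhds.mul ?_)
    exact (hg.contDiffAt hx).continuousAt.tendsto.comp
      ((tendsto_add_nhdsGT x).mono_right nhdsWithin_le_nhds)

/-- The coefficients of the point part of the product `F * G`, where `f`, `g` are the regular parts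
and `c`, `d` the coefficients of the point parts of `F` and `G`. As `G` is shifted to the left, the
point part of `F` meets `g` to the right of the point, and that of `G` meets `f` to the left. -/
def starCoeff (N : ℕ) (f g : ℝ → ℂ) (c d : ℝ → ℕ → ℂ) (s : ℝ) (q : ℕ) : ℂ :=
  mulCoeff N (rightLim g s) (c s) q + mulCoeff N (leftLim f s) (d s) q

/-- The limit of the Hörmander products `F(x) · G(x + ε)` exists, and its regular and point parts
are determined by those of the factors. -/
theorem HasRep.exists_isStarProduct {F G : Distr} {T : Finset ℝ} {N : ℕ} {f g : ℝ → ℂ}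
    {c d : ℝ → ℕ → ℂ} (hF : HasRep F T N f c) (hG : HasRep G T N g d) :
    ∃ P : Distr, IsStarProduct F G P ∧
      HasRep P T N (fun x => f x * g x) (starCoeff N f g c d) := by
  have hfg := hF.pSmooth.mul hG.pSmooth
  obtain ⟨P₁, hP₁⟩ := exists_distr_pointPart T N (starCoeff N f g c d)
  have hPval : ∀ t : Test, (ofFun (fun x => f x * g x) + P₁ : Distr) t =
      (∫ x, (t x : ℂ) * (f x * g x)) +
        pointPart T N (starCoeff N f g c d) (fun x => (t x : ℂ)) := by
    intro t
    have : (ofFun (fun x => f x * g x) + P₁ : Distr) t = ofFun (fun x => f x * g x) t + P₁ t := rfl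
    rw [this, ofFun_apply hfg.locallyIntegrable, hP₁]
  refine ⟨ofFun (fun x => f x * g x) + P₁, ?_, ⟨hfg, fun s hs q => ?_, fun s q hq => ?_, hPval⟩⟩
  swap
  · have h1 : c s = 0 := funext (hF.coeff_notMem s hs)
    have h2 : d s = 0 := funext (hG.coeff_notMem s hs)
    rw [starCoeff, h1, h2, mulCoeff_zero, mulCoeff_zero, add_zero]
  swap
  · rw [starCoeff, mulCoeff_eq_zero_of_le hq, mulCoeff_eq_zero_of_le hq, add_zero]
  have hex : ∀ ε : ℝ, ∃ P : Distr, Disjoint T (T.image (fun x => x - ε)) →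
      IsHormanderProduct F (SingularODE.shift ε G) P ∧ ∀ t : Test,
        P t = (∫ x, (t x : ℂ) * (f x * g (x + ε))) +
          pointPart T N c (fun x => g (x + ε) * t x) +
          pointPart (T.image (fun x => x - ε)) N (fun s => d (s + ε)) (fun x => f x * t x) := by
    intro ε
    by_cases hd : Disjoint T (T.image (fun x => x - ε))
    · obtain ⟨P, hP⟩ := hF.exists_isHormanderProduct (hG.shift ε) hd
      exact ⟨P, fun _ => hP⟩
    · exact ⟨0, fun h => absurd h hd⟩
  choose H hH using hex
  -- the value at `t` in terms of the fixed set `T`: the point part of `F` sees `g` at `s + ε`, the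
  -- point part of `G` sits at `s - ε`
  refine ⟨H, (eventually_disjoint_shift T).mono fun ε hε => (hH ε hε).1, fun t => ?_⟩
  have hev : (fun ε => (∫ x, (t x : ℂ) * (f x * g (x + ε))) +
      (∑ s ∈ T, ∑ q ∈ Finset.range N, mulCoeff N (fun j => iteratedDeriv j g (s + ε)) (c s) q *
        iteratedDeriv q (fun x => (t x : ℂ)) s) +
      ∑ s ∈ T, ∑ j ∈ Finset.range N, d s j *
        iteratedDeriv j (fun x => f x * (t x : ℂ)) (s - ε)) =ᶠ[𝓝[>] 0] fun ε => H ε t := by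
    filter_upwards [eventually_disjoint_shift T] with ε hε
    rw [(hH ε hε).2 t]
    congr 1
    · congr 1
      rw [pointPart_mul (fun s hs => (hG.shift ε).pSmooth.contDiffAt
        (Finset.disjoint_left.1 hε hs)) (contDiff_ofReal_test t)]
      unfold pointPart
      simp only [iteratedDeriv_comp_add_const]
    · unfold pointPart
      rw [Finset.sum_image (fun x _ y _ h => sub_left_injective h)]
      simp only [sub_add_cancel]
  refine Tendsto.congr' hev ?_
  rw [hPval t]
  simp_rw [add_assoc]
  refine (hF.pSmooth.tendsto_integral_shift hG.pSmooth t).add ?_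
  have hsplit : pointPart T N (starCoeff N f g c d) (fun x => (t x : ℂ)) =
      (∑ s ∈ T, ∑ q ∈ Finset.range N, mulCoeff N (rightLim g s) (c s) q *
        iteratedDeriv q (fun x => (t x : ℂ)) s) +
      ∑ s ∈ T, ∑ j ∈ Finset.range N, d s j * leftLim (fun x => f x * (t x : ℂ)) s j := by
    rw [← Finset.sum_add_distrib]
    refine Finset.sum_congr rfl fun s _ => ?_
    have hl : ∀ j, leftLim (fun x => f x * (t x : ℂ)) s j = ∑ i ∈ Finset.range (j + 1),
        (j.choose i : ℂ) * iteratedDeriv i (fun x => (t x : ℂ)) s * leftLim f s (j - i) := by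
      intro j
      have : (fun x => f x * (t x : ℂ)) = fun x => (t x : ℂ) * f x := by
        funext x; exact mul_comm _ _
      rw [this, (PSmooth.of_contDiff (contDiff_ofReal_test t)).leftLim_mul hF.pSmooth]
      simp only [leftLim_of_contDiffAt (contDiff_ofReal_test t).contDiffAt]
    simp only [hl]
    rw [sum_leibniz, ← Finset.sum_add_distrib]
    exact Finset.sum_congr rfl fun q _ => add_mul _ _ _
  rw [hsplit]
  refine Tendsto.add ?_ ?_
  · refine tendsto_finsetSum T fun s _ => tendsto_finsetSum _ fun q _ => ?_
    refine Tendsto.mul_const _ (tendsto_finsetSum _ fun j _ => ?_)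
    exact ((hG.pSmooth.tendsto_right s (j - q)).comp (tendsto_add_nhdsGT s)).const_mul _
      |>.const_mul _
  · refine tendsto_finsetSum T fun s _ => tendsto_finsetSum _ fun j _ => ?_
    exact (((hF.pSmooth.mul (PSmooth.of_contDiff (contDiff_ofReal_test t))).tendsto_left s j).comp
      (tendsto_sub_nhdsLT s)).const_mul _

theorem IsStarProduct.unique {F G P P' : Distr} {T : Finset ℝ} {N : ℕ} {f g : ℝ → ℂ}
    {c d : ℝ → ℕ → ℂ} (hF : HasRep F T N f c) (hG : HasRep G T N g d)
    (hP : IsStarProduct F G P) (hP' : IsStarProduct F G P') : P = P' := by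
  obtain ⟨H, hH, hlim⟩ := hP
  obtain ⟨H', hH', hlim'⟩ := hP'
  refine DFunLike.ext _ _ fun t => tendsto_nhds_unique ((hlim t).congr' ?_) (hlim' t)
  filter_upwards [hH, hH', eventually_disjoint_shift T] with ε h1 h2 h3
  rw [h1.unique hF (hG.shift ε) h3 h2]

/-- The product `F * G` of two distributions with given regular and point parts. -/
theorem HasRep.starProd {F G : Distr} {T : Finset ℝ} {N : ℕ} {f g : ℝ → ℂ}
    {c d : ℝ → ℕ → ℂ} (hF : HasRep F T N f c) (hG : HasRep G T N g d) :
    HasRep (starProd F G) T N (fun x => f x * g x) (starCoeff N f g c d) := by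
  obtain ⟨P, hP, hrep⟩ := hF.exists_isStarProduct hG
  have hex : ∃ P : Distr, IsStarProduct F G P := ⟨P, hP⟩
  have : SingularODE.starProd F G = P := by
    rw [SingularODE.starProd, dif_pos hex]
    exact hex.choose_spec.unique hF hG hP
  rwa [this]

/-! ### Singular support and order -/

theorem eventually_eventuallyEq_left {T : Finset ℝ} {V : Set ℝ} {s : ℝ} {g h : ℝ → ℂ}
    (hV : IsOpen V) (hs : V ∈ 𝓝[<] s) (H : ∀ x ∈ V, x ∉ T → h x = g x) :
    ∀ᶠ x in 𝓝[<] s, h =ᶠ[𝓝 x] g := by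
  filter_upwards [hs, eventually_notMem_finset_left T s] with x hx hxT
  filter_upwards [hV.mem_nhds hx, (isOpen_compl_finset T).mem_nhds hxT] with y hy hyT
  exact H y hy hyT

theorem eventually_eventuallyEq_right {T : Finset ℝ} {V : Set ℝ} {s : ℝ} {g h : ℝ → ℂ}
    (hV : IsOpen V) (hs : V ∈ 𝓝[>] s) (H : ∀ x ∈ V, x ∉ T → h x = g x) :
    ∀ᶠ x in 𝓝[>] s, h =ᶠ[𝓝 x] g := by
  filter_upwards [hs, eventually_notMem_finset_right T s] with x hx hxT
  filter_upwards [hV.mem_nhds hx, (isOpen_compl_finset T).mem_nhds hxT] with y hy hyT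
  exact H y hy hyT

/-- Off the singular support there are no point part and no jumps. -/
theorem HasRep.regular_of_notMem_singSupp {F : Distr} {T : Finset ℝ} {N : ℕ} {h : ℝ → ℂ}
    {c : ℝ → ℕ → ℂ} (H : HasRep F T N h c) {s : ℝ} (hs : s ∉ singSupp F) :
    (∀ j, c s j = 0) ∧ ∀ j, leftLim h s j = rightLim h s j := by
  obtain ⟨U, hU, hsU, g, hg, hFg⟩ := not_not.1 hs
  obtain ⟨h1, h2⟩ := H.eqOn_of_agreesOn hU hg.continuousOn hFg
  refine ⟨h2 s hsU, fun j => ?_⟩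
  have hgs : ContDiffAt ℝ ∞ g s := hg.contDiffAt (hU.mem_nhds hsU)
  have hUs := hU.mem_nhds hsU
  rw [leftLim_congr (eventually_eventuallyEq_left hU (nhdsWithin_le_nhds hUs) h1),
    rightLim_congr (eventually_eventuallyEq_right hU (nhdsWithin_le_nhds hUs) h1),
    leftLim_of_contDiffAt hgs, rightLim_of_contDiffAt hgs]

theorem exists_of_order_le {F : Distr} {n : ℕ} (h : order F ≤ n) :
    ∃ k ≤ n, ∃ g : ℝ → ℂ, LocallyIntegrable g ∧ F = distDeriv k (ofFun g) := by
  by_contra! hcon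
  have h1 : ((n + 1 : ℕ) : ℕ∞) ≤ order F := by
    refine le_iInf₂ fun k hk => ?_
    obtain ⟨g, hg, hF⟩ := hk
    by_contra hlt
    have hk' : k < n + 1 := by exact_mod_cast not_le.1 hlt
    exact hcon k (Nat.lt_succ_iff.1 hk') g hg hF
  have h2 : ((n + 1 : ℕ) : ℕ∞) ≤ n := h1.trans h
  have h3 : n + 1 ≤ n := by exact_mod_cast h2
  omega

theorem iterate_testDeriv_apply (k : ℕ) (t : Test) (x : ℝ) :
    testDeriv^[k] t x = iteratedDeriv k t x := by
  induction k generalizing t with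
  | zero => simp
  | succ k ih =>
    have h : (testDeriv t : ℝ → ℝ) = deriv t := funext (testDeriv_apply t)
    rw [Function.iterate_succ_apply, ih, iteratedDeriv_succ', h]

theorem distDeriv_apply (k : ℕ) (F : Distr) (t : Test) :
    distDeriv k F t = (-1) ^ k * F (testDeriv^[k] t) := by
  induction k generalizing t with
  | zero => simp [distDeriv_zero]
  | succ k ih =>
    rw [distDeriv_succ, lineDerivOp_apply_test, ih, Function.iterate_succ_apply]
    ring

/-- Integrals against bounded functions that concentrate at a point tend to zero. -/
theorem tendsto_integral_rescale {w : ℝ → ℂ} (hw : LocallyIntegrable w) {φ : ℝ → ℝ}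
    (hφ : Continuous φ) (hsupp : ∀ x, 1 < |x| → φ x = 0) {a : ℝ → ℝ}
    (ha : ∀ r, 1 ≤ r → |a r| ≤ 1) (s : ℝ) :
    Tendsto (fun r : ℝ => ∫ x, ((a r * φ (r * (x - s)) : ℝ) : ℂ) * w x) atTop (𝓝 0) := by
  obtain ⟨M, hM⟩ := (isCompact_Icc (a := (-1 : ℝ)) (b := 1)).exists_bound_of_continuousOn
    hφ.continuousOn
  have hM' : ∀ x, ‖φ x‖ ≤ max M 0 := by
    intro x
    by_cases hx : 1 < |x|
    · rw [hsupp x hx, norm_zero]; exact le_max_right _ _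
    · have := abs_le.1 (not_lt.1 hx)
      exact (hM x ⟨this.1, this.2⟩).trans (le_max_left _ _)
  have hlim := tendsto_integral_filter_of_dominated_convergence (μ := volume)
    (F := fun (r : ℝ) x => ((a r * φ (r * (x - s)) : ℝ) : ℂ) * w x) (f := fun _ => 0)
    (l := atTop) ((Icc (s - 1) (s + 1)).indicator fun x => max M 0 * ‖w x‖) ?_ ?_ ?_ ?_
  · simpa using hlim
  · refine Eventually.of_forall fun r => ?_
    refine Continuous.aestronglyMeasurable ?_ |>.mul hw.aestronglyMeasurable
    fun_prop
  · filter_upwards [eventually_ge_atTop 1] with r hr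
    refine Eventually.of_forall fun x => ?_
    by_cases hx : x ∈ Icc (s - 1) (s + 1)
    · rw [indicator_of_mem hx, norm_mul, Complex.norm_real, norm_mul]
      have h1 : ‖a r‖ ≤ 1 := ha r hr
      calc ‖a r‖ * ‖φ (r * (x - s))‖ * ‖w x‖ ≤ 1 * max M 0 * ‖w x‖ := by
            gcongr
            exact hM' _
        _ = _ := by rw [one_mul]
    · rw [indicator_of_notMem hx, hsupp, mul_zero, Complex.ofReal_zero, zero_mul, norm_zero]
      have h2 : 1 < |x - s| := by
        by_contra h
        have := abs_le.1 (not_lt.1 h)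
        exact hx ⟨by linarith [this.1], by linarith [this.2]⟩
      rw [abs_mul, abs_of_pos (by linarith)]
      nlinarith
  · refine IntegrableOn.integrable_indicator ?_ measurableSet_Icc
    exact (hw.integrableOn_isCompact isCompact_Icc).norm.const_mul _
  · have hT : ∀ᵐ x, x ∉ ({s} : Set ℝ) := (countable_singleton s).ae_notMem volume
    filter_upwards [hT] with x hx
    refine tendsto_const_nhds.congr' ?_
    have hxs : 0 < |x - s| := abs_pos.2 (sub_ne_zero.2 hx)
    filter_upwards [eventually_gt_atTop (1 / |x - s|), eventually_gt_atTop 0] with r hr hr0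
    rw [hsupp, mul_zero, Complex.ofReal_zero, zero_mul]
    rw [abs_mul, abs_of_pos hr0]
    rwa [div_lt_iff₀ hxs] at hr

/-- A distribution of order at most `n` has no derivative of order `n` or more of the Dirac
distribution in its point part: test functions `x ↦ r⁻ʲ θ (r (x - s))` detect the coefficient
of index `j`, while their derivatives up to order `j` stay bounded and concentrate at `s`. -/
theorem HasRep.coeff_eq_zero_of_order_le {F : Distr} {T : Finset ℝ} {N : ℕ} {h : ℝ → ℂ}
    {c : ℝ → ℕ → ℂ} (H : HasRep F T N h c) {n : ℕ} (hn : order F ≤ n) (s : ℝ) {j : ℕ}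
    (hj : n ≤ j) : c s j = 0 := by
  by_cases hsT : s ∈ T
  swap
  · exact H.coeff_notMem s hsT j
  by_cases hjN : j < N
  swap
  · exact H.coeff_le s j (not_lt.1 hjN)
  obtain ⟨k, hk, g, hg, rfl⟩ := exists_of_order_le hn
  obtain ⟨θ, hθ, hjet⟩ := exists_test_monomial j
  have hsupp : ∀ i x, 1 < |x| → iteratedDeriv i θ x = 0 := by
    intro i x hx
    have hx' : x ∉ tsupport θ := fun h => absurd (abs_le.2 (hθ h)) (not_le.2 hx)
    have : (θ : ℝ → ℝ) =ᶠ[𝓝 x] fun _ => 0 := eventuallyEq_zero_of_notMem_tsupport hx'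
    rw [this.iteratedDeriv_eq, iteratedDeriv_fun_const_zero]
  have hcont : ∀ i, Continuous (iteratedDeriv i θ) := fun i =>
    θ.contDiff.continuous_iteratedDeriv i (by exact_mod_cast le_top)
  have hbd : ∀ i ≤ j, ∀ r : ℝ, 1 ≤ r → |(r ^ j)⁻¹ * r ^ i| ≤ 1 := by
    intro i hi r hr
    have hr0 : 0 < r := by linarith
    rw [abs_of_nonneg (by positivity), inv_mul_le_iff₀ (by positivity), mul_one]
    exact pow_le_pow_right₀ hr hi
  -- the integrals against `h` and `g` tend to zero, and the point part tends to `c s j`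
  have lim1 := tendsto_integral_rescale H.pSmooth.locallyIntegrable (hcont 0) (hsupp 0)
    (hbd 0 (Nat.zero_le j)) s
  have lim2 := (tendsto_integral_rescale hg (hcont k) (hsupp k) (hbd k (hk.trans hj)) s).const_mul
    ((-1 : ℂ) ^ k)
  rw [mul_zero] at lim2
  have hfar : ∀ᶠ r : ℝ in atTop, ∀ q ∈ T, q ≠ s → 1 < |r * (q - s)| := by
    rw [Filter.eventually_all_finset]
    intro q _
    by_cases hqs : q = s
    · exact Eventually.of_forall fun r h => absurd hqs h
    · have hpos : 0 < |q - s| := abs_pos.2 (sub_ne_zero.2 hqs)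
      filter_upwards [eventually_gt_atTop (1 / |q - s|), eventually_gt_atTop 0] with r hr hr0 _
      rw [abs_mul, abs_of_pos hr0]
      rwa [div_lt_iff₀ hpos] at hr
  have key : (fun r : ℝ => (∫ x, (((r ^ j)⁻¹ * r ^ 0 * iteratedDeriv 0 θ (r * (x - s)) : ℝ) : ℂ) *
      h x) + c s j) =ᶠ[atTop] fun r : ℝ => (-1 : ℂ) ^ k *
        ∫ x, (((r ^ j)⁻¹ * r ^ k * iteratedDeriv k θ (r * (x - s)) : ℝ) : ℂ) * g x := by
    filter_upwards [hfar, eventually_gt_atTop 0] with r hr hr0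
    have e := H.apply_eq (scaleTest θ j s r hr0)
    rw [distDeriv_apply, ofFun_apply hg] at e
    simp only [iterate_testDeriv_apply, iteratedDeriv_scaleTest] at e
    have hpp : pointPart T N c (fun x => (scaleTest θ j s r hr0 x : ℂ)) = c s j := by
      unfold pointPart
      simp only [iteratedDeriv_ofReal_test, iteratedDeriv_scaleTest]
      rw [Finset.sum_eq_single s, Finset.sum_eq_single j]
      · rw [sub_self, mul_zero, hjet, if_pos rfl, mul_one, inv_mul_cancel₀ (pow_ne_zero _ hr0.ne')]
        simp
      · intro i _ hij
        rw [sub_self, mul_zero, hjet, if_neg hij]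
        simp
      · intro h'
        exact absurd (Finset.mem_range.2 hjN) h'
      · intro q hq hqs
        refine Finset.sum_eq_zero fun i _ => ?_
        rw [hsupp i _ (hr q hq hqs)]
        simp
      · intro h'
        exact absurd hsT h'
    rw [hpp] at e
    simp only [mul_assoc, pow_zero, one_mul, iteratedDeriv_zero]
    exact e.symm
  have h1 : Tendsto (fun r : ℝ => (∫ x, (((r ^ j)⁻¹ * r ^ 0 *
      iteratedDeriv 0 θ (r * (x - s)) : ℝ) : ℂ) * h x) + c s j) atTop (𝓝 (0 + c s j)) :=
    lim1.add_const _
  have := tendsto_nhds_unique (h1.congr' key) lim2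
  simpa using this

/-! ### Smooth extension to closed intervals -/

theorem Ioo_subset_of_mem_closure {Ω : Set ℝ} (hc : Ω.OrdConnected) {x y : ℝ}
    (hx : x ∈ closure Ω) (hy : y ∈ closure Ω) : Ioo x y ⊆ Ω := by
  intro z hz
  obtain ⟨x', hx', hx'Ω⟩ := mem_closure_iff.1 hx (Iio z) isOpen_Iio hz.1
  obtain ⟨y', hy', hy'Ω⟩ := mem_closure_iff.1 hy (Ioi z) isOpen_Ioi hz.2
  exact hc.out hx'Ω hy'Ω ⟨(mem_Iio.1 hx').le, (mem_Ioi.1 hy').le⟩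

theorem mem_nhdsGT_or_closure_subset {Ω : Set ℝ} (hc : Ω.OrdConnected) {x : ℝ}
    (hx : x ∈ closure Ω) : Ω ∈ 𝓝[>] x ∨ closure Ω ⊆ Iic x := by
  by_cases h : ∃ y ∈ closure Ω, x < y
  · obtain ⟨y, hy, hxy⟩ := h
    exact Or.inl (mem_of_superset (Ioo_mem_nhdsGT hxy) (Ioo_subset_of_mem_closure hc hx hy))
  · push Not at h
    exact Or.inr h

theorem mem_nhdsLT_or_closure_subset {Ω : Set ℝ} (hc : Ω.OrdConnected) {x : ℝ}
    (hx : x ∈ closure Ω) : Ω ∈ 𝓝[<] x ∨ closure Ω ⊆ Ici x := by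
  by_cases h : ∃ y ∈ closure Ω, y < x
  · obtain ⟨y, hy, hxy⟩ := h
    exact Or.inl (mem_of_superset (Ioo_mem_nhdsLT hxy) (Ioo_subset_of_mem_closure hc hy hx))
  · push Not at h
    exact Or.inr h

theorem convex_closure_of_ordConnected {Ω : Set ℝ} (hc : Ω.OrdConnected) :
    Convex ℝ (closure Ω) :=
  hc.convex.closure

theorem uniqueDiffOn_closure {Ω : Set ℝ} (hΩ : IsOpen Ω) (hc : Ω.OrdConnected)
    (hne : Ω.Nonempty) : UniqueDiffOn ℝ (closure Ω) :=
  uniqueDiffOn_convex (convex_closure_of_ordConnected hc)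
    (hne.mono (interior_maximal subset_closure hΩ))

theorem closure_subset_closure_inter_compl (T : Finset ℝ) {Ω : Set ℝ} (hΩ : IsOpen Ω) :
    closure Ω ⊆ closure (Ω ∩ (T : Set ℝ)ᶜ) :=
  closure_minimal ((T.finite_toSet.countable.dense_compl ℝ).open_subset_closure_inter hΩ)
    isClosed_closure

/-- A function with a sequence of successive derivatives within `K` is smooth on `K`. -/
theorem contDiffOn_of_hasDerivWithinAt {K : Set ℝ} (hK : UniqueDiffOn ℝ K) {P : ℕ → ℝ → ℂ}
    (hP : ∀ j, ∀ x ∈ K, HasDerivWithinAt (P j) (P (j + 1) x) K x) :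
    ContDiffOn ℝ ∞ (P 0) K ∧ ∀ j, ∀ x ∈ K, iteratedDerivWithin j (P 0) K x = P j x := by
  have h : ∀ j, EqOn (iteratedDerivWithin j (P 0) K) (P j) K := by
    intro j
    induction j with
    | zero => intro x _; simp
    | succ j ih =>
      intro x hx
      rw [iteratedDerivWithin_succ, derivWithin_congr ih (ih hx)]
      exact (hP j x hx).derivWithin (hK x hx)
  refine ⟨?_, fun j x hx => h j hx⟩
  refine contDiffOn_of_differentiableOn_deriv (n := ⊤) fun j _ => ?_
  have hd : DifferentiableOn ℝ (P j) K := fun x hx => (hP j x hx).differentiableWithinAt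
  exact hd.congr (h j)

theorem iteratedDerivWithin_closure_eq {Ω : Set ℝ} (hΩ : IsOpen Ω) (hc : Ω.OrdConnected)
    {p : ℝ → ℂ} (hp : ContDiffOn ℝ ∞ p (closure Ω)) (j : ℕ) {x : ℝ} (hx : x ∈ Ω) :
    iteratedDerivWithin j p (closure Ω) x = iteratedDeriv j p x := by
  refine iteratedDerivWithin_eq_iteratedDeriv (uniqueDiffOn_closure hΩ hc ⟨x, hx⟩) ?_
    (subset_closure hx)
  exact (hp.contDiffAt (mem_of_superset (hΩ.mem_nhds hx) subset_closure)).of_le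
    (by exact_mod_cast le_top)

theorem continuousOn_iteratedDerivWithin_closure {Ω : Set ℝ} (hΩ : IsOpen Ω)
    (hc : Ω.OrdConnected) (hne : Ω.Nonempty) {p : ℝ → ℂ} (hp : ContDiffOn ℝ ∞ p (closure Ω))
    (j : ℕ) : ContinuousOn (iteratedDerivWithin j p (closure Ω)) (closure Ω) :=
  hp.continuousOn_iteratedDerivWithin (by exact_mod_cast le_top) (uniqueDiffOn_closure hΩ hc hne)

theorem tendsto_iteratedDeriv_of_contDiffOn_closure {Ω : Set ℝ} (hΩ : IsOpen Ω)
    (hc : Ω.OrdConnected) {T : Finset ℝ} {p h : ℝ → ℂ} (hp : ContDiffOn ℝ ∞ p (closure Ω))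
    (hh : ∀ x ∈ Ω, x ∉ T → h x = p x) {x : ℝ} (hx : x ∈ closure Ω) {l : Filter ℝ}
    (hl : l ≤ 𝓝 x) (hlΩ : Ω ∈ l) (hlT : ∀ᶠ y in l, y ∉ T) (j : ℕ) :
    Tendsto (iteratedDeriv j h) l (𝓝 (iteratedDerivWithin j p (closure Ω) x)) := by
  have hne : Ω.Nonempty := closure_nonempty_iff.1 ⟨x, hx⟩
  have h1 := continuousOn_iteratedDerivWithin_closure hΩ hc hne hp j x hx
  have h2 : l ≤ 𝓝[closure Ω] x :=
    le_inf hl (le_principal_iff.2 (mem_of_superset hlΩ subset_closure))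
  refine (h1.mono_left h2).congr' ?_
  filter_upwards [hlΩ, hlT] with y hy hyT
  rw [iteratedDerivWithin_closure_eq hΩ hc hp j hy]
  refine (Filter.EventuallyEq.iteratedDeriv_eq j ?_).symm
  filter_upwards [hΩ.mem_nhds hy, (isOpen_compl_finset T).mem_nhds hyT] with z hz hzT
  exact hh z hz hzT

theorem rightLim_eq_iteratedDerivWithin {Ω : Set ℝ} (hΩ : IsOpen Ω) (hc : Ω.OrdConnected)
    {T : Finset ℝ} {p h : ℝ → ℂ} (hp : ContDiffOn ℝ ∞ p (closure Ω))
    (hh : ∀ x ∈ Ω, x ∉ T → h x = p x) {x : ℝ} (hx : Ω ∈ 𝓝[>] x) (j : ℕ) :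
    rightLim h x j = iteratedDerivWithin j p (closure Ω) x :=
  rightLim_eq (tendsto_iteratedDeriv_of_contDiffOn_closure hΩ hc hp hh
    (mem_closure_iff_nhdsWithin_neBot.2 (neBot_of_le (le_inf nhdsWithin_le_nhds
      (le_principal_iff.2 hx)))) nhdsWithin_le_nhds hx (eventually_notMem_finset_right T x) j)

theorem leftLim_eq_iteratedDerivWithin {Ω : Set ℝ} (hΩ : IsOpen Ω) (hc : Ω.OrdConnected)
    {T : Finset ℝ} {p h : ℝ → ℂ} (hp : ContDiffOn ℝ ∞ p (closure Ω))
    (hh : ∀ x ∈ Ω, x ∉ T → h x = p x) {x : ℝ} (hx : Ω ∈ 𝓝[<] x) (j : ℕ) :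
    leftLim h x j = iteratedDerivWithin j p (closure Ω) x :=
  leftLim_eq (tendsto_iteratedDeriv_of_contDiffOn_closure hΩ hc hp hh
    (mem_closure_iff_nhdsWithin_neBot.2 (neBot_of_le (le_inf nhdsWithin_le_nhds
      (le_principal_iff.2 hx)))) nhdsWithin_le_nhds hx (eventually_notMem_finset_left T x) j)

/-- A piecewise smooth function without jumps in an open interval coincides there, off the
exceptional points, with a function that is smooth on the closed interval. -/
theorem PSmooth.exists_contDiffOn_closure {T : Finset ℝ} {h : ℝ → ℂ} (H : PSmooth T h)
    {Ω : Set ℝ} (hΩ : IsOpen Ω) (hc : Ω.OrdConnected) (hne : Ω.Nonempty)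
    (hj : ∀ x ∈ Ω, ∀ j, leftLim h x j = rightLim h x j) :
    ∃ p : ℝ → ℂ, ContDiffOn ℝ ∞ p (closure Ω) ∧ ∀ x ∈ Ω, x ∉ T → h x = p x := by
  set A : Set ℝ := Ω ∩ (T : Set ℝ)ᶜ with hA
  have hAo : IsOpen A := hΩ.inter (isOpen_compl_finset T)
  have hKA : closure Ω ⊆ closure A := closure_subset_closure_inter_compl T hΩ
  have hlim : ∀ j, ∀ x ∈ closure Ω, ∃ y, Tendsto (iteratedDeriv j h) (𝓝[A] x) (𝓝 y) := by
    intro j x hx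
    by_cases hxA : x ∈ A
    · exact ⟨_, (continuousAt_iteratedDeriv (H.contDiffAt hxA.2) j).mono_left nhdsWithin_le_nhds⟩
    by_cases hxΩ : x ∈ Ω
    · refine ⟨leftLim h x j, ((H.tendsto_left x j).sup (hj x hxΩ j ▸ H.tendsto_right x j)).mono_left
        ?_⟩
      rw [nhdsLT_sup_nhdsGT]
      exact nhdsWithin_mono _ fun y hy h => hxA (by rwa [mem_singleton_iff.1 h] at hy)
    · -- `x` is an end point of the interval
      by_cases h1 : Ω ⊆ Ioi x
      · exact ⟨_, (H.tendsto_right x j).mono_left (nhdsWithin_mono _ (inter_subset_left.trans h1))⟩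
      · have h2 : Ω ⊆ Iio x := by
          obtain ⟨y, hy, hyx⟩ := not_subset.1 h1
          intro z hz
          by_contra hzx
          exact hxΩ (hc.out hy hz ⟨not_lt.1 hyx, not_lt.1 hzx⟩)
        exact ⟨_, (H.tendsto_left x j).mono_left (nhdsWithin_mono _ (inter_subset_left.trans h2))⟩
  set P : ℕ → ℝ → ℂ := fun j => extendFrom A (iteratedDeriv j h) with hP
  have hPcont : ∀ j, ContinuousOn (P j) (closure Ω) := fun j =>
    continuousOn_extendFrom hKA (hlim j)
  have hPA : ∀ j, ∀ x ∈ A, P j x = iteratedDeriv j h x := fun j x hx =>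
    extendFrom_extends (fun y hy => (continuousAt_iteratedDeriv (H.contDiffAt hy.2)
      j).continuousWithinAt) x hx
  have hPd : ∀ j, ∀ x ∈ A, HasDerivAt (P j) (P (j + 1) x) x := by
    intro j x hx
    rw [hPA (j + 1) x hx, iteratedDeriv_succ]
    refine (hasDerivAt_of_contDiffAt
      (contDiffAt_iteratedDeriv (H.contDiffAt hx.2) j)).congr_of_eventuallyEq ?_
    filter_upwards [hAo.mem_nhds hx] with y hy
    exact hPA j y hy
  have hAK : A ⊆ closure Ω := inter_subset_left.trans subset_closure
  have hdiff : ∀ j, DifferentiableOn ℝ (P j) A := fun j x hx =>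
    (hPd j x hx).differentiableAt.differentiableWithinAt
  have hright : ∀ j, ∀ x ∈ closure Ω,
      HasDerivWithinAt (P j) (P (j + 1) x) (closure Ω ∩ Ici x) x := by
    intro j x hx
    rcases mem_nhdsGT_or_closure_subset hc hx with h1 | h1
    · have hAx : A ∈ 𝓝[>] x := inter_mem h1 (eventually_notMem_finset_right T x)
      refine (hasDerivWithinAt_Ici_of_tendsto_deriv (hdiff j) ((hPcont j x hx).mono hAK) hAx
        ?_).mono inter_subset_right
      refine ((hPcont (j + 1) x hx).mono_left (le_inf nhdsWithin_le_nhds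
        (le_principal_iff.2 (mem_of_superset hAx hAK)))).congr' ?_
      filter_upwards [hAx] with y hy
      exact (hPd j y hy).deriv.symm
    · have : closure Ω ∩ Ici x ⊆ {x} := fun y hy => le_antisymm (h1 hy.1) hy.2
      exact hasDerivWithinAt_iff_hasFDerivWithinAt.2 (HasFDerivWithinAt.singleton.mono this)
  have hleft : ∀ j, ∀ x ∈ closure Ω,
      HasDerivWithinAt (P j) (P (j + 1) x) (closure Ω ∩ Iic x) x := by
    intro j x hx
    rcases mem_nhdsLT_or_closure_subset hc hx with h1 | h1
    · have hAx : A ∈ 𝓝[<] x := inter_mem h1 (eventually_notMem_finset_left T x)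
      refine (hasDerivWithinAt_Iic_of_tendsto_deriv (hdiff j) ((hPcont j x hx).mono hAK) hAx
        ?_).mono inter_subset_right
      refine ((hPcont (j + 1) x hx).mono_left (le_inf nhdsWithin_le_nhds
        (le_principal_iff.2 (mem_of_superset hAx hAK)))).congr' ?_
      filter_upwards [hAx] with y hy
      exact (hPd j y hy).deriv.symm
    · have : closure Ω ∩ Iic x ⊆ {x} := fun y hy => le_antisymm hy.2 (h1 hy.1)
      exact hasDerivWithinAt_iff_hasFDerivWithinAt.2 (HasFDerivWithinAt.singleton.mono this)
  have hall : ∀ j, ∀ x ∈ closure Ω, HasDerivWithinAt (P j) (P (j + 1) x) (closure Ω) x := by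
    intro j x hx
    have := (hleft j x hx).union (hright j x hx)
    rwa [← inter_union_distrib_left, Iic_union_Ici, inter_univ] at this
  refine ⟨P 0, (contDiffOn_of_hasDerivWithinAt (uniqueDiffOn_closure hΩ hc hne) hall).1,
    fun x hx hxT => ?_⟩
  rw [hPA 0 x ⟨hx, hxT⟩, iteratedDeriv_zero]

theorem HasRep.agreesOn_of_eqOn {F : Distr} {T : Finset ℝ} {N : ℕ} {h g : ℝ → ℂ}
    {c : ℝ → ℕ → ℂ} (H : HasRep F T N h c) {U : Set ℝ} (hc : ∀ s ∈ U, ∀ j, c s j = 0)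
    (hg : ∀ x ∈ U, x ∉ T → h x = g x) : AgreesOn F g U := by
  intro t ht
  rw [H.apply_eq, pointPart_congr (σ := fun _ => 0)]
  · have hT : ∀ᵐ x, x ∉ (T : Set ℝ) := T.finite_toSet.countable.ae_notMem volume
    have : ∫ x, (t x : ℂ) * h x = ∫ x, (t x : ℂ) * g x := by
      refine integral_congr_ae ?_
      filter_upwards [hT] with x hx
      by_cases hxt : x ∈ tsupport t
      · rw [hg x (ht hxt) hx]
      · simp [image_eq_zero_of_notMem_tsupport hxt]
    rw [this]
    simp [pointPart, iteratedDeriv_fun_const_zero]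
  · intro s hs
    by_cases hst : s ∈ tsupport t
    · exact Or.inr (hc s (ht hst))
    · refine Or.inl ?_
      filter_upwards [eventuallyEq_zero_of_notMem_tsupport hst] with x hx
      rw [hx, Complex.ofReal_zero]

/-- An element of `𝒜` is smooth up to the end points on every interval without singular points. -/
theorem HasRep.exists_isClosedExtension {F : Distr} {T : Finset ℝ} {N : ℕ} {h : ℝ → ℂ}
    {c : ℝ → ℕ → ℂ} (H : HasRep F T N h c) {Ω : Set ℝ} (hΩ : IsOpen Ω) (hc : Ω.OrdConnected)
    (hne : Ω.Nonempty) (hd : Disjoint Ω (singSupp F)) : ∃ p, IsClosedExtension F Ω p := by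
  have hr := fun x (hx : x ∈ Ω) => H.regular_of_notMem_singSupp (disjoint_left.1 hd hx)
  obtain ⟨p, hp, hph⟩ := H.pSmooth.exists_contDiffOn_closure hΩ hc hne fun x hx => (hr x hx).2
  exact ⟨p, hp, H.agreesOn_of_eqOn (fun x hx => (hr x hx).1) hph⟩

theorem IsClosedExtension.eq_of_notMem {F : Distr} {T : Finset ℝ} {N : ℕ} {h p : ℝ → ℂ}
    {c : ℝ → ℕ → ℂ} (H : HasRep F T N h c) {Ω : Set ℝ} (hΩ : IsOpen Ω)
    (hp : IsClosedExtension F Ω p) : ∀ x ∈ Ω, x ∉ T → h x = p x :=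
  (H.eqOn_of_agreesOn hΩ (hp.1.continuousOn.mono subset_closure) hp.2).1

/-! ### The intervals cut out by the singular points -/

section piece

variable {m : ℕ} {ξ : Fin m → ℝ}

theorem isOpen_piece (ξ : Fin m → ℝ) (k : Fin (m + 1)) : IsOpen (piece ξ k) := by
  unfold piece
  rw [Set.ofPred_forall]
  refine isOpen_iInter_of_finite fun j => ?_
  by_cases h : (j : ℕ) < k
  · have : {x | ((j : ℕ) < k → ξ j < x) ∧ ((k : ℕ) ≤ j → x < ξ j)} = Ioi (ξ j) := by
      ext x; simp [h, h.not_ge]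
    rw [this]; exact isOpen_Ioi
  · have : {x | ((j : ℕ) < k → ξ j < x) ∧ ((k : ℕ) ≤ j → x < ξ j)} = Iio (ξ j) := by
      ext x; simp [h, not_lt.1 h]
    rw [this]; exact isOpen_Iio

theorem ordConnected_piece (ξ : Fin m → ℝ) (k : Fin (m + 1)) : (piece ξ k).OrdConnected :=
  ⟨fun _ hx _ hy _ hz j => ⟨fun h => ((hx j).1 h).trans_le hz.1,
    fun h => hz.2.trans_lt ((hy j).2 h)⟩⟩

theorem piece_castSucc_mem_nhdsLT (hξ : StrictMono ξ) (s : Fin m) :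
    piece ξ s.castSucc ∈ 𝓝[<] ξ s := by
  refine (Filter.eventually_all (l := 𝓝[<] ξ s)).2 fun j => Filter.Eventually.and ?_ ?_
  · by_cases h : (j : ℕ) < s
    · filter_upwards [nhdsWithin_le_nhds (lt_mem_nhds (hξ (Fin.lt_def.2 h)))] with x hx _
      exact hx
    · exact Eventually.of_forall fun x hx => absurd (by simpa using hx) h
  · filter_upwards [self_mem_nhdsWithin] with x hx h
    exact (mem_Iio.1 hx).trans_le (hξ.monotone (Fin.le_def.2 (by simpa using h)))

theorem piece_succ_mem_nhdsGT (hξ : StrictMono ξ) (s : Fin m) :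
    piece ξ s.succ ∈ 𝓝[>] ξ s := by
  refine (Filter.eventually_all (l := 𝓝[>] ξ s)).2 fun j => Filter.Eventually.and ?_ ?_
  · filter_upwards [self_mem_nhdsWithin] with x hx h
    rw [Fin.val_succ] at h
    exact (hξ.monotone (Fin.le_def.2 (Nat.lt_succ_iff.1 h))).trans_lt (mem_Ioi.1 hx)
  · by_cases h : (s : ℕ) < j
    · filter_upwards [nhdsWithin_le_nhds (gt_mem_nhds (hξ (Fin.lt_def.2 h)))] with x hx _
      exact hx
    · refine Eventually.of_forall fun x hx => absurd ?_ h
      rw [Fin.val_succ] at hx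
      omega

theorem piece_nonempty (hξ : StrictMono ξ) (k : Fin (m + 1)) : (piece ξ k).Nonempty := by
  induction k using Fin.cases with
  | zero =>
    rcases m with _ | m
    · exact ⟨0, fun j => j.elim0⟩
    · exact Filter.nonempty_of_mem (piece_castSucc_mem_nhdsLT hξ 0)
  | succ s => exact Filter.nonempty_of_mem (piece_succ_mem_nhdsGT hξ s)

theorem disjoint_piece {k l : Fin (m + 1)} (h : k ≠ l) : Disjoint (piece ξ k) (piece ξ l) := by
  wlog hkl : k < l generalizing k l
  · exact (this h.symm (lt_of_le_of_ne (not_lt.1 hkl) h.symm)).symm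
  rw [disjoint_left]
  intro x hx hx'
  have hkm : (k : ℕ) < m := lt_of_lt_of_le (Fin.lt_def.1 hkl) (Nat.lt_succ_iff.1 l.2)
  exact lt_asymm ((hx ⟨k, hkm⟩).2 le_rfl) ((hx' ⟨k, hkm⟩).1 (Fin.lt_def.1 hkl))

theorem notMem_piece (ξ : Fin m → ℝ) (s : Fin m) (k : Fin (m + 1)) : ξ s ∉ piece ξ k := by
  intro h
  rcases lt_or_ge (s : ℕ) k with hs | hs
  · exact lt_irrefl _ ((h s).1 hs)
  · exact lt_irrefl _ ((h s).2 hs)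

theorem exists_mem_piece (hξ : StrictMono ξ) {x : ℝ} (hx : x ∉ range ξ) : ∃ k, x ∈ piece ξ k := by
  classical
  have hex : ∃ k : ℕ, ∀ j : Fin m, k ≤ j → x < ξ j :=
    ⟨m, fun j hj => absurd j.2 (not_lt.2 hj)⟩
  have hle : Nat.find hex ≤ m := Nat.find_min' hex fun j hj => absurd j.2 (not_lt.2 hj)
  refine ⟨⟨Nat.find hex, Nat.lt_succ_iff.2 hle⟩, fun j => ⟨fun hj => ?_,
    fun hj => Nat.find_spec hex j hj⟩⟩
  have hj' : (j : ℕ) < Nat.find hex := hj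
  have hmin := Nat.find_min hex (m := Nat.find hex - 1) (by omega)
  push Not at hmin
  obtain ⟨i, hi, hxi⟩ := hmin
  have hij : ξ j ≤ ξ i := hξ.monotone (Fin.le_def.2 (by omega))
  exact lt_of_le_of_ne (hij.trans hxi) fun h => hx ⟨j, h⟩

theorem disjoint_piece_range (ξ : Fin m → ℝ) (k : Fin (m + 1)) :
    Disjoint (piece ξ k) (range ξ) := by
  rw [disjoint_right]
  rintro _ ⟨s, rfl⟩
  exact notMem_piece ξ s k

/-- The function equal to `p k` on the `k`-th interval. -/
def glueFun (ξ : Fin m → ℝ) (p : Fin (m + 1) → ℝ → ℂ) (x : ℝ) : ℂ :=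
  ∑ k, (piece ξ k).indicator (p k) x

theorem glueFun_eq (p : Fin (m + 1) → ℝ → ℂ) {k : Fin (m + 1)} {x : ℝ} (hx : x ∈ piece ξ k) :
    glueFun ξ p x = p k x := by
  rw [glueFun, Finset.sum_eq_single k, indicator_of_mem hx]
  · intro l _ hl
    exact indicator_of_notMem (fun h => disjoint_left.1 (disjoint_piece hl) h hx) _
  · intro h
    exact absurd (Finset.mem_univ k) h

theorem pSmooth_glueFun (hξ : StrictMono ξ) {p : Fin (m + 1) → ℝ → ℂ}
    (hp : ∀ k, ContDiffOn ℝ ∞ (p k) (closure (piece ξ k))) :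
    PSmooth (Finset.univ.image ξ) (glueFun ξ p) := by
  have heq : ∀ k, ∀ x ∈ piece ξ k, x ∉ (∅ : Finset ℝ) → glueFun ξ p x = p k x :=
    fun k x hx _ => glueFun_eq p hx
  refine .of_tendsto (fun x hx => ?_) (fun s hs j => ?_) (fun s hs j => ?_)
  · obtain ⟨k, hk⟩ := exists_mem_piece hξ (x := x) fun h => hx (by simpa using h)
    have h1 : ContDiffAt ℝ ∞ (p k) x :=
      (hp k).contDiffAt (mem_of_superset ((isOpen_piece ξ k).mem_nhds hk) subset_closure)
    refine (h1.congr_of_eventuallyEq ?_).contDiffWithinAt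
    filter_upwards [(isOpen_piece ξ k).mem_nhds hk] with y hy
    exact glueFun_eq p hy
  · obtain ⟨i, -, rfl⟩ := Finset.mem_image.1 hs
    have h1 := piece_castSucc_mem_nhdsLT hξ i
    exact ⟨_, tendsto_iteratedDeriv_of_contDiffOn_closure (isOpen_piece ξ _)
      (ordConnected_piece ξ _) (hp _) (heq _) (mem_closure_iff_nhdsWithin_neBot.2
        (neBot_of_le (le_inf nhdsWithin_le_nhds (le_principal_iff.2 h1)))) nhdsWithin_le_nhds h1
      (eventually_notMem_finset_left ∅ _) j⟩
  · obtain ⟨i, -, rfl⟩ := Finset.mem_image.1 hs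
    have h1 := piece_succ_mem_nhdsGT hξ i
    exact ⟨_, tendsto_iteratedDeriv_of_contDiffOn_closure (isOpen_piece ξ _)
      (ordConnected_piece ξ _) (hp _) (heq _) (mem_closure_iff_nhdsWithin_neBot.2
        (neBot_of_le (le_inf nhdsWithin_le_nhds (le_principal_iff.2 h1)))) nhdsWithin_le_nhds h1
      (eventually_notMem_finset_right ∅ _) j⟩

end piece

/-! ### One-sided jets of solutions -/

section jets

variable {n : ℕ}

/-- The sequence `P` of derivatives at a point satisfies all differentiated versions of the
equation `∑ i, g_i p⁽ⁱ⁾ = f` at this point, where `Γ i` are the derivatives of `g_i` and `Φ` those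
of `f`. -/
def JetODE (Γ : Fin (n + 1) → ℕ → ℂ) (P Φ : ℕ → ℂ) : Prop :=
  ∀ q, ∑ i : Fin (n + 1), ∑ l ∈ Finset.range (q + 1),
    (q.choose l : ℂ) * P (i + l) * Γ i (q - l) = Φ q

/-- By repeated differentiation of the equation, all derivatives of a solution at a point are
linear combinations of the first `n` of them and of derivatives of the right-hand side, with
coefficients depending on the equation only. -/
theorem JetODE.exists_reduction {Γ : Fin (n + 1) → ℕ → ℂ} (h0 : Γ (Fin.last n) 0 ≠ 0) (K r : ℕ)
    (hr : r < n + K) : ∃ (x : Fin n → ℂ) (y : Fin K → ℂ), ∀ P Φ : ℕ → ℂ, JetODE Γ P Φ →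
      P r = ∑ j, x j * P j + ∑ k, y k * Φ k := by
  induction r using Nat.strong_induction_on with
  | _ r ih =>
    by_cases hrn : r < n
    · refine ⟨Pi.single ⟨r, hrn⟩ 1, 0, fun P Φ _ => ?_⟩
      rw [Finset.sum_eq_single ⟨r, hrn⟩]
      · simp
      · intro j _ hj
        rw [Pi.single_eq_of_ne hj, zero_mul]
      · simp
    · obtain ⟨q, rfl⟩ := Nat.exists_eq_add_of_le (not_lt.1 hrn)
      -- solve the `q`-times differentiated equation for its term of highest order `n + q`
      set A : Finset (Fin (n + 1) × ℕ) := (Finset.univ ×ˢ Finset.range (q + 1)).erase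
        (Fin.last n, q) with hA
      have hlt : ∀ p ∈ A, (p.1 : ℕ) + p.2 < n + q := by
        rintro ⟨i, l⟩ hp
        rw [hA, Finset.mem_erase, Finset.mem_product, Finset.mem_range] at hp
        obtain ⟨hne, -, hl⟩ := hp
        have hi := Fin.le_last i
        rw [Fin.le_def, Fin.val_last] at hi
        by_contra hcon
        have hin : (i : ℕ) = n := by simp only at hcon hl; omega
        have hlq : l = q := by simp only at hcon hl; omega
        exact hne (Prod.ext (Fin.ext (by simpa using hin)) hlq)
      have hred : ∀ p : Fin (n + 1) × ℕ, ∃ (x : Fin n → ℂ) (y : Fin K → ℂ), p ∈ A →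
          ∀ P Φ : ℕ → ℂ, JetODE Γ P Φ →
            P (p.1 + p.2) = ∑ j, x j * P j + ∑ k, y k * Φ k := by
        intro p
        by_cases hp : p ∈ A
        · obtain ⟨x, y, hxy⟩ := ih _ (hlt p hp) ((hlt p hp).trans hr)
          exact ⟨x, y, fun _ => hxy⟩
        · exact ⟨0, 0, fun h => absurd h hp⟩
      choose x y hxy using hred
      set w : Fin (n + 1) × ℕ → ℂ := fun p => (q.choose p.2 : ℂ) * Γ p.1 (q - p.2) with hw
      refine ⟨fun j => -(Γ (Fin.last n) 0)⁻¹ * ∑ p ∈ A, w p * x p j,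
        fun k => (Γ (Fin.last n) 0)⁻¹ * ((Pi.single (⟨q, by omega⟩ : Fin K) (1 : ℂ) : Fin K → ℂ) k -
          ∑ p ∈ A, w p * y p k),
        fun P Φ hP => ?_⟩
      have hq := hP q
      rw [← Finset.sum_product' (f := fun (i : Fin (n + 1)) l =>
        (q.choose l : ℂ) * P (i + l) * Γ i (q - l)),
        ← Finset.add_sum_erase _ _ (a := (Fin.last n, q)) (by simp)] at hq
      simp only [Fin.val_last, Nat.choose_self, Nat.cast_one, one_mul, Nat.sub_self] at hq
      have hsum : ∑ p ∈ A, (q.choose p.2 : ℂ) * P (p.1 + p.2) * Γ p.1 (q - p.2) =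
          ∑ j, (∑ p ∈ A, w p * x p j) * P j + ∑ k, (∑ p ∈ A, w p * y p k) * Φ k := by
        simp_rw [Finset.sum_mul]
        rw [Finset.sum_comm, Finset.sum_comm (s := Finset.univ (α := Fin K)),
          ← Finset.sum_add_distrib]
        refine Finset.sum_congr rfl fun p hp => ?_
        rw [hxy p hp P Φ hP]
        simp_rw [mul_assoc, ← Finset.mul_sum]
        rw [hw]
        ring
      rw [hsum] at hq
      have hsingle : ∑ k : Fin K, (Pi.single (⟨q, by omega⟩ : Fin K) (1 : ℂ) : Fin K → ℂ) k * Φ k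
          = Φ q := by
        rw [Finset.sum_eq_single ⟨q, by omega⟩]
        · simp
        · intro j _ hj
          rw [Pi.single_eq_of_ne hj, zero_mul]
        · simp
      simp_rw [mul_assoc, ← Finset.mul_sum, sub_mul, Finset.sum_sub_distrib]
      rw [hsingle]
      field_simp
      linear_combination hq

/-- The jet of a solution is determined by its first `n` entries. -/
theorem JetODE.unique {Γ : Fin (n + 1) → ℕ → ℂ} (h0 : Γ (Fin.last n) 0 ≠ 0) {P P' Φ : ℕ → ℂ}
    (hP : JetODE Γ P Φ) (hP' : JetODE Γ P' Φ) (h : ∀ r < n, P r = P' r) (r : ℕ) : P r = P' r := by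
  obtain ⟨x, y, hxy⟩ := JetODE.exists_reduction h0 (r + 1) r (by omega)
  rw [hxy P Φ hP, hxy P' Φ hP']
  congr 1
  exact Finset.sum_congr rfl fun j _ => by rw [h j j.2]

/-! ### The point part of the left-hand side of the equation -/

/-- The coefficient of index `q` at a point of the point part of
`∑ i, (a i * ψ⁽ⁱ⁾ + ψ⁽ⁱ⁾ * b i)`. Here `α i`, `β i`, `δ i` are the coefficients of the point parts
of `a i`, `b i` and `ψ⁽ⁱ⁾`, `l` and `r` are the left and right jets of `ψ`, and `γ i` is the sum of
the left jet of `a i` and the right jet of `b i`. -/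
def eqnCoeff (M : ℕ) (α β γ δ : Fin (n + 1) → ℕ → ℂ) (l r : ℕ → ℂ) (q : ℕ) : ℂ :=
  ∑ i : Fin (n + 1), (mulCoeff M (fun k => r (i + k)) (α i) q +
    mulCoeff M (fun k => l (i + k)) (β i) q + mulCoeff M (γ i) (δ i) q)

theorem mulCoeff_eq_zero {M q : ℕ} {γ c : ℕ → ℂ} (h : ∀ j, q ≤ j → c j = 0) :
    mulCoeff M γ c q = 0 := by
  refine Finset.sum_eq_zero fun j _ => ?_
  rcases lt_or_ge j q with hj | hj
  · rw [Nat.choose_eq_zero_of_lt hj]; simp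
  · rw [h j hj, zero_mul]

theorem mulCoeff_eq_single {M q : ℕ} (hq : q < M) {γ c : ℕ → ℂ} (h : ∀ j, q < j → c j = 0) :
    mulCoeff M γ c q = c q * γ 0 := by
  rw [mulCoeff, Finset.sum_eq_single q]
  · simp
  · intro j _ hj
    rcases lt_or_gt_of_ne hj with hj | hj
    · rw [Nat.choose_eq_zero_of_lt hj]; simp
    · rw [h j hj, zero_mul]
  · intro h'
    exact absurd (Finset.mem_range.2 hq) h'

/-- If only the leading term `ψ⁽ⁿ⁾` contributes to the coefficient of index `q`, then its
contribution is `δ n q * γ n 0`. -/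
theorem eqnCoeff_eq_leading {M q : ℕ} (hq : q < M) {α β γ δ : Fin (n + 1) → ℕ → ℂ} {l r : ℕ → ℂ}
    (hα : ∀ i j, q ≤ j → α i j = 0) (hβ : ∀ i j, q ≤ j → β i j = 0)
    (hδ : ∀ i j, q ≤ j → (i ≠ Fin.last n ∨ q < j) → δ i j = 0) :
    eqnCoeff M α β γ δ l r q = δ (Fin.last n) q * γ (Fin.last n) 0 := by
  rw [eqnCoeff, Finset.sum_eq_single (Fin.last n)]
  · rw [mulCoeff_eq_zero (hα _), mulCoeff_eq_zero (hβ _), mulCoeff_eq_single hq]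
    · ring
    · exact fun j hj => hδ _ j hj.le (Or.inr hj)
  · intro i _ hi
    rw [mulCoeff_eq_zero (hα _), mulCoeff_eq_zero (hβ _),
      mulCoeff_eq_zero fun j hj => hδ i j hj (Or.inl hi)]
    ring
  · simp

/-- At a point where the leading coefficient does not degenerate, a solution has no point part,
provided that the coefficients have order at most `n`. -/
theorem coeff_eq_zero_of_eqnCoeff {M N : ℕ} (hM : N + n ≤ M) {α β γ δ : Fin (n + 1) → ℕ → ℂ}
    {l r c : ℕ → ℂ} (hα : ∀ i j, n ≤ j → α i j = 0) (hβ : ∀ i j, n ≤ j → β i j = 0)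
    (hγ : γ (Fin.last n) 0 ≠ 0)
    (hδ : ∀ (i : Fin (n + 1)) j, (i : ℕ) ≤ j → δ i j = (-1) ^ (i : ℕ) * c (j - i))
    (hc : ∀ j, N ≤ j → c j = 0) (h : ∀ q, eqnCoeff M α β γ δ l r q = 0) (j : ℕ) : c j = 0 := by
  induction hk : N - j using Nat.strong_induction_on generalizing j with
  | _ k ih =>
    by_cases hjN : N ≤ j
    · exact hc j hjN
    have hlt : ∀ j', j < j' → c j' = 0 := by
      intro j' hj'
      by_cases hj'N : N ≤ j'
      · exact hc j' hj'N
      · exact ih (N - j') (by omega) j' rfl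
    -- only `a n(x⁻) + b n(x⁺)` times the point part of `ψ⁽ⁿ⁾` contributes at index `n + j`
    have h1 := h (n + j)
    rw [eqnCoeff_eq_leading (by omega) (fun i j' hj' => hα i j' (by omega))
      (fun i j' hj' => hβ i j' (by omega)) (fun i j' hj' hor => ?_)] at h1
    · rw [hδ _ _ (by simp), Fin.val_last, Nat.add_sub_cancel_left] at h1
      have h2 := (mul_eq_zero.1 h1).resolve_right hγ
      exact (mul_eq_zero.1 h2).resolve_left (pow_ne_zero _ (by norm_num))
    · have hi := i.is_le
      rw [hδ i j' (by omega), hlt, mul_zero]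
      rcases hor with hor | hor
      · have : (i : ℕ) ≠ n := fun h => hor (Fin.ext (by simpa using h))
        omega
      · omega

/-- At a point where the coefficients are smooth, the derivatives of order less than `n` of a
solution without point part have no jumps. -/
theorem jump_eq_zero_of_eqnCoeff {M : ℕ} (hM : n ≤ M) {α β γ δ : Fin (n + 1) → ℕ → ℂ}
    {l r J : ℕ → ℂ} (hα : ∀ i j, α i j = 0) (hβ : ∀ i j, β i j = 0)
    (hγ : γ (Fin.last n) 0 ≠ 0)
    (hδ : ∀ (i : Fin (n + 1)) (j : ℕ), δ i j = if (i : ℕ) ≤ j then 0 else (-1) ^ j * J (i - 1 - j))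
    (h : ∀ q, eqnCoeff M α β γ δ l r q = 0) {k : ℕ} (hk : k < n) : J k = 0 := by
  induction k using Nat.strong_induction_on with
  | _ k ih =>
    -- the jump of index `k` enters through `ψ⁽ⁿ⁾` at index `n - 1 - k`, along with smaller jumps
    have h1 := h (n - 1 - k)
    rw [eqnCoeff_eq_leading (by omega) (fun i j' _ => hα i j')
      (fun i j' _ => hβ i j') (fun i j' hj' hor => ?_)] at h1
    · rw [hδ, Fin.val_last, if_neg (by omega), show n - 1 - (n - 1 - k) = k by omega] at h1
      have h2 := (mul_eq_zero.1 h1).resolve_right hγ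
      exact (mul_eq_zero.1 h2).resolve_left (pow_ne_zero _ (by norm_num))
    · have hi := i.is_le
      rw [hδ]
      split_ifs with hij
      · rfl
      · rw [ih _ ?_ ?_, mul_zero]
        · rcases hor with hor | hor
          · have : (i : ℕ) ≠ n := fun h => hor (Fin.ext (by simpa using h))
            omega
          · omega
        · omega

/-! ### The interface conditions -/

/-- A functional of left jets, right jets and jets of the right-hand side that, on solutions, is a
linear combination of derivatives of order less than `n`. -/
def IsReducible (ΓL ΓR : Fin (n + 1) → ℕ → ℂ) (ℓ : (ℕ → ℂ) → (ℕ → ℂ) → ℂ) : Prop :=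
  ∃ x y z : Fin n → ℂ, ∀ l r Φ : ℕ → ℂ, JetODE ΓL l Φ → JetODE ΓR r Φ →
    ℓ l r = ∑ j, x j * l j + ∑ j, y j * r j + ∑ j, z j * Φ j

variable {ΓL ΓR : Fin (n + 1) → ℕ → ℂ}

theorem IsReducible.add {ℓ ℓ' : (ℕ → ℂ) → (ℕ → ℂ) → ℂ} (h : IsReducible ΓL ΓR ℓ)
    (h' : IsReducible ΓL ΓR ℓ') : IsReducible ΓL ΓR (fun l r => ℓ l r + ℓ' l r) := by
  obtain ⟨x, y, z, H⟩ := h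
  obtain ⟨x', y', z', H'⟩ := h'
  refine ⟨x + x', y + y', z + z', fun l r Φ hl hr => ?_⟩
  simp only [H l r Φ hl hr, H' l r Φ hl hr, Pi.add_apply, add_mul, Finset.sum_add_distrib]
  ring

theorem IsReducible.const_mul {ℓ : (ℕ → ℂ) → (ℕ → ℂ) → ℂ} (h : IsReducible ΓL ΓR ℓ) (a : ℂ) :
    IsReducible ΓL ΓR (fun l r => a * ℓ l r) := by
  obtain ⟨x, y, z, H⟩ := h
  refine ⟨a • x, a • y, a • z, fun l r Φ hl hr => ?_⟩
  simp only [H l r Φ hl hr, Pi.smul_apply, smul_eq_mul, mul_assoc, ← Finset.mul_sum]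
  ring

theorem IsReducible.zero : IsReducible ΓL ΓR (fun _ _ => 0) :=
  ⟨0, 0, 0, fun _ _ _ _ _ => by simp⟩

theorem IsReducible.sum {ι : Type*} (A : Finset ι) {ℓ : ι → (ℕ → ℂ) → (ℕ → ℂ) → ℂ}
    (h : ∀ i ∈ A, IsReducible ΓL ΓR (ℓ i)) :
    IsReducible ΓL ΓR (fun l r => ∑ i ∈ A, ℓ i l r) := by
  classical
  induction A using Finset.induction_on with
  | empty => simpa using IsReducible.zero
  | insert i A hi ih =>
    simp only [Finset.sum_insert hi]
    exact (h i (by simp)).add (ih fun j hj => h j (by simp [hj]))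

theorem IsReducible.left (h0 : ΓL (Fin.last n) 0 ≠ 0) {k : ℕ} (hk : k < n + n) :
    IsReducible ΓL ΓR (fun l _ => l k) := by
  obtain ⟨x, y, H⟩ := JetODE.exists_reduction h0 n k hk
  exact ⟨x, 0, y, fun l r Φ hl _ => by simp [H l Φ hl]⟩

theorem IsReducible.right (h0 : ΓR (Fin.last n) 0 ≠ 0) {k : ℕ} (hk : k < n + n) :
    IsReducible ΓL ΓR (fun _ r => r k) := by
  obtain ⟨x, y, H⟩ := JetODE.exists_reduction h0 n k hk
  exact ⟨0, x, y, fun l r Φ _ hr => by simp [H r Φ hr]⟩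

/-- The vanishing of the point part at a singular point amounts to an interface condition between
the left and the right jets of the solution. There are `n` scalar conditions, since the coefficients
of index `n` and more vanish; the derivatives of order `n` and more that occur in them are
eliminated by means of the differential equation on either side. -/
theorem exists_interface_matrices (M : ℕ) {α β γ : Fin (n + 1) → ℕ → ℂ}
    (hα : ∀ i j, n ≤ j → α i j = 0) (hβ : ∀ i j, n ≤ j → β i j = 0)
    (hL : ΓL (Fin.last n) 0 ≠ 0) (hR : ΓR (Fin.last n) 0 ≠ 0) :
    ∃ A B D : Matrix (Fin n) (Fin n) ℂ, ∀ l r Φ : ℕ → ℂ, JetODE ΓL l Φ → JetODE ΓR r Φ →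
      ((∀ q, eqnCoeff M α β γ (fun i j => if (i : ℕ) ≤ j then 0 else
          (-1) ^ j * (r (i - 1 - j) - l (i - 1 - j))) l r q = 0) ↔
        A.mulVec (fun j => l j) = B.mulVec (fun j => r j) + D.mulVec (fun j => Φ j)) := by
  have hred : ∀ q : Fin n, IsReducible ΓL ΓR fun l r => eqnCoeff M α β γ (fun i j =>
      if (i : ℕ) ≤ j then 0 else (-1) ^ j * (r (i - 1 - j) - l (i - 1 - j))) l r q := by
    intro q
    refine IsReducible.sum _ fun i _ => ?_
    have hi := i.is_le
    refine (IsReducible.add ?_ ?_).add ?_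
    · refine IsReducible.sum _ fun j _ => ?_
      by_cases hj : n ≤ j
      · simpa [hα i j hj] using IsReducible.zero
      · exact ((IsReducible.right hR (by omega)).const_mul _).const_mul _
    · refine IsReducible.sum _ fun j _ => ?_
      by_cases hj : n ≤ j
      · simpa [hβ i j hj] using IsReducible.zero
      · exact ((IsReducible.left hL (by omega)).const_mul _).const_mul _
    · refine IsReducible.sum _ fun j _ => ?_
      by_cases hij : (i : ℕ) ≤ j
      · simpa [hij] using IsReducible.zero
      · simp only [if_neg hij]
        have h1 : IsReducible ΓL ΓR (fun _ r => r (i - 1 - j)) := IsReducible.right hR (by omega)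
        have h2 : IsReducible ΓL ΓR (fun l _ => l (i - 1 - j)) := IsReducible.left hL (by omega)
        have h3 := ((h1.add (h2.const_mul (-1))).const_mul
          ((-1) ^ j * ((j.choose q : ℂ) * γ i (j - q))))
        convert h3 using 3
        ring
  choose x y z H using hred
  refine ⟨Matrix.of x, -Matrix.of y, -Matrix.of z, fun l r Φ hl hr => ?_⟩
  rw [funext_iff]
  have hrow : ∀ q : Fin n, (Matrix.of x).mulVec (fun j => l j) q =
      ((-Matrix.of y).mulVec (fun j => r j) + (-Matrix.of z).mulVec (fun j => Φ j)) q ↔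
      eqnCoeff M α β γ (fun i j => if (i : ℕ) ≤ j then 0 else
          (-1) ^ j * (r (i - 1 - j) - l (i - 1 - j))) l r q = 0 := by
    intro q
    have hH := H q l r Φ hl hr
    beta_reduce at hH
    rw [hH]
    simp only [Matrix.mulVec, dotProduct, Pi.add_apply, Matrix.neg_apply, Matrix.of_apply, neg_mul,
      Finset.sum_neg_distrib]
    constructor
    · intro h; linear_combination h
    · intro h; linear_combination h
  simp only [hrow]
  refine ⟨fun h q => h q, fun h q => ?_⟩
  by_cases hq : q < n
  · exact h ⟨q, hq⟩
  · refine Finset.sum_eq_zero fun i _ => ?_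
    have hi := i.is_le
    rw [mulCoeff_eq_zero fun j hj => hα i j (by omega),
      mulCoeff_eq_zero fun j hj => hβ i j (by omega),
      mulCoeff_eq_zero fun j hj => if_pos (by omega)]
    ring

end jets

/-! ### Linear differential equations -/

/-- The successive terms of the Picard series of the linear equation `y' = A y + b`. -/
def picardTerm {E : Type*} [NormedAddCommGroup E] [NormedSpace ℝ E] (A : ℝ → E →L[ℝ] E)
    (b : ℝ → E) (t₀ : ℝ) (y₀ : E) : ℕ → ℝ → E
  | 0 => fun t => y₀ + ∫ s in t₀..t, b s
  | k + 1 => fun t => ∫ s in t₀..t, A s (picardTerm A b t₀ y₀ k s)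

section linear

variable {E : Type*} [NormedAddCommGroup E] [NormedSpace ℝ E]
  {A : ℝ → E →L[ℝ] E} {b : ℝ → E}

/-- The usual factorial bound for the terms of the Picard series. -/
theorem norm_picardTerm_le {t₀ R K C : ℝ} {y₀ : E} (hK : ∀ t, |t - t₀| ≤ R → ‖A t‖ ≤ K)
    (hC : ∀ t, |t - t₀| ≤ R → ‖picardTerm A b t₀ y₀ 0 t‖ ≤ C) (k : ℕ) {t : ℝ}
    (ht : |t - t₀| ≤ R) :
    ‖picardTerm A b t₀ y₀ k t‖ ≤ C * (K ^ k * |t - t₀| ^ k / k.factorial) := by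
  induction k generalizing t with
  | zero => simpa using hC t ht
  | succ k ih =>
    have hK0 : 0 ≤ K := (norm_nonneg _).trans (hK t ht)
    have hC0 : 0 ≤ C := (norm_nonneg _).trans (hC t ht)
    have hbound : ∀ s ∈ uIoc t₀ t, ‖A s (picardTerm A b t₀ y₀ k s)‖ ≤
        K * C * K ^ k / k.factorial * |s - t₀| ^ k := by
      intro s hs
      have hs' : |s - t₀| ≤ R := (abs_sub_left_of_mem_uIcc (uIoc_subset_uIcc hs)).trans ht
      calc ‖A s (picardTerm A b t₀ y₀ k s)‖ ≤ ‖A s‖ * ‖picardTerm A b t₀ y₀ k s‖ :=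
            (A s).le_opNorm _
        _ ≤ K * (C * (K ^ k * |s - t₀| ^ k / k.factorial)) := by
            gcongr
            · exact hK s hs'
            · exact ih hs'
        _ = _ := by ring
    have hint : IntegrableOn (fun s => K * C * K ^ k / k.factorial * |s - t₀| ^ k) (uIoc t₀ t) := by
      have : Continuous (fun s => K * C * K ^ k / k.factorial * |s - t₀| ^ k) := by fun_prop
      exact (this.integrableOn_uIcc).mono_set uIoc_subset_uIcc
    calc ‖picardTerm A b t₀ y₀ (k + 1) t‖
        ≤ ∫ s in uIoc t₀ t, ‖A s (picardTerm A b t₀ y₀ k s)‖ :=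
          intervalIntegral.norm_integral_le_integral_norm_uIoc
      _ ≤ ∫ s in uIoc t₀ t, K * C * K ^ k / k.factorial * |s - t₀| ^ k := by
          refine integral_mono_of_nonneg (Eventually.of_forall fun s => norm_nonneg _) hint ?_
          filter_upwards [ae_restrict_mem measurableSet_uIoc] with s hs
          exact hbound s hs
      _ = _ := by
          rw [integral_const_mul, integral_pow_abs_sub_uIoc, Nat.factorial_succ]
          push_cast
          field_simp
          ring

variable [CompleteSpace E]

theorem hasDerivAt_picardTerm_zero (hb : Continuous b) (t₀ : ℝ) (y₀ : E) (t : ℝ) :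
    HasDerivAt (picardTerm A b t₀ y₀ 0) (b t) t :=
  (hb.integral_hasStrictDerivAt t₀ t).hasDerivAt.const_add y₀

theorem continuous_picardTerm (hA : Continuous A) (hb : Continuous b) (t₀ : ℝ) (y₀ : E) (k : ℕ) :
    Continuous (picardTerm A b t₀ y₀ k) := by
  induction k with
  | zero => exact continuous_iff_continuousAt.2 fun t =>
      (hasDerivAt_picardTerm_zero hb t₀ y₀ t).continuousAt
  | succ k ih =>
    exact continuous_iff_continuousAt.2 fun t =>
      ((hA.clm_apply ih).integral_hasStrictDerivAt t₀ t).hasDerivAt.continuousAt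

theorem hasDerivAt_picardTerm_succ (hA : Continuous A) (hb : Continuous b) (t₀ : ℝ) (y₀ : E)
    (k : ℕ) (t : ℝ) :
    HasDerivAt (picardTerm A b t₀ y₀ (k + 1)) (A t (picardTerm A b t₀ y₀ k t)) t :=
  ((hA.clm_apply (continuous_picardTerm hA hb t₀ y₀ k)).integral_hasStrictDerivAt t₀ t).hasDerivAt

/-- Linear differential equations with continuous coefficients on the line have global
solutions. -/
theorem exists_hasDerivAt_linear (hA : Continuous A) (hb : Continuous b) (t₀ : ℝ) (y₀ : E) :
    ∃ y : ℝ → E, y t₀ = y₀ ∧ ∀ t, HasDerivAt y (A t (y t) + b t) t := by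
  set d := picardTerm A b t₀ y₀ with hd
  have d0 : d 0 t₀ = y₀ := by simp [hd, picardTerm]
  have dsucc : ∀ k, d (k + 1) t₀ = 0 := by
    intro k
    simp [hd, picardTerm]
  refine ⟨fun t => ∑' k, d k t, ?_, fun t => ?_⟩
  · change ∑' k, d k t₀ = y₀
    rw [tsum_eq_single 0]
    · exact d0
    · intro k hk
      obtain ⟨k, rfl⟩ := Nat.exists_eq_succ_of_ne_zero hk
      exact dsucc k
  · set R := |t - t₀| + 1 with hR
    have hcomp : IsCompact (Metric.closedBall t₀ R) := isCompact_closedBall t₀ R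
    obtain ⟨K, hK⟩ := hcomp.exists_bound_of_continuousOn hA.continuousOn
    obtain ⟨B, hB⟩ := hcomp.exists_bound_of_continuousOn hb.continuousOn
    obtain ⟨C, hC⟩ := hcomp.exists_bound_of_continuousOn
      (continuous_picardTerm hA hb t₀ y₀ 0).continuousOn
    have hball : ∀ s, |s - t₀| ≤ R → s ∈ Metric.closedBall t₀ R := fun s hs => by
      rwa [Metric.mem_closedBall, Real.dist_eq]
    have hK' : ∀ s, |s - t₀| ≤ R → ‖A s‖ ≤ K := fun s hs => hK s (hball s hs)
    have hC' : ∀ s, |s - t₀| ≤ R → ‖picardTerm A b t₀ y₀ 0 s‖ ≤ C := fun s hs => hC s (hball s hs)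
    have ht₀ : |t₀ - t₀| ≤ R := by rw [sub_self, abs_zero]; positivity
    have hK0 : 0 ≤ K := (norm_nonneg _).trans (hK' t₀ ht₀)
    have hC0 : 0 ≤ C := (norm_nonneg _).trans (hC' t₀ ht₀)
    have hbd : ∀ k s, |s - t₀| ≤ R → ‖d k s‖ ≤ C * ((K * R) ^ k / k.factorial) := by
      intro k s hs
      refine (norm_picardTerm_le hK' hC' k hs).trans ?_
      rw [mul_pow]
      gcongr
    set d' : ℕ → ℝ → E := fun k s => match k with
      | 0 => b s
      | k + 1 => A s (d k s) with hd'
    set u : ℕ → ℝ := fun k => match k with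
      | 0 => B
      | k + 1 => K * (C * ((K * R) ^ k / k.factorial)) with hu
    have hsum : Summable u :=
      (summable_nat_add_iff 1).1 (((Real.summable_pow_div_factorial _).mul_left C).mul_left K)
    have hder : ∀ k s, s ∈ Metric.ball t₀ R → HasDerivAt (d k) (d' k s) s := by
      intro k s _
      cases k with
      | zero => exact hasDerivAt_picardTerm_zero hb t₀ y₀ s
      | succ k => exact hasDerivAt_picardTerm_succ hA hb t₀ y₀ k s
    have hle : ∀ s, s ∈ Metric.ball t₀ R → |s - t₀| ≤ R := fun s hs => by
      rw [Metric.mem_ball, Real.dist_eq] at hs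
      exact hs.le
    have hd'u : ∀ k s, s ∈ Metric.ball t₀ R → ‖d' k s‖ ≤ u k := by
      intro k s hs
      cases k with
      | zero => exact hB s (hball s (hle s hs))
      | succ k =>
        exact ((A s).le_opNorm _).trans
          (mul_le_mul (hK' s (hle s hs)) (hbd k s (hle s hs)) (norm_nonneg _) hK0)
    have ht : t ∈ Metric.ball t₀ R := by
      rw [Metric.mem_ball, Real.dist_eq, hR]; linarith
    have hs : ∀ s, |s - t₀| ≤ R → Summable fun k => d k s := fun s hs =>
      Summable.of_norm_bounded ((Real.summable_pow_div_factorial _).mul_left C)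
        fun k => hbd k s hs
    have key := hasDerivAt_tsum_of_isPreconnected hsum Metric.isOpen_ball
      (convex_ball t₀ R).isPreconnected hder hd'u ht (hs t (hle t ht)) ht
    have hs' : Summable fun k => d' k t := .of_norm_bounded hsum fun k => hd'u k t ht
    have he : ∑' k, d' k t = A t (∑' k, d k t) + b t := by
      rw [hs'.tsum_eq_zero_add, (A t).map_tsum (hs t (hle t ht)), add_comm]
    rwa [he] at key

end linear

/-- The matrix of the first-order system of a scalar equation `p⁽ⁿ⁾ = ∑ i, z i * p⁽ⁱ⁾`. -/
def companion (n : ℕ) (z : Fin n → ℂ) : (Fin n → ℂ) →L[ℝ] (Fin n → ℂ) :=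
  ContinuousLinearMap.pi fun j => if h : (j : ℕ) + 1 < n then
    ContinuousLinearMap.proj (R := ℝ) (φ := fun _ : Fin n => ℂ) ⟨j + 1, h⟩ else
    ∑ i, z i • ContinuousLinearMap.proj (R := ℝ) (φ := fun _ : Fin n => ℂ) i

theorem companion_apply_of_lt {n : ℕ} (z y : Fin n → ℂ) {j : Fin n} (h : (j : ℕ) + 1 < n) :
    companion n z y j = y ⟨j + 1, h⟩ := by
  simp [companion, h]

theorem companion_apply_of_not_lt {n : ℕ} (z y : Fin n → ℂ) {j : Fin n} (h : ¬ (j : ℕ) + 1 < n) :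
    companion n z y j = ∑ i, z i * y i := by
  simp [companion, h]

theorem continuous_companion {X : Type*} [TopologicalSpace X] {n : ℕ} {z : X → Fin n → ℂ}
    (hz : ∀ i, Continuous fun t => z t i) :
    Continuous fun t => companion n (z t) := by
  have h : (fun t => companion n (z t)) = fun t => companion n 0 + ∑ i, z t i •
      (ContinuousLinearMap.pi fun j : Fin n => if (j : ℕ) + 1 < n then 0 else
        ContinuousLinearMap.proj (R := ℝ) (φ := fun _ : Fin n => ℂ) i :
          (Fin n → ℂ) →L[ℝ] (Fin n → ℂ)) := by
    funext t
    ext y j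
    by_cases hj : (j : ℕ) + 1 < n
    · simp [companion, hj]
    · simp [companion, hj]
  rw [h]
  exact continuous_const.add (continuous_finsetSum _ fun i _ => (hz i).smul continuous_const)

/-- A solution of a homogeneous linear equation that vanishes at a point vanishes to the right of
that point. -/
theorem eq_zero_of_linear_right {E : Type*} [NormedAddCommGroup E] [NormedSpace ℝ E] {K : Set ℝ}
    (hK : K.OrdConnected) {A : ℝ → E →L[ℝ] E} (hA : ContinuousOn A K) {z : ℝ → E}
    (hz : ∀ t ∈ K, HasDerivWithinAt z (A t (z t)) K t) {x₀ x : ℝ} (hx₀ : x₀ ∈ K) (hx : x ∈ K)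
    (hxx : x₀ ≤ x) (h0 : z x₀ = 0) : z x = 0 := by
  have hsub : Icc x₀ x ⊆ K := hK.out hx₀ hx
  obtain ⟨L, hL⟩ := isCompact_Icc.exists_bound_of_continuousOn (hA.mono hsub)
  refine eq_zero_of_abs_deriv_le_mul_abs_self_of_eq_zero_right (f' := fun t => A t (z t)) (K := L)
    (fun t ht => ((hz t (hsub ht)).continuousWithinAt).mono hsub) (fun t ht => ?_) h0
    (fun t ht => ((A t).le_opNorm _).trans
      (mul_le_mul_of_nonneg_right (hL t (Ico_subset_Icc_self ht)) (norm_nonneg _)))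
    x (right_mem_Icc.2 hxx)
  refine (hz t (hsub (Ico_subset_Icc_self ht))).mono_of_mem_nhdsWithin ?_
  have h1 : Icc t x ∈ 𝓝[≥] t := Icc_mem_nhdsGE ht.2
  exact mem_of_superset h1 ((Icc_subset_Icc_left ht.1).trans hsub)

theorem eq_zero_of_linear {E : Type*} [NormedAddCommGroup E] [NormedSpace ℝ E] {K : Set ℝ}
    (hK : K.OrdConnected) {A : ℝ → E →L[ℝ] E} (hA : ContinuousOn A K) {z : ℝ → E}
    (hz : ∀ t ∈ K, HasDerivWithinAt z (A t (z t)) K t) {x₀ x : ℝ} (hx₀ : x₀ ∈ K) (hx : x ∈ K)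
    (h0 : z x₀ = 0) : z x = 0 := by
  rcases le_total x₀ x with h | h
  · exact eq_zero_of_linear_right hK hA hz hx₀ hx h h0
  · -- reflect the interval
    have hmaps : MapsTo (fun t : ℝ => -t) ((fun t : ℝ => -t) ⁻¹' K) K := fun t ht => ht
    have key := eq_zero_of_linear_right (K := (fun t : ℝ => -t) ⁻¹' K) (A := fun t => -A (-t))
      (z := fun t => z (-t)) (x₀ := -x₀) (x := -x)
      (hK.preimage_anti fun _ _ h => neg_le_neg h)
      (hA.comp continuous_neg.continuousOn hmaps).neg
      (fun t ht => by
        have := (hz (-t) ht).scomp t (hasDerivAt_neg t).hasDerivWithinAt hmaps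
        simpa using! this)
      (by simpa using hx₀) (by simpa using hx) (neg_le_neg h) (by simpa using h0)
    simpa using key

theorem exists_continuous_extension {K : Set ℝ} (hK : IsClosed K) {g : ℝ → ℂ}
    (hg : ContinuousOn g K) : ∃ G : ℝ → ℂ, Continuous G ∧ ∀ x ∈ K, G x = g x := by
  obtain ⟨G, hG⟩ := ContinuousMap.exists_restrict_eq hK ⟨K.domRestrict g, hg.domRestrict⟩
  exact ⟨G, G.continuous, fun x hx => congrArg (fun F : C(K, ℂ) => F ⟨x, hx⟩) hG⟩

section scalar

variable {n : ℕ} {K : Set ℝ}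

/-- A scalar linear equation of positive order in normal form, with coefficients smooth on a closed
interval, has smooth solutions with arbitrary data. -/
theorem exists_normal_form_solution (hn : 0 < n) (hK : IsClosed K) (hu : UniqueDiffOn ℝ K)
    {c : Fin n → ℝ → ℂ} {φ : ℝ → ℂ} (hc : ∀ i, ContDiffOn ℝ ∞ (c i) K) (hφ : ContDiffOn ℝ ∞ φ K)
    {x₀ : ℝ} (hx₀ : x₀ ∈ K) (v : Fin n → ℂ) :
    ∃ p : ℝ → ℂ, ContDiffOn ℝ ∞ p K ∧
      (∀ x ∈ K, iteratedDerivWithin n p K x =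
        ∑ i, c i x * iteratedDerivWithin i p K x + φ x) ∧
      ∀ j : Fin n, iteratedDerivWithin j p K x₀ = v j := by
  -- extend the coefficients to the line, where the system has a global solution; the smoothness of
  -- the solution on `K` follows by induction from the system itself
  choose C hC hCc using fun i => exists_continuous_extension hK (hc i).continuousOn
  obtain ⟨Φ, hΦ, hΦφ⟩ := exists_continuous_extension hK hφ.continuousOn
  obtain ⟨y, hy0, hy⟩ := exists_hasDerivAt_linear
    (A := fun t => companion n fun i => C i t)
    (b := fun t j => if (j : ℕ) + 1 < n then 0 else Φ t)
    (continuous_companion hC)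
    (continuous_pi fun j => by split_ifs <;> fun_prop) x₀ v
  have hyj := fun t => hasDerivAt_pi.1 (hy t)
  have hder1 : ∀ (j : Fin n) (h : (j : ℕ) + 1 < n), ∀ t ∈ K,
      HasDerivWithinAt (fun t => y t j) (y t ⟨j + 1, h⟩) K t := by
    intro j h t _
    have := hyj t j
    simp only [Pi.add_apply, companion_apply_of_lt _ _ h, if_pos h, add_zero] at this
    exact this.hasDerivWithinAt
  have hder2 : ∀ (j : Fin n), ¬ (j : ℕ) + 1 < n → ∀ t ∈ K,
      HasDerivWithinAt (fun t => y t j) (∑ i, c i t * y t i + φ t) K t := by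
    intro j h t ht
    have := hyj t j
    simp only [Pi.add_apply, companion_apply_of_not_lt _ _ h, if_neg h, hCc _ t ht,
      hΦφ t ht] at this
    exact this.hasDerivWithinAt
  have hsm : ∀ k : ℕ, ∀ j, ContDiffOn ℝ k (fun t => y t j) K := by
    intro k
    induction k with
    | zero =>
      intro j
      exact contDiffOn_zero.2 fun t _ => (hyj t j).continuousAt.continuousWithinAt
    | succ k ih =>
      intro j
      rw [Nat.cast_succ, contDiffOn_succ_iff_derivWithin hu]
      refine ⟨fun t _ => (hyj t j).differentiableAt.differentiableWithinAt,
        fun h => absurd h (by simp), ?_⟩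
      by_cases h : (j : ℕ) + 1 < n
      · exact (ih ⟨j + 1, h⟩).congr fun t ht => (hder1 j h t ht).derivWithin (hu t ht)
      · refine ContDiffOn.congr ?_ fun t ht => (hder2 j h t ht).derivWithin (hu t ht)
        have hle : ((k : ℕ) : WithTop ℕ∞) ≤ ∞ := by exact_mod_cast le_top
        exact (ContDiffOn.sum fun i _ => ((hc i).of_le hle).mul (ih i)).add (hφ.of_le hle)
  have hit : ∀ j (h : j < n), ∀ t ∈ K,
      iteratedDerivWithin j (fun t => y t ⟨0, hn⟩) K t = y t ⟨j, h⟩ := by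
    intro j
    induction j with
    | zero => intro h t _; simp
    | succ j ih =>
      intro h t ht
      rw [iteratedDerivWithin_succ,
        derivWithin_congr (fun s hs => ih (by omega) s hs) (ih (by omega) t ht)]
      exact (hder1 ⟨j, by omega⟩ h t ht).derivWithin (hu t ht)
  refine ⟨fun t => y t ⟨0, hn⟩, contDiffOn_infty.2 fun k => hsm k _, fun t ht => ?_, fun j => ?_⟩
  · obtain ⟨n, rfl⟩ := Nat.exists_eq_succ_of_ne_zero hn.ne'
    rw [iteratedDerivWithin_succ, derivWithin_congr (fun s hs => hit n (by omega) s hs)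
      (hit n (by omega) t ht), (hder2 ⟨n, by omega⟩ (by simp) t ht).derivWithin (hu t ht)]
    exact congrArg (· + φ t) (Finset.sum_congr rfl fun i _ => by rw [hit i i.2 t ht])
  · rw [hit j j.2 x₀ hx₀, hy0]

/-- A scalar linear equation with coefficients smooth on a closed interval and non-vanishing
leading coefficient has smooth solutions with arbitrary data. -/
theorem exists_scalar_solution (hK : IsClosed K) (hu : UniqueDiffOn ℝ K)
    {g : Fin (n + 1) → ℝ → ℂ} {f : ℝ → ℂ} (hg : ∀ i, ContDiffOn ℝ ∞ (g i) K)
    (hf : ContDiffOn ℝ ∞ f K) (h0 : ∀ x ∈ K, g (Fin.last n) x ≠ 0)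
    {x₀ : ℝ} (hx₀ : x₀ ∈ K) (v : Fin n → ℂ) :
    ∃ p : ℝ → ℂ, ContDiffOn ℝ ∞ p K ∧
      (∀ x ∈ K, ∑ i : Fin (n + 1), g i x * iteratedDerivWithin i p K x = f x) ∧
      ∀ j : Fin n, iteratedDerivWithin j p K x₀ = v j := by
  have hφ : ContDiffOn ℝ ∞ (fun x => f x / g (Fin.last n) x) K :=
    (hf.mul ((hg _).inv h0)).congr fun x _ => div_eq_mul_inv _ _
  rcases Nat.eq_zero_or_pos n with rfl | hn
  · refine ⟨fun x => f x / g (Fin.last 0) x, hφ, fun x hx => ?_, fun j => j.elim0⟩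
    have := h0 x hx
    simp only [Fin.last, Fin.zero_eta] at this
    simp [Fin.last, mul_div_cancel₀, this]
  · obtain ⟨p, hp, he, hd⟩ := exists_normal_form_solution hn hK hu
      (c := fun i x => -(g i.castSucc x / g (Fin.last n) x)) (φ := fun x => f x / g (Fin.last n) x)
      (fun i => (((hg i.castSucc).mul ((hg _).inv h0)).congr fun x _ => div_eq_mul_inv _ _).neg)
      hφ hx₀ v
    refine ⟨p, hp, fun x hx => ?_, hd⟩
    rw [Fin.sum_univ_castSucc, Fin.val_last, he x hx, mul_add, Finset.mul_sum, ← add_assoc,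
      ← Finset.sum_add_distrib, mul_div_cancel₀ _ (h0 x hx)]
    refine (congrArg (· + f x) (Finset.sum_eq_zero fun i _ => ?_)).trans (zero_add _)
    have := h0 x hx
    simp only [Fin.val_castSucc]
    field_simp
    ring

/-- The solutions of a scalar linear equation with non-vanishing leading coefficient are determined
by their data at one point. -/
theorem scalar_solution_unique (hK : K.OrdConnected) (hu : UniqueDiffOn ℝ K)
    {g : Fin (n + 1) → ℝ → ℂ} {f p q : ℝ → ℂ} (hg : ∀ i, ContDiffOn ℝ ∞ (g i) K)
    (h0 : ∀ x ∈ K, g (Fin.last n) x ≠ 0) (hp : ContDiffOn ℝ ∞ p K) (hq : ContDiffOn ℝ ∞ q K)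
    (hpe : ∀ x ∈ K, ∑ i : Fin (n + 1), g i x * iteratedDerivWithin i p K x = f x)
    (hqe : ∀ x ∈ K, ∑ i : Fin (n + 1), g i x * iteratedDerivWithin i q K x = f x)
    {x₀ : ℝ} (hx₀ : x₀ ∈ K)
    (h : ∀ j < n, iteratedDerivWithin j p K x₀ = iteratedDerivWithin j q K x₀) :
    EqOn p q K := by
  have hd : ∀ {r : ℝ → ℂ}, ContDiffOn ℝ ∞ r K → ∀ j, ∀ t ∈ K,
      HasDerivWithinAt (iteratedDerivWithin j r K) (iteratedDerivWithin (j + 1) r K t) K t := by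
    intro r hr j t ht
    rw [iteratedDerivWithin_succ]
    exact ((hr.differentiableOn_iteratedDerivWithin (by exact_mod_cast WithTop.coe_lt_top _) hu)
      t ht).hasDerivWithinAt
  set w : ℕ → ℝ → ℂ := fun j t => iteratedDerivWithin j p K t - iteratedDerivWithin j q K t with hw
  have hwd : ∀ j, ∀ t ∈ K, HasDerivWithinAt (w j) (w (j + 1) t) K t :=
    fun j t ht => (hd hp j t ht).sub (hd hq j t ht)
  have hwe : ∀ t ∈ K, w n t = ∑ i : Fin n, -(g i.castSucc t / g (Fin.last n) t) * w i t := by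
    intro t ht
    have e : ∑ i : Fin (n + 1), g i t * w i t = 0 := by
      simp only [hw, mul_sub, Finset.sum_sub_distrib, hpe t ht, hqe t ht, sub_self]
    rw [Fin.sum_univ_castSucc, Fin.val_last] at e
    have h1 : w n t = -(∑ i : Fin n, g i.castSucc t * w i.castSucc t) / g (Fin.last n) t := by
      rw [eq_div_iff (h0 t ht)]
      linear_combination e
    rw [h1, ← Finset.sum_neg_distrib, Finset.sum_div]
    exact Finset.sum_congr rfl fun i _ => by rw [Fin.val_castSucc]; ring
  intro x hx
  rcases Nat.eq_zero_or_pos n with rfl | hn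
  · have := hwe x hx
    simp only [Finset.univ_eq_empty, Finset.sum_empty] at this
    simpa [hw] using sub_eq_zero.1 this
  · have key : (fun j : Fin n => w j x) = 0 := by
      have hC : ∀ i : Fin n, ContinuousOn (fun t => -(g i.castSucc t / g (Fin.last n) t)) K :=
        fun i => ((hg _).continuousOn.div (hg _).continuousOn h0).neg
      refine eq_zero_of_linear (z := fun t (j : Fin n) => w j t)
        (A := fun t => companion n fun i => -(g i.castSucc t / g (Fin.last n) t)) hK ?_ ?_ hx₀ hx ?_
      · rw [continuousOn_iff_continuous_domRestrict]
        exact continuous_companion fun i => (hC i).domRestrict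
      · intro t ht
        refine hasDerivWithinAt_pi.2 fun j => ?_
        by_cases hj : (j : ℕ) + 1 < n
        · rw [companion_apply_of_lt _ _ hj]
          exact hwd j t ht
        · rw [companion_apply_of_not_lt _ _ hj]
          rw [← hwe t ht]
          have := hwd j t ht
          rwa [show (j : ℕ) + 1 = n by omega] at this
      · funext j
        exact sub_eq_zero.2 (h j j.2)
    have := congrFun key ⟨0, hn⟩
    simpa [hw] using sub_eq_zero.1 this

end scalar

/-! ### The equation in terms of regular and point parts -/

theorem HasRep.add {F G : Distr} {T : Finset ℝ} {N : ℕ} {g h : ℝ → ℂ} {c d : ℝ → ℕ → ℂ}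
    (hF : HasRep F T N g c) (hG : HasRep G T N h d) :
    HasRep (F + G) T N (fun x => g x + h x) (fun s j => c s j + d s j) := by
  refine ⟨hF.pSmooth.add hG.pSmooth,
    fun s hs j => by rw [hF.coeff_notMem s hs, hG.coeff_notMem s hs, add_zero],
    fun s j hj => by rw [hF.coeff_le s j hj, hG.coeff_le s j hj, add_zero], fun t => ?_⟩
  have hi : ∀ {k : ℝ → ℂ}, PSmooth T k → Integrable (fun x => (t x : ℂ) * k x) := fun hk => by
    simpa only [smul_eq_mul] using hk.locallyIntegrable.integrable_smul_left_of_hasCompactSupport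
      (contDiff_ofReal_test t).continuous (hasCompactSupport_ofReal_test t)
  have e : (F + G) t = F t + G t := rfl
  rw [e, hF.apply_eq, hG.apply_eq]
  simp only [mul_add, integral_add (hi hF.pSmooth) (hi hG.pSmooth), pointPart, add_mul,
    Finset.sum_add_distrib]
  ring

theorem HasRep.zero (T : Finset ℝ) (N : ℕ) : HasRep 0 T N (fun _ => 0) 0 :=
  ⟨.of_contDiff contDiff_const, fun _ _ _ => rfl, fun _ _ _ => rfl, fun t => by
    have e : (0 : Distr) t = 0 := rfl
    simp [pointPart, e]⟩

theorem HasRep.sum {ι : Type*} (A : Finset ι) {F : ι → Distr} {T : Finset ℝ} {N : ℕ}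
    {h : ι → ℝ → ℂ} {c : ι → ℝ → ℕ → ℂ} (H : ∀ i, HasRep (F i) T N (h i) (c i)) :
    HasRep (∑ i ∈ A, F i) T N (fun x => ∑ i ∈ A, h i x) (fun s j => ∑ i ∈ A, c i s j) := by
  classical
  induction A using Finset.induction_on with
  | empty => simpa using! HasRep.zero T N
  | insert i A hi ih =>
    simp only [Finset.sum_insert hi]
    exact (H i).add ih

theorem HasRep.eq_ofFun_iff {F : Distr} {T : Finset ℝ} {N : ℕ} {h f : ℝ → ℂ} {c : ℝ → ℕ → ℂ}
    (H : HasRep F T N h c) (hf : ContDiff ℝ ∞ f) :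
    F = ofFun f ↔ (∀ x ∉ T, h x = f x) ∧ ∀ s j, c s j = 0 := by
  constructor
  · intro e
    have hA : AgreesOn F f univ := fun t _ => by
      rw [e, ofFun_apply hf.continuous.locallyIntegrable]
    obtain ⟨h1, h2⟩ := H.eqOn_of_agreesOn isOpen_univ hf.continuous.continuousOn hA
    exact ⟨fun x hx => h1 x (mem_univ x) hx, fun s => h2 s (mem_univ s)⟩
  · rintro ⟨h1, h2⟩
    refine DFunLike.ext _ _ fun t => ?_
    rw [ofFun_apply hf.continuous.locallyIntegrable]
    exact H.agreesOn_of_eqOn (U := univ) (fun s _ => h2 s) (fun x _ hx => h1 x hx) t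
      (subset_univ _)

/-- A distribution without point part is given by any function that coincides with its regular part
off a finite set. -/
theorem HasRep.eq_ofFun {F : Distr} {T T' : Finset ℝ} {N : ℕ} {h g : ℝ → ℂ} {c : ℝ → ℕ → ℂ}
    (H : HasRep F T N h c) (hg : PSmooth T' g) (hc : ∀ s j, c s j = 0)
    (hh : ∀ x ∉ T, h x = g x) : F = ofFun g := by
  refine DFunLike.ext _ _ fun t => ?_
  rw [ofFun_apply hg.locallyIntegrable]
  exact H.agreesOn_of_eqOn (U := univ) (fun s _ => hc s) (fun x _ hx => hh x hx) t
    (subset_univ _)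

theorem PSmooth.leftLim_sum {ι : Type*} (A : Finset ι) {T : Finset ℝ} {g : ι → ℝ → ℂ}
    (hg : ∀ i, PSmooth T (g i)) (s : ℝ) (j : ℕ) :
    leftLim (fun x => ∑ i ∈ A, g i x) s j = ∑ i ∈ A, leftLim (g i) s j := by
  classical
  induction A using Finset.induction_on with
  | empty =>
    simp only [Finset.sum_empty]
    rw [leftLim_of_contDiffAt contDiffAt_const, iteratedDeriv_fun_const_zero]
  | insert i A hi ih =>
    simp only [Finset.sum_insert hi]
    rw [(hg i).leftLim_add (PSmooth.sum A fun i _ => hg i), ih]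

theorem PSmooth.rightLim_sum {ι : Type*} (A : Finset ι) {T : Finset ℝ} {g : ι → ℝ → ℂ}
    (hg : ∀ i, PSmooth T (g i)) (s : ℝ) (j : ℕ) :
    rightLim (fun x => ∑ i ∈ A, g i x) s j = ∑ i ∈ A, rightLim (g i) s j := by
  classical
  induction A using Finset.induction_on with
  | empty =>
    simp only [Finset.sum_empty]
    rw [rightLim_of_contDiffAt contDiffAt_const, iteratedDeriv_fun_const_zero]
  | insert i A hi ih =>
    simp only [Finset.sum_insert hi]
    rw [(hg i).rightLim_add (PSmooth.sum A fun i _ => hg i), ih]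

section equation

variable {n : ℕ} {a b : Fin (n + 1) → Distr} {T T' : Finset ℝ} {N N' : ℕ}
  {u v : Fin (n + 1) → ℝ → ℂ} {α β : Fin (n + 1) → ℝ → ℕ → ℂ} {h f : ℝ → ℂ}

/-- The left jet of a solution satisfies all differentiated versions of the equation. -/
theorem jetODE_leftLim {w : Fin (n + 1) → ℝ → ℂ} (hw : ∀ i, PSmooth T (w i)) (hh : PSmooth T h)
    (hf : ContDiff ℝ ∞ f) (he : ∀ x ∉ T, ∑ i : Fin (n + 1), w i x * iteratedDeriv i h x = f x)
    (s : ℝ) :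
    JetODE (fun i => leftLim (w i) s) (leftLim h s) (fun k => iteratedDeriv k f s) := by
  intro q
  have h1 : leftLim (fun x => ∑ i : Fin (n + 1), iteratedDeriv i h x * w i x) s q =
      iteratedDeriv q f s := by
    rw [← leftLim_of_contDiffAt hf.contDiffAt]
    refine leftLim_congr (eventually_eventuallyEq_left (T := T) isOpen_univ univ_mem
      fun x _ hx => ?_) q
    rw [← he x hx]
    exact Finset.sum_congr rfl fun i _ => mul_comm _ _
  rw [PSmooth.leftLim_sum _ fun i : Fin (n + 1) => (hh.iterDeriv i).mul (hw i)] at h1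
  refine (Finset.sum_congr rfl fun i _ => ?_).trans h1
  rw [(hh.iterDeriv i).leftLim_mul (hw i)]
  simp only [leftLim_iteratedDeriv]

/-- The right jet of a solution satisfies all differentiated versions of the equation. -/
theorem jetODE_rightLim {w : Fin (n + 1) → ℝ → ℂ} (hw : ∀ i, PSmooth T (w i)) (hh : PSmooth T h)
    (hf : ContDiff ℝ ∞ f) (he : ∀ x ∉ T, ∑ i : Fin (n + 1), w i x * iteratedDeriv i h x = f x)
    (s : ℝ) :
    JetODE (fun i => rightLim (w i) s) (rightLim h s) (fun k => iteratedDeriv k f s) := by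
  intro q
  have h1 : rightLim (fun x => ∑ i : Fin (n + 1), iteratedDeriv i h x * w i x) s q =
      iteratedDeriv q f s := by
    rw [← rightLim_of_contDiffAt hf.contDiffAt]
    refine rightLim_congr (eventually_eventuallyEq_right (T := T) isOpen_univ univ_mem
      fun x _ hx => ?_) q
    rw [← he x hx]
    exact Finset.sum_congr rfl fun i _ => mul_comm _ _
  rw [PSmooth.rightLim_sum _ fun i : Fin (n + 1) => (hh.iterDeriv i).mul (hw i)] at h1
  refine (Finset.sum_congr rfl fun i _ => ?_).trans h1
  rw [(hh.iterDeriv i).rightLim_mul (hw i)]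
  simp only [rightLim_iteratedDeriv]

/-- The coefficients `a i` and `b i` have regular parts `u i` and `v i` and point parts with
coefficients `α i` and `β i`. -/
structure CoeffRep (a b : Fin (n + 1) → Distr) (T : Finset ℝ) (N : ℕ)
    (u v : Fin (n + 1) → ℝ → ℂ) (α β : Fin (n + 1) → ℝ → ℕ → ℂ) : Prop where
  left : ∀ i, HasRep (a i) T N (u i) (α i)
  right : ∀ i, HasRep (b i) T N (v i) (β i)

theorem CoeffRep.mono (R : CoeffRep a b T N u v α β) (hT : T ⊆ T') (hN : N ≤ N') :
    CoeffRep a b T' N' u v α β :=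
  ⟨fun i => (R.left i).mono hT hN, fun i => (R.right i).mono hT hN⟩

theorem exists_coeffRep (ha : ∀ i, a i ∈ spaceA) (hb : ∀ i, b i ∈ spaceA) :
    ∃ T N u v α β, CoeffRep a b T N u v α β := by
  choose T N u α H using fun i => exists_hasRep_of_mem_spaceA (ha i)
  choose T' N' v β H' using fun i => exists_hasRep_of_mem_spaceA (hb i)
  refine ⟨Finset.univ.biUnion fun i => T i ∪ T' i, ∑ i, (N i + N' i), u, v, α, β,
    fun i => (H i).mono ?_ ?_, fun i => (H' i).mono ?_ ?_⟩
  · exact Finset.subset_union_left.trans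
      (Finset.subset_biUnion_of_mem (fun i => T i ∪ T' i) (Finset.mem_univ i))
  · exact (Nat.le_add_right _ _).trans
      (Finset.single_le_sum (f := fun i => N i + N' i) (fun _ _ => Nat.zero_le _)
        (Finset.mem_univ i))
  · exact Finset.subset_union_right.trans
      (Finset.subset_biUnion_of_mem (fun i => T i ∪ T' i) (Finset.mem_univ i))
  · exact (Nat.le_add_left _ _).trans
      (Finset.single_le_sum (f := fun i => N i + N' i) (fun _ _ => Nat.zero_le _)
        (Finset.mem_univ i))

theorem CoeffRep.hasRep_equation (R : CoeffRep a b T N u v α β) {ψ : Distr} {c : ℝ → ℕ → ℂ}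
    (H : HasRep ψ T N h c) :
    HasRep (∑ i : Fin (n + 1), (starProd (a i) (distDeriv i ψ) + starProd (distDeriv i ψ) (b i)))
      T (N + n) (fun x => ∑ i : Fin (n + 1),
        (u i x * iteratedDeriv i h x + iteratedDeriv i h x * v i x))
      (fun s => eqnCoeff (N + n) (fun i => α i s) (fun i => β i s)
        (fun i k => leftLim (u i) s k + rightLim (v i) s k) (fun i => derivCoeff h c i s)
        (leftLim h s) (rightLim h s)) := by
  have hd : ∀ i : Fin (n + 1),
      HasRep (distDeriv i ψ) T (N + n) (iteratedDeriv i h) (derivCoeff h c i) := fun i =>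
    (H.deriv i).mono subset_rfl (by omega)
  have R' := R.mono subset_rfl (Nat.le_add_right N n)
  convert HasRep.sum Finset.univ fun i =>
    ((R'.left i).starProd (hd i)).add ((hd i).starProd (R'.right i)) using 1
  funext s q
  refine Finset.sum_congr rfl fun i _ => ?_
  have e1 : rightLim (iteratedDeriv i h) s = fun k => rightLim h s (i + k) :=
    funext fun k => rightLim_iteratedDeriv h i s k
  have e2 : leftLim (iteratedDeriv i h) s = fun k => leftLim h s (i + k) :=
    funext fun k => leftLim_iteratedDeriv h i s k
  rw [starCoeff, starCoeff, e1, e2]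
  have e3 : mulCoeff (N + n) (fun k => leftLim (u i) s k + rightLim (v i) s k)
      (derivCoeff h c i s) q = mulCoeff (N + n) (leftLim (u i) s) (derivCoeff h c i s) q +
        mulCoeff (N + n) (rightLim (v i) s) (derivCoeff h c i s) q := by
    simp only [mulCoeff, mul_add, Finset.sum_add_distrib]
  rw [e3]
  ring

/-- The equation splits into an ordinary differential equation for the regular part of the solution
and the vanishing of all coefficients of the point part. -/
theorem CoeffRep.equation_iff (R : CoeffRep a b T N u v α β) {ψ : Distr} {c : ℝ → ℕ → ℂ}
    (H : HasRep ψ T N h c) (hf : ContDiff ℝ ∞ f) :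
    ∑ i : Fin (n + 1), (starProd (a i) (distDeriv i ψ) + starProd (distDeriv i ψ) (b i)) =
        ofFun f ↔
      (∀ x ∉ T, ∑ i : Fin (n + 1), (u i x + v i x) * iteratedDeriv i h x = f x) ∧
      ∀ s q, eqnCoeff (N + n) (fun i => α i s) (fun i => β i s)
        (fun i k => leftLim (u i) s k + rightLim (v i) s k) (fun i => derivCoeff h c i s)
        (leftLim h s) (rightLim h s) q = 0 := by
  rw [(R.hasRep_equation H).eq_ofFun_iff hf]
  have e : ∀ x, ∑ i : Fin (n + 1), (u i x * iteratedDeriv i h x + iteratedDeriv i h x * v i x) =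
      ∑ i : Fin (n + 1), (u i x + v i x) * iteratedDeriv i h x := fun x =>
    Finset.sum_congr rfl fun i _ => by ring
  simp only [e]

theorem HasRep.leftLim_of_hasLeftValue {F : Distr} {c : ℝ → ℕ → ℂ} (H : HasRep F T N h c) {x : ℝ}
    {z : ℂ} (hz : HasLeftValue F x z) : leftLim h x 0 = z := by
  obtain ⟨ε, g, hε, hg, hFg, hgz⟩ := hz
  have h1 := (H.eqOn_of_agreesOn isOpen_Ioo hg.continuousOn hFg).1
  refine leftLim_eq (j := 0) ?_
  rw [iteratedDeriv_zero]
  refine hgz.congr' ?_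
  filter_upwards [Ioo_mem_nhdsLT (sub_lt_self x hε), eventually_notMem_finset_left T x]
    with y hy hyT
  exact (h1 y hy hyT).symm

theorem HasRep.rightLim_of_hasRightValue {F : Distr} {c : ℝ → ℕ → ℂ} (H : HasRep F T N h c)
    {x : ℝ} {z : ℂ} (hz : HasRightValue F x z) : rightLim h x 0 = z := by
  obtain ⟨ε, g, hε, hg, hFg, hgz⟩ := hz
  have h1 := (H.eqOn_of_agreesOn isOpen_Ioo hg.continuousOn hFg).1
  refine rightLim_eq (j := 0) ?_
  rw [iteratedDeriv_zero]
  refine hgz.congr' ?_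
  filter_upwards [Ioo_mem_nhdsGT (lt_add_of_pos_right x hε), eventually_notMem_finset_right T x]
    with y hy hyT
  exact (h1 y hy hyT).symm

/-- Closed extensions are unique. -/
theorem IsClosedExtension.eqOn {F : Distr} {c : ℝ → ℕ → ℂ} (H : HasRep F T N h c) {Ω : Set ℝ}
    (hΩ : IsOpen Ω) {p q : ℝ → ℂ} (hp : IsClosedExtension F Ω p) (hq : IsClosedExtension F Ω q) :
    EqOn p q (closure Ω) := by
  have hd : Ω ∩ (T : Set ℝ)ᶜ ⊆ closure Ω := inter_subset_left.trans subset_closure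
  refine EqOn.of_subset_closure (s := Ω ∩ (T : Set ℝ)ᶜ) (fun x hx => ?_) hp.1.continuousOn
    hq.1.continuousOn hd (closure_subset_closure_inter_compl T hΩ)
  rw [← hp.eq_of_notMem H hΩ x hx.1 hx.2, hq.eq_of_notMem H hΩ x hx.1 hx.2]

end equation

/-! ### Solutions as glued solutions of regular equations -/

section gluing

variable {n m : ℕ} {a b : Fin (n + 1) → Distr} {ξ : Fin m → ℝ} {T : Finset ℝ} {N : ℕ}
  {u v : Fin (n + 1) → ℝ → ℂ} {α β : Fin (n + 1) → ℝ → ℕ → ℂ} {h f : ℝ → ℂ}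

theorem exists_piece_mem_nhdsLT (hξ : StrictMono ξ) (s : ℝ) : ∃ k, piece ξ k ∈ 𝓝[<] s := by
  by_cases hs : s ∈ range ξ
  · obtain ⟨j, rfl⟩ := hs
    exact ⟨_, piece_castSucc_mem_nhdsLT hξ j⟩
  · obtain ⟨k, hk⟩ := exists_mem_piece hξ hs
    exact ⟨k, nhdsWithin_le_nhds ((isOpen_piece ξ k).mem_nhds hk)⟩

theorem exists_piece_mem_nhdsGT (hξ : StrictMono ξ) (s : ℝ) : ∃ k, piece ξ k ∈ 𝓝[>] s := by
  by_cases hs : s ∈ range ξ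
  · obtain ⟨j, rfl⟩ := hs
    exact ⟨_, piece_succ_mem_nhdsGT hξ j⟩
  · obtain ⟨k, hk⟩ := exists_mem_piece hξ hs
    exact ⟨k, nhdsWithin_le_nhds ((isOpen_piece ξ k).mem_nhds hk)⟩

theorem disjoint_piece_singSupp_left (hI : range ξ = singularSet a b) (k : Fin (m + 1))
    (i : Fin (n + 1)) : Disjoint (piece ξ k) (singSupp (a i)) :=
  (disjoint_piece_range ξ k).mono_right (hI ▸ subset_union_left.trans
    (subset_iUnion (fun i => singSupp (a i) ∪ singSupp (b i)) i))

theorem disjoint_piece_singSupp_right (hI : range ξ = singularSet a b) (k : Fin (m + 1))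
    (i : Fin (n + 1)) : Disjoint (piece ξ k) (singSupp (b i)) :=
  (disjoint_piece_range ξ k).mono_right (hI ▸ subset_union_right.trans
    (subset_iUnion (fun i => singSupp (a i) ∪ singSupp (b i)) i))

theorem CoeffRep.pSmooth_add (R : CoeffRep a b T N u v α β) (i : Fin (n + 1)) :
    PSmooth T (fun x => u i x + v i x) :=
  (R.left i).pSmooth.add (R.right i).pSmooth

theorem CoeffRep.leftLim_leading_ne_zero (R : CoeffRep a b T N u v α β) (hξ : StrictMono ξ)
    (hI : range ξ = singularSet a b) (hC2 : NondegenerateOnRegular a b) (s : ℝ) :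
    leftLim (fun x => u (Fin.last n) x + v (Fin.last n) x) s 0 ≠ 0 := by
  obtain ⟨k, hk⟩ := exists_piece_mem_nhdsLT hξ s
  obtain ⟨p, q, hp, hq, h0⟩ := hC2 _ (isOpen_piece ξ k) (ordConnected_piece ξ k)
    (hI ▸ disjoint_piece_range ξ k)
  rw [leftLim_eq_iteratedDerivWithin (T := T) (isOpen_piece ξ k) (ordConnected_piece ξ k)
    (hp.1.add hq.1) (fun x hx hxT => ?_) hk]
  · rw [iteratedDerivWithin_zero]
    exact h0 s (mem_closure_iff_nhdsWithin_neBot.2 (neBot_of_le (le_inf nhdsWithin_le_nhds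
      (le_principal_iff.2 hk))))
  · rw [hp.eq_of_notMem (R.left _) (isOpen_piece ξ k) x hx hxT,
      hq.eq_of_notMem (R.right _) (isOpen_piece ξ k) x hx hxT]

theorem CoeffRep.rightLim_leading_ne_zero (R : CoeffRep a b T N u v α β) (hξ : StrictMono ξ)
    (hI : range ξ = singularSet a b) (hC2 : NondegenerateOnRegular a b) (s : ℝ) :
    rightLim (fun x => u (Fin.last n) x + v (Fin.last n) x) s 0 ≠ 0 := by
  obtain ⟨k, hk⟩ := exists_piece_mem_nhdsGT hξ s
  obtain ⟨p, q, hp, hq, h0⟩ := hC2 _ (isOpen_piece ξ k) (ordConnected_piece ξ k)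
    (hI ▸ disjoint_piece_range ξ k)
  rw [rightLim_eq_iteratedDerivWithin (T := T) (isOpen_piece ξ k) (ordConnected_piece ξ k)
    (hp.1.add hq.1) (fun x hx hxT => ?_) hk]
  · rw [iteratedDerivWithin_zero]
    exact h0 s (mem_closure_iff_nhdsWithin_neBot.2 (neBot_of_le (le_inf nhdsWithin_le_nhds
      (le_principal_iff.2 hk))))
  · rw [hp.eq_of_notMem (R.left _) (isOpen_piece ξ k) x hx hxT,
      hq.eq_of_notMem (R.right _) (isOpen_piece ξ k) x hx hxT]

theorem notMem_singSupp_left {s : ℝ} (hs : s ∉ singularSet a b) (i : Fin (n + 1)) :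
    s ∉ singSupp (a i) := fun h => hs (mem_iUnion.2 ⟨i, Or.inl h⟩)

theorem notMem_singSupp_right {s : ℝ} (hs : s ∉ singularSet a b) (i : Fin (n + 1)) :
    s ∉ singSupp (b i) := fun h => hs (mem_iUnion.2 ⟨i, Or.inr h⟩)

/-- The factor with which the point part of `ψ⁽ⁿ⁾` enters into the equation does not vanish at any
point: at singular points by hypothesis, elsewhere because it is the leading coefficient. -/
theorem CoeffRep.leading_ne_zero (R : CoeffRep a b T N u v α β) (hξ : StrictMono ξ)
    (hI : range ξ = singularSet a b) (hC1 : NondegenerateAtSingular a b)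
    (hC2 : NondegenerateOnRegular a b) (s : ℝ) :
    leftLim (u (Fin.last n)) s 0 + rightLim (v (Fin.last n)) s 0 ≠ 0 := by
  by_cases hs : s ∈ singularSet a b
  · obtain ⟨c, d, hc, hd, h0⟩ := hC1 s hs
    rwa [(R.left _).leftLim_of_hasLeftValue hc, (R.right _).rightLim_of_hasRightValue hd]
  · rw [← ((R.right _).regular_of_notMem_singSupp (notMem_singSupp_right hs _)).2,
      ← (R.left _).pSmooth.leftLim_add (R.right _).pSmooth]
    exact R.leftLim_leading_ne_zero hξ hI hC2 s

theorem order_left_le (hM : maxOrder a b ≤ (n : ℕ∞)) (i : Fin (n + 1)) : order (a i) ≤ n :=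
  (le_max_left _ _).trans ((le_iSup (fun i => max (order (a i)) (order (b i))) i).trans hM)

theorem order_right_le (hM : maxOrder a b ≤ (n : ℕ∞)) (i : Fin (n + 1)) : order (b i) ≤ n :=
  (le_max_right _ _).trans ((le_iSup (fun i => max (order (a i)) (order (b i))) i).trans hM)

/-- Every solution is a piecewise smooth function, with jumps at the singular points only. -/
theorem IsSolution.exists_eq_glue (ha : ∀ i, a i ∈ spaceA) (hb : ∀ i, b i ∈ spaceA)
    (hξ : StrictMono ξ) (hI : range ξ = singularSet a b) (hC1 : NondegenerateAtSingular a b)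
    (hC2 : NondegenerateOnRegular a b) (hM : maxOrder a b ≤ (n : ℕ∞)) (hf : ContDiff ℝ ∞ f)
    {ψ : Distr} (hψ : IsSolution a b f ψ) :
    ∃ p : Fin (m + 1) → ℝ → ℂ, (∀ k, ContDiffOn ℝ ∞ (p k) (closure (piece ξ k))) ∧
      ψ = glue ξ p := by
  obtain ⟨T₀, N₀, u, v, α, β, R₀⟩ := exists_coeffRep ha hb
  obtain ⟨T₁, N₁, h, c, H₁⟩ := exists_hasRep_of_mem_spaceA hψ.1
  have R := R₀.mono (T' := T₀ ∪ T₁) Finset.subset_union_left (le_max_left N₀ N₁)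
  have H := H₁.mono (T' := T₀ ∪ T₁) Finset.subset_union_right (le_max_right N₀ N₁)
  generalize T₀ ∪ T₁ = T at R H
  generalize max N₀ N₁ = N at R H
  obtain ⟨hode, hpt⟩ := (R.equation_iff H hf).1 hψ.2
  have hα := fun s i j (hj : n ≤ j) => (R.left i).coeff_eq_zero_of_order_le
    (order_left_le hM i) s hj
  have hβ := fun s i j (hj : n ≤ j) => (R.right i).coeff_eq_zero_of_order_le
    (order_right_le hM i) s hj
  -- there is no point part
  have hc : ∀ s j, c s j = 0 := fun s =>
    coeff_eq_zero_of_eqnCoeff le_rfl (hα s) (hβ s) (R.leading_ne_zero hξ hI hC1 hC2 s)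
      (fun i j hij => if_pos hij) (H.coeff_le s) (hpt s)
  -- there are no jumps off the singular points: the first `n` derivatives do not jump because of
  -- the point part of the equation, the others because of its regular part
  have hj : ∀ s ∉ range ξ, ∀ j, leftLim h s j = rightLim h s j := by
    intro s hs
    rw [hI] at hs
    have hreg := fun i => (R.left i).regular_of_notMem_singSupp (notMem_singSupp_left hs i)
    have hreg' := fun i => (R.right i).regular_of_notMem_singSupp (notMem_singSupp_right hs i)
    have hL := jetODE_leftLim R.pSmooth_add H.pSmooth hf hode s
    have hR := jetODE_rightLim R.pSmooth_add H.pSmooth hf hode s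
    have hLR : (fun i : Fin (n + 1) => rightLim (fun x => u i x + v i x) s) =
        fun i => leftLim (fun x => u i x + v i x) s := by
      funext i j
      rw [(R.left i).pSmooth.leftLim_add (R.right i).pSmooth,
        (R.left i).pSmooth.rightLim_add (R.right i).pSmooth, (hreg i).2, (hreg' i).2]
    rw [hLR] at hR
    refine hL.unique (R.leftLim_leading_ne_zero hξ hI hC2 s) hR fun j hjn => ?_
    have := jump_eq_zero_of_eqnCoeff (J := jump h s) (Nat.le_add_left n N)
      (fun i => (hreg i).1) (fun i => (hreg' i).1) (R.leading_ne_zero hξ hI hC1 hC2 s)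
      (fun i j => by simp only [derivCoeff, hc, mul_zero]) (hpt s) hjn
    exact (sub_eq_zero.1 this).symm
  choose p hp hhp using fun k => H.pSmooth.exists_contDiffOn_closure (isOpen_piece ξ k)
    (ordConnected_piece ξ k) (piece_nonempty hξ k)
    fun x hx => hj x (disjoint_left.1 (disjoint_piece_range ξ k) hx)
  refine ⟨p, hp, (H.mono (T' := T ∪ Finset.univ.image ξ) Finset.subset_union_left le_rfl).eq_ofFun
    (pSmooth_glueFun hξ hp) hc fun x hx => ?_⟩
  rw [Finset.mem_union, not_or] at hx
  obtain ⟨k, hk⟩ := exists_mem_piece hξ (x := x) fun h => hx.2 (by simpa using h)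
  exact (hhp k x hk hx.1).trans (glueFun_eq p hk).symm

theorem iteratedDeriv_glueFun (p : Fin (m + 1) → ℝ → ℂ) {k : Fin (m + 1)}
    {x : ℝ} (hp : ContDiffOn ℝ ∞ (p k) (closure (piece ξ k))) (hx : x ∈ piece ξ k) (j : ℕ) :
    iteratedDeriv j (glueFun ξ p) x = iteratedDerivWithin j (p k) (closure (piece ξ k)) x := by
  rw [iteratedDerivWithin_closure_eq (isOpen_piece ξ k) (ordConnected_piece ξ k) hp j hx]
  refine Filter.EventuallyEq.iteratedDeriv_eq j ?_
  filter_upwards [(isOpen_piece ξ k).mem_nhds hx] with y hy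
  exact glueFun_eq p hy

/-- A glued function satisfies the regular part of the equation if and only if its constituents
solve the equation on the closed intervals. -/
theorem CoeffRep.ode_glueFun_iff (R : CoeffRep a b T N u v α β) (hξ : StrictMono ξ)
    (hI : range ξ = singularSet a b) (hT : Finset.univ.image ξ ⊆ T) (hf : ContDiff ℝ ∞ f)
    {p : Fin (m + 1) → ℝ → ℂ} (hp : ∀ k, ContDiffOn ℝ ∞ (p k) (closure (piece ξ k))) :
    (∀ x ∉ T, ∑ i : Fin (n + 1), (u i x + v i x) * iteratedDeriv i (glueFun ξ p) x = f x) ↔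
      ∀ k, SolvesOnClosure a b f (piece ξ k) (p k) := by
  constructor
  · intro hode k
    have ho := isOpen_piece ξ k
    have hc := ordConnected_piece ξ k
    have hne := piece_nonempty hξ k
    choose A hA using fun i => (R.left i).exists_isClosedExtension ho hc hne
      (disjoint_piece_singSupp_left hI k i)
    choose B hB using fun i => (R.right i).exists_isClosedExtension ho hc hne
      (disjoint_piece_singSupp_right hI k i)
    refine ⟨A, B, hA, hB, EqOn.of_subset_closure (s := piece ξ k ∩ (T : Set ℝ)ᶜ)
      (f := fun x => ∑ i : Fin (n + 1),
        (A i x + B i x) * iteratedDerivWithin i (p k) (closure (piece ξ k)) x) (g := f)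
      (fun x hx => ?_) ?_ hf.continuous.continuousOn (inter_subset_left.trans subset_closure)
      (closure_subset_closure_inter_compl T ho)⟩
    · rw [← hode x hx.2]
      refine Finset.sum_congr rfl fun i _ => ?_
      rw [iteratedDeriv_glueFun p (hp k) hx.1, (hA i).eq_of_notMem (R.left i) ho x hx.1 hx.2,
        (hB i).eq_of_notMem (R.right i) ho x hx.1 hx.2]
    · exact continuousOn_finsetSum _ fun i _ =>
        ((hA i).1.continuousOn.add (hB i).1.continuousOn).mul
          (continuousOn_iteratedDerivWithin_closure ho hc hne (hp k) i)
  · intro hs x hx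
    obtain ⟨k, hk⟩ := exists_mem_piece hξ (x := x) fun h => hx (hT (by simpa using h))
    have ho := isOpen_piece ξ k
    obtain ⟨A, B, hA, hB, hAB⟩ := hs k
    rw [← hAB x (subset_closure hk)]
    refine Finset.sum_congr rfl fun i _ => ?_
    rw [iteratedDeriv_glueFun p (hp k) hk, (hA i).eq_of_notMem (R.left i) ho x hk hx,
      (hB i).eq_of_notMem (R.right i) ho x hk hx]

/-- The interface matrices: glued functions are solutions if and only if their constituents solve
the equation on the closed intervals and satisfy the interface conditions. -/
theorem exists_interface_conditions (ha : ∀ i, a i ∈ spaceA) (hb : ∀ i, b i ∈ spaceA)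
    (hξ : StrictMono ξ) (hI : range ξ = singularSet a b)
    (hC2 : NondegenerateOnRegular a b) (hM : maxOrder a b ≤ (n : ℕ∞)) :
    ∃ A B D : Fin m → Matrix (Fin n) (Fin n) ℂ, ∀ f : ℝ → ℂ, ContDiff ℝ ∞ f →
      ∀ p : Fin (m + 1) → ℝ → ℂ, (∀ k, ContDiffOn ℝ ∞ (p k) (closure (piece ξ k))) →
        (IsSolution a b f (glue ξ p) ↔ (∀ k, SolvesOnClosure a b f (piece ξ k) (p k)) ∧
          ∀ s : Fin m,
            (A s).mulVec (jet n (p s.castSucc) (closure (piece ξ s.castSucc)) (ξ s)) =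
              (B s).mulVec (jet n (p s.succ) (closure (piece ξ s.succ)) (ξ s)) +
                (D s).mulVec (jet n f Set.univ (ξ s))) := by
  obtain ⟨T₀, N, u, v, α, β, R₀⟩ := exists_coeffRep ha hb
  have R := R₀.mono (T' := T₀ ∪ Finset.univ.image ξ) Finset.subset_union_left (le_refl N)
  have hT : Finset.univ.image ξ ⊆ T₀ ∪ Finset.univ.image ξ := Finset.subset_union_right
  generalize T₀ ∪ Finset.univ.image ξ = T at R hT
  choose A B D hABD using fun s : Fin m => exists_interface_matrices (N + n)
    (γ := fun i k => leftLim (u i) (ξ s) k + rightLim (v i) (ξ s) k)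
    (fun i j (hj : n ≤ j) => (R.left i).coeff_eq_zero_of_order_le (order_left_le hM i) (ξ s) hj)
    (fun i j (hj : n ≤ j) => (R.right i).coeff_eq_zero_of_order_le (order_right_le hM i) (ξ s) hj)
    (ΓL := fun i => leftLim (fun x => u i x + v i x) (ξ s))
    (ΓR := fun i => rightLim (fun x => u i x + v i x) (ξ s))
    (R.leftLim_leading_ne_zero hξ hI hC2 (ξ s)) (R.rightLim_leading_ne_zero hξ hI hC2 (ξ s))
  refine ⟨A, B, D, fun f hf p hp => ?_⟩
  have hps := pSmooth_glueFun hξ hp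
  have H : HasRep (glue ξ p) T N (glueFun ξ p) 0 :=
    (HasRep.of_pSmooth hps).mono hT (Nat.zero_le N)
  have hA : glue ξ p ∈ spaceA := ⟨0, glueFun ξ p, hps.isPiecewiseSmooth, rfl⟩
  have hδ : ∀ s, (fun i : Fin (n + 1) => derivCoeff (glueFun ξ p) 0 i s) =
      fun (i : Fin (n + 1)) j => if (i : ℕ) ≤ j then 0 else
        (-1) ^ j * (rightLim (glueFun ξ p) s (i - 1 - j) - leftLim (glueFun ξ p) s (i - 1 - j)) := by
    intro s
    funext i j
    simp only [derivCoeff, jump, Pi.zero_apply, mul_zero]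
  rw [IsSolution, and_iff_right hA, R.equation_iff H hf, R.ode_glueFun_iff hξ hI hT hf hp]
  refine and_congr_right fun hode => ?_
  rw [← R.ode_glueFun_iff hξ hI hT hf hp] at hode
  have hglue : ∀ k, ∀ x ∈ piece ξ k, x ∉ T → glueFun ξ p x = p k x :=
    fun k x hx _ => glueFun_eq p hx
  have key : ∀ s : Fin m, (∀ q, eqnCoeff (N + n) (fun i => α i (ξ s)) (fun i => β i (ξ s))
      (fun i k => leftLim (u i) (ξ s) k + rightLim (v i) (ξ s) k)
      (fun i => derivCoeff (glueFun ξ p) 0 i (ξ s))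
      (leftLim (glueFun ξ p) (ξ s)) (rightLim (glueFun ξ p) (ξ s)) q = 0) ↔
      (A s).mulVec (jet n (p s.castSucc) (closure (piece ξ s.castSucc)) (ξ s)) =
        (B s).mulVec (jet n (p s.succ) (closure (piece ξ s.succ)) (ξ s)) +
          (D s).mulVec (jet n f Set.univ (ξ s)) := by
    intro s
    rw [hδ, hABD s _ _ _ (jetODE_leftLim R.pSmooth_add H.pSmooth hf hode (ξ s))
      (jetODE_rightLim R.pSmooth_add H.pSmooth hf hode (ξ s))]
    have e1 : (fun j : Fin n => leftLim (glueFun ξ p) (ξ s) j) =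
        jet n (p s.castSucc) (closure (piece ξ s.castSucc)) (ξ s) := funext fun j =>
      leftLim_eq_iteratedDerivWithin (isOpen_piece ξ _) (ordConnected_piece ξ _) (hp _)
        (hglue _) (piece_castSucc_mem_nhdsLT hξ s) j
    have e2 : (fun j : Fin n => rightLim (glueFun ξ p) (ξ s) j) =
        jet n (p s.succ) (closure (piece ξ s.succ)) (ξ s) := funext fun j =>
      rightLim_eq_iteratedDerivWithin (isOpen_piece ξ _) (ordConnected_piece ξ _) (hp _)
        (hglue _) (piece_succ_mem_nhdsGT hξ s) j
    have e3 : (fun j : Fin n => iteratedDeriv j f (ξ s)) = jet n f univ (ξ s) :=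
      funext fun j => by rw [jet, iteratedDerivWithin_univ]
    rw [e1, e2, e3]
  refine ⟨fun h s => (key s).1 (h (ξ s)), fun h s => ?_⟩
  by_cases hs : s ∈ range ξ
  · obtain ⟨s, rfl⟩ := hs
    exact (key s).2 (h s)
  · -- off the singular points, all point coefficients and all jumps vanish
    intro q
    have hsi : s ∉ Finset.univ.image ξ := fun h => hs (by simpa using h)
    rw [hI] at hs
    refine Finset.sum_eq_zero fun i _ => ?_
    have h1 := ((R.left i).regular_of_notMem_singSupp (notMem_singSupp_left hs i)).1
    have h2 := ((R.right i).regular_of_notMem_singSupp (notMem_singSupp_right hs i)).1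
    rw [mulCoeff_eq_zero fun j _ => h1 j, mulCoeff_eq_zero fun j _ => h2 j,
      mulCoeff_eq_zero fun j _ => ?_]
    · ring
    · simp only [derivCoeff, hps.jump_eq_zero hsi, Pi.zero_apply, mul_zero, ite_self]

end gluing

/-! ### Transmission of data through the singular points -/

section transmission

variable {m n : ℕ} {X : Type*} {P : Fin (m + 1) → X → Prop}

/-- A family of objects can be modified to the right of an index, if each of them has a successor
in the relation `I`. -/
theorem exists_extension_right {I : Fin m → X → X → Prop} (k : ℕ)
    (hI : ∀ s : Fin m, k ≤ s → ∀ x, P s.castSucc x → ∃ y, P s.succ y ∧ I s x y)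
    {p : Fin (m + 1) → X} (hp : ∀ j, P j (p j)) :
    ∃ p' : Fin (m + 1) → X, (∀ j, P j (p' j)) ∧ (∀ j : Fin (m + 1), (j : ℕ) ≤ k → p' j = p j) ∧
      ∀ s : Fin m, k ≤ s → I s (p' s.castSucc) (p' s.succ) := by
  classical
  choose! g hgP hgI using hI
  set q : Fin (m + 1) → X := fun j =>
    Fin.induction (motive := fun _ => X) (p 0) (fun s x => if k ≤ s then g s x else p s.succ) j
    with hq
  have q0 : q 0 = p 0 := rfl
  have qs : ∀ s : Fin m, q s.succ = if k ≤ s then g s (q s.castSucc) else p s.succ := fun s =>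
    Fin.induction_succ _ _ s
  have hP : ∀ j, P j (q j) := by
    intro j
    induction j using Fin.induction with
    | zero => exact hp 0
    | succ s ih =>
      rw [qs]
      split_ifs with h
      · exact hgP s h _ ih
      · exact hp _
  refine ⟨q, hP, fun j hj => ?_, fun s hs => ?_⟩
  · induction j using Fin.cases with
    | zero => exact q0
    | succ s =>
      rw [qs, if_neg]
      rw [Fin.val_succ] at hj
      omega
  · rw [qs, if_pos hs]
    exact hgI s hs _ (hP _)

/-- A family of objects can be modified to the left of an index, if each of them has a predecessor
in the relation `I`. -/
theorem exists_extension_left {I : Fin m → X → X → Prop} (k : ℕ)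
    (hI : ∀ s : Fin m, (s : ℕ) < k → ∀ y, P s.succ y → ∃ x, P s.castSucc x ∧ I s x y)
    {p : Fin (m + 1) → X} (hp : ∀ j, P j (p j)) :
    ∃ p' : Fin (m + 1) → X, (∀ j, P j (p' j)) ∧ (∀ j : Fin (m + 1), k ≤ j → p' j = p j) ∧
      ∀ s : Fin m, (s : ℕ) < k → I s (p' s.castSucc) (p' s.succ) := by
  classical
  choose! g hgP hgI using hI
  set q : Fin (m + 1) → X := fun j =>
    Fin.reverseInduction (motive := fun _ => X) (p (Fin.last m))
      (fun s y => if (s : ℕ) < k then g s y else p s.castSucc) j with hq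
  have q0 : q (Fin.last m) = p (Fin.last m) := Fin.reverseInduction_last
  have qs : ∀ s : Fin m, q s.castSucc =
      if (s : ℕ) < k then g s (q s.succ) else p s.castSucc := fun _ =>
    Fin.reverseInduction_castSucc _
  have hP : ∀ j, P j (q j) := by
    intro j
    induction j using Fin.reverseInduction with
    | last => rw [q0]; exact hp _
    | cast s ih =>
      rw [qs]
      split_ifs with h
      · exact hgP s h _ ih
      · exact hp _
  refine ⟨q, hP, fun j hj => ?_, fun s hs => ?_⟩
  · induction j using Fin.lastCases with
    | last => exact q0
    | cast s =>
      rw [qs, if_neg]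
      rw [Fin.val_castSucc] at hj
      omega
  · rw [qs, if_pos hs]
    exact hgI s hs _ (hP _)

/-- Induction in both directions from the index `k`. -/
theorem forall_of_propagation {Q : Fin (m + 1) → Prop} {k : Fin (m + 1)} (hk : Q k)
    (hr : ∀ s : Fin m, (k : ℕ) ≤ s → Q s.castSucc → Q s.succ)
    (hl : ∀ s : Fin m, (s : ℕ) < k → Q s.succ → Q s.castSucc) (j : Fin (m + 1)) : Q j := by
  have h1 : ∀ j : Fin (m + 1), k ≤ j → Q j := by
    intro j
    induction j using Fin.induction with
    | zero => intro h; rwa [← Fin.le_zero_iff.1 h]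
    | succ s ih =>
      intro h
      rcases h.eq_or_lt with h | h
      · rwa [← h]
      · have hks : (k : ℕ) ≤ s := Nat.lt_succ_iff.1 (by simpa using Fin.lt_def.1 h)
        exact hr s hks (ih (Fin.le_def.2 hks))
  have h2 : ∀ j : Fin (m + 1), j ≤ k → Q j := by
    intro j
    induction j using Fin.reverseInduction with
    | last => intro h; rwa [Fin.last_le_iff.1 h] at hk
    | cast s ih =>
      intro h
      rcases h.eq_or_lt with h | h
      · rwa [h]
      · have hks : (s : ℕ) < k := Fin.lt_def.1 h
        exact hl s hks (ih (Fin.le_def.2 (by simpa using hks)))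
  exact (le_total k j).elim (h1 j) (h2 j)

/-- Unique solvability of interface problems. On each of `m + 1` consecutive intervals there is a
space `P j` of local solutions (up to the equivalence `E j`), parametrized by their data at the
right end (`L`), at the left end (`R`) or at a chosen point (`J`). Local solutions on adjacent
intervals match if `A s (L s x) = B s (R s y) + d s`. Matching families are determined by arbitrary
data on the `k`-th interval if and only if the matrices by which the data are transported away
from that interval are invertible. -/
theorem existsUnique_transmission_iff {E : Fin (m + 1) → X → X → Prop}
    {L R : Fin m → X → Fin n → ℂ} {J : X → Fin n → ℂ} {k : Fin (m + 1)}
    (hL : ∀ s v, ∃ x, P s.castSucc x ∧ L s x = v) (hR : ∀ s v, ∃ x, P s.succ x ∧ R s x = v)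
    (hJ : ∀ v, ∃ x, P k x ∧ J x = v) (hP : ∀ j, ∃ x, P j x)
    (hLE : ∀ s x y, P s.castSucc x → P s.castSucc y → (L s x = L s y ↔ E s.castSucc x y))
    (hRE : ∀ s x y, P s.succ x → P s.succ y → (R s x = R s y ↔ E s.succ x y))
    (hJE : ∀ x y, P k x → P k y → (J x = J y ↔ E k x y))
    (A B : Fin m → Matrix (Fin n) (Fin n) ℂ) (d : Fin m → Fin n → ℂ) (C : Fin n → ℂ) :
    ((∃ p : Fin (m + 1) → X, ((∀ j, P j (p j)) ∧
        ∀ s, (A s).mulVec (L s (p s.castSucc)) = (B s).mulVec (R s (p s.succ)) + d s) ∧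
        J (p k) = C) ∧
      ∀ p p' : Fin (m + 1) → X,
        ((∀ j, P j (p j)) ∧
          ∀ s, (A s).mulVec (L s (p s.castSucc)) = (B s).mulVec (R s (p s.succ)) + d s) →
        ((∀ j, P j (p' j)) ∧
          ∀ s, (A s).mulVec (L s (p' s.castSucc)) = (B s).mulVec (R s (p' s.succ)) + d s) →
        J (p k) = C → J (p' k) = C → ∀ j, E j (p j) (p' j)) ↔
      (∀ s : Fin m, (k : ℕ) ≤ s → (B s).det ≠ 0) ∧ ∀ r : Fin m, (r : ℕ) < k → (A r).det ≠ 0 := by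
  classical
  set I : Fin m → X → X → Prop := fun s x y =>
    (A s).mulVec (L s x) = (B s).mulVec (R s y) + d s with hIdef
  have stepR : ∀ s : Fin m, (B s).det ≠ 0 → ∀ x, P s.castSucc x → ∃ y, P s.succ y ∧ I s x y := by
    intro s hs x _
    obtain ⟨y, hy, hyv⟩ := hR s ((B s)⁻¹.mulVec ((A s).mulVec (L s x) - d s))
    refine ⟨y, hy, ?_⟩
    simp only [hIdef]
    rw [hyv, Matrix.mulVec_mulVec, Matrix.mul_nonsing_inv _ (isUnit_iff_ne_zero.2 hs),
      Matrix.one_mulVec, sub_add_cancel]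
  have stepL : ∀ s : Fin m, (A s).det ≠ 0 → ∀ y, P s.succ y → ∃ x, P s.castSucc x ∧ I s x y := by
    intro s hs y _
    obtain ⟨x, hx, hxv⟩ := hL s ((A s)⁻¹.mulVec ((B s).mulVec (R s y) + d s))
    refine ⟨x, hx, ?_⟩
    simp only [hIdef]
    rw [hxv, Matrix.mulVec_mulVec, Matrix.mul_nonsing_inv _ (isUnit_iff_ne_zero.2 hs),
      Matrix.one_mulVec]
  constructor
  · rintro ⟨⟨p, ⟨hpP, hpI⟩, hpC⟩, huniq⟩
    refine ⟨?_, ?_⟩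
    · by_contra! hcon
      -- at the last singular matrix on the right, a kernel vector can be added to the data, and the
      -- modified family can be continued, since the matrices further right are invertible
      obtain ⟨s, hs, hmax⟩ := Finset.exists_max_image
        (Finset.univ.filter fun s : Fin m => (k : ℕ) ≤ s ∧ (B s).det = 0) id
        (by obtain ⟨s, h1, h2⟩ := hcon; exact ⟨s, by simp [h1, h2]⟩)
      obtain ⟨hks, hs0⟩ := (Finset.mem_filter.1 hs).2
      obtain ⟨c, hc0, hc⟩ := Matrix.exists_mulVec_eq_zero_iff.2 hs0
      obtain ⟨y, hy, hyv⟩ := hR s (R s (p s.succ) + c)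
      have hupd : ∀ j, P j (Function.update p s.succ y j) := by
        intro j
        rcases eq_or_ne j s.succ with rfl | hj
        · simpa using hy
        · simpa [hj] using hpP j
      obtain ⟨p', hp'P, hp'e, hp'I⟩ := exists_extension_right (I := I) ((s : ℕ) + 1)
        (fun r hr => stepR r fun h0 => by
          have := Fin.le_def.1 (hmax r (by simp [h0]; omega))
          simp only [id] at this
          omega) hupd
      have hlow : ∀ j : Fin (m + 1), (j : ℕ) ≤ s → p' j = p j := by
        intro j hj
        rw [hp'e j (by omega), Function.update_of_ne]
        rintro rfl
        simp at hj
      have hsucc : p' s.succ = y := by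
        rw [hp'e s.succ (by simp), Function.update_self]
      have key := huniq p' p ⟨hp'P, fun r => ?_⟩ ⟨hpP, hpI⟩ (by rw [hlow k hks, hpC]) hpC s.succ
      · rw [← hRE s _ _ (hp'P _) (hpP _), hsucc, hyv] at key
        exact hc0 (by simpa using key)
      · rcases lt_trichotomy (r : ℕ) s with h | h | h
        · rw [hlow r.castSucc (by simpa using h.le), hlow r.succ (by simpa using h)]
          exact hpI r
        · obtain rfl : r = s := Fin.ext h
          rw [hlow r.castSucc (by simp), hsucc, hyv, Matrix.mulVec_add, hc, add_zero]
          exact hpI r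
        · exact hp'I r h
    · by_contra! hcon
      -- likewise at the first singular matrix on the left
      obtain ⟨s, hs, hmin⟩ := Finset.exists_min_image
        (Finset.univ.filter fun s : Fin m => (s : ℕ) < k ∧ (A s).det = 0) id
        (by obtain ⟨s, h1, h2⟩ := hcon; exact ⟨s, by simp [h1, h2]⟩)
      obtain ⟨hks, hs0⟩ := (Finset.mem_filter.1 hs).2
      obtain ⟨c, hc0, hc⟩ := Matrix.exists_mulVec_eq_zero_iff.2 hs0
      obtain ⟨y, hy, hyv⟩ := hL s (L s (p s.castSucc) + c)
      have hupd : ∀ j, P j (Function.update p s.castSucc y j) := by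
        intro j
        rcases eq_or_ne j s.castSucc with rfl | hj
        · simpa using hy
        · simpa [hj] using hpP j
      obtain ⟨p', hp'P, hp'e, hp'I⟩ := exists_extension_left (I := I) (s : ℕ)
        (fun r hr => stepL r fun h0 => by
          have := Fin.le_def.1 (hmin r (by simp [h0]; omega))
          simp only [id] at this
          omega) hupd
      have hhigh : ∀ j : Fin (m + 1), (s : ℕ) < j → p' j = p j := by
        intro j hj
        rw [hp'e j hj.le, Function.update_of_ne]
        rintro rfl
        simp at hj
      have hcast : p' s.castSucc = y := by
        rw [hp'e s.castSucc (by simp), Function.update_self]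
      have key := huniq p' p ⟨hp'P, fun r => ?_⟩ ⟨hpP, hpI⟩ (by rw [hhigh k hks, hpC]) hpC
        s.castSucc
      · rw [← hLE s _ _ (hp'P _) (hpP _), hcast, hyv] at key
        exact hc0 (by simpa using key)
      · rcases lt_trichotomy (r : ℕ) s with h | h | h
        · exact hp'I r h
        · obtain rfl : r = s := Fin.ext h
          rw [hhigh r.succ (by simp), hcast, hyv, Matrix.mulVec_add, hc, add_zero]
          exact hpI r
        · rw [hhigh r.castSucc (by simpa using h), hhigh r.succ (by simp; omega)]
          exact hpI r
  · rintro ⟨hB, hA⟩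
    refine ⟨?_, ?_⟩
    · obtain ⟨x, hx, hxC⟩ := hJ C
      choose p₀ hp₀ using hP
      have hupd : ∀ j, P j (Function.update p₀ k x j) := by
        intro j
        rcases eq_or_ne j k with rfl | hj
        · simpa using hx
        · simpa [hj] using hp₀ j
      obtain ⟨p₁, hp₁P, hp₁e, hp₁I⟩ := exists_extension_right (I := I) (k : ℕ)
        (fun s hs => stepR s (hB s hs)) hupd
      obtain ⟨p₂, hp₂P, hp₂e, hp₂I⟩ := exists_extension_left (I := I) (k : ℕ)
        (fun s hs => stepL s (hA s hs)) hp₁P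
      refine ⟨p₂, ⟨hp₂P, fun s => ?_⟩, ?_⟩
      · rcases lt_or_ge (s : ℕ) k with h | h
        · exact hp₂I s h
        · rw [hp₂e s.castSucc (by simpa using h), hp₂e s.succ (by simp; omega)]
          exact hp₁I s h
      · rw [hp₂e k le_rfl, hp₁e k le_rfl, Function.update_self, hxC]
    · intro p p' hp hp' hC hC'
      refine forall_of_propagation ((hJE _ _ (hp.1 k) (hp'.1 k)).1 (hC.trans hC'.symm))
        (fun s hs h => ?_) (fun s hs h => ?_)
      · rw [← hLE s _ _ (hp.1 _) (hp'.1 _)] at h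
        rw [← hRE s _ _ (hp.1 _) (hp'.1 _)]
        have e : (B s).mulVec (R s (p s.succ)) = (B s).mulVec (R s (p' s.succ)) :=
          add_right_cancel ((hp.2 s).symm.trans (h ▸ hp'.2 s))
        exact Matrix.mulVec_injective_of_det_ne_zero (hB s hs) e
      · rw [← hRE s _ _ (hp.1 _) (hp'.1 _)] at h
        rw [← hLE s _ _ (hp.1 _) (hp'.1 _)]
        have e : (A s).mulVec (L s (p s.castSucc)) = (A s).mulVec (L s (p' s.castSucc)) := by
          rw [hp.2 s, hp'.2 s, h]
        exact Matrix.mulVec_injective_of_det_ne_zero (hA s hs) e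

end transmission

/-! ### Local solutions and their data -/

section localSolutions

variable {n m : ℕ} {a b : Fin (n + 1) → Distr} {Ω : Set ℝ} {f p q : ℝ → ℂ}

/-- `p` is a smooth solution of the equation on the closure of `Ω`. -/
def IsLocalSolution (a b : Fin (n + 1) → Distr) (f : ℝ → ℂ) (Ω : Set ℝ) (p : ℝ → ℂ) : Prop :=
  ContDiffOn ℝ ∞ p (closure Ω) ∧ SolvesOnClosure a b f Ω p

theorem jet_congr (h : EqOn p q (closure Ω)) {x : ℝ} (hx : x ∈ closure Ω) :
    jet n p (closure Ω) x = jet n q (closure Ω) x :=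
  funext fun _ => iteratedDerivWithin_congr h hx

/-- Smooth closed extensions of the coefficients, with non-vanishing leading coefficient. -/
theorem exists_coefficients (ha : ∀ i, a i ∈ spaceA) (hb : ∀ i, b i ∈ spaceA) (hΩ : IsOpen Ω)
    (hc : Ω.OrdConnected) (hne : Ω.Nonempty) (hd : Disjoint Ω (singularSet a b))
    (hC2 : NondegenerateOnRegular a b) :
    ∃ g : Fin (n + 1) → ℝ → ℂ, (∀ i, ContDiffOn ℝ ∞ (g i) (closure Ω)) ∧
      (∀ x ∈ closure Ω, g (Fin.last n) x ≠ 0) ∧ ∀ (f p : ℝ → ℂ), SolvesOnClosure a b f Ω p ↔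
        ∀ x ∈ closure Ω, ∑ i : Fin (n + 1), g i x * iteratedDerivWithin i p (closure Ω) x = f x := by
  obtain ⟨T, N, u, v, α, β, R⟩ := exists_coeffRep ha hb
  choose A hA using fun i => (R.left i).exists_isClosedExtension hΩ hc hne (hd.mono_right
    (subset_union_left.trans (subset_iUnion (fun i => singSupp (a i) ∪ singSupp (b i)) i)))
  choose B hB using fun i => (R.right i).exists_isClosedExtension hΩ hc hne (hd.mono_right
    (subset_union_right.trans (subset_iUnion (fun i => singSupp (a i) ∪ singSupp (b i)) i)))
  refine ⟨fun i x => A i x + B i x, fun i => (hA i).1.add (hB i).1, ?_, fun f p => ⟨?_, ?_⟩⟩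
  · obtain ⟨A', B', hA', hB', h0⟩ := hC2 Ω hΩ hc hd
    intro x hx
    beta_reduce
    rw [(hA _).eqOn (R.left _) hΩ hA' hx, (hB _).eqOn (R.right _) hΩ hB' hx]
    exact h0 x hx
  · rintro ⟨A', B', hA', hB', he⟩ x hx
    rw [← he x hx]
    refine Finset.sum_congr rfl fun i _ => ?_
    beta_reduce
    rw [(hA i).eqOn (R.left i) hΩ (hA' i) hx, (hB i).eqOn (R.right i) hΩ (hB' i) hx]
  · exact fun he => ⟨A, B, hA, hB, he⟩

/-- Local solutions with arbitrary data at one point of the closed interval exist. -/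
theorem exists_isLocalSolution (ha : ∀ i, a i ∈ spaceA) (hb : ∀ i, b i ∈ spaceA) (hΩ : IsOpen Ω)
    (hc : Ω.OrdConnected) (hd : Disjoint Ω (singularSet a b))
    (hC2 : NondegenerateOnRegular a b) (hf : ContDiff ℝ ∞ f) {x₀ : ℝ} (hx₀ : x₀ ∈ closure Ω)
    (z : Fin n → ℂ) : ∃ p, IsLocalSolution a b f Ω p ∧ jet n p (closure Ω) x₀ = z := by
  have hne : Ω.Nonempty := closure_nonempty_iff.1 ⟨x₀, hx₀⟩
  obtain ⟨g, hg, h0, hiff⟩ := exists_coefficients ha hb hΩ hc hne hd hC2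
  obtain ⟨p, hp, hpe, hpz⟩ := exists_scalar_solution isClosed_closure
    (uniqueDiffOn_closure hΩ hc hne) hg hf.contDiffOn h0 hx₀ z
  exact ⟨p, ⟨hp, (hiff f p).2 hpe⟩, funext hpz⟩

/-- Local solutions are determined by their data at one point of the closed interval. -/
theorem jet_eq_jet_iff (ha : ∀ i, a i ∈ spaceA) (hb : ∀ i, b i ∈ spaceA) (hΩ : IsOpen Ω)
    (hc : Ω.OrdConnected) (hd : Disjoint Ω (singularSet a b))
    (hC2 : NondegenerateOnRegular a b) (hp : IsLocalSolution a b f Ω p)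
    (hq : IsLocalSolution a b f Ω q) {x₀ : ℝ} (hx₀ : x₀ ∈ closure Ω) :
    jet n p (closure Ω) x₀ = jet n q (closure Ω) x₀ ↔ EqOn p q (closure Ω) := by
  have hne : Ω.Nonempty := closure_nonempty_iff.1 ⟨x₀, hx₀⟩
  obtain ⟨g, hg, h0, hiff⟩ := exists_coefficients ha hb hΩ hc hne hd hC2
  refine ⟨fun h => ?_, fun h => jet_congr h hx₀⟩
  exact scalar_solution_unique (convex_closure_of_ordConnected hc).ordConnected
    (uniqueDiffOn_closure hΩ hc hne) hg h0 hp.1 hq.1 ((hiff f p).1 hp.2) ((hiff f q).1 hq.2) hx₀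
    fun j hj => congrFun h ⟨j, hj⟩

end localSolutions

section glueData

variable {n m : ℕ} {ξ : Fin m → ℝ} {p p' : Fin (m + 1) → ℝ → ℂ}

/-- The data of a glued function at a regular point are those of the constituent living there. -/
theorem hasData_glue_iff (hξ : StrictMono ξ)
    (hp : ∀ k, ContDiffOn ℝ ∞ (p k) (closure (piece ξ k))) {k : Fin (m + 1)} {x₀ : ℝ}
    (hx₀ : x₀ ∈ piece ξ k) (C : Fin n → ℂ) :
    HasData (glue ξ p) x₀ C ↔ jet n (p k) (closure (piece ξ k)) x₀ = C := by
  have H : HasRep (glue ξ p) _ 0 (glueFun ξ p) 0 := HasRep.of_pSmooth (pSmooth_glueFun hξ hp)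
  have ho := isOpen_piece ξ k
  have hjet : ∀ j, iteratedDerivWithin j (p k) (closure (piece ξ k)) x₀ =
      iteratedDeriv j (p k) x₀ := fun j =>
    iteratedDerivWithin_closure_eq ho (ordConnected_piece ξ k) (hp k) j hx₀
  constructor
  · rintro ⟨l, u, φ, hlu, hφ, hag, hC⟩
    have h1 := (H.eqOn_of_agreesOn isOpen_Ioo hφ.continuous.continuousOn hag).1
    have h2 : p k =ᶠ[𝓝 x₀] φ := by
      filter_upwards [ho.mem_nhds hx₀, isOpen_Ioo.mem_nhds hlu] with x hx hxlu
      rw [← glueFun_eq p hx]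
      refine h1 x hxlu fun hxξ => ?_
      obtain ⟨s, -, rfl⟩ := Finset.mem_image.1 hxξ
      exact notMem_piece ξ s k hx
    funext j
    rw [← hC j, ← h2.iteratedDeriv_eq]
    exact hjet j
  · intro hC
    obtain ⟨r, hr, hball⟩ := Metric.isOpen_iff.1 ho x₀ hx₀
    -- cut `p k` off near the end points of the interval to get a function smooth on the line
    let χ : ContDiffBump x₀ := ⟨r / 4, r / 2, by positivity, by linarith⟩
    have hsupp : tsupport (fun x => (χ x : ℂ)) ⊆ piece ξ k := by
      refine Subset.trans (b := tsupport χ)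
        (closure_mono fun x (hx : (χ x : ℂ) ≠ 0) (h : χ x = 0) => hx (by simp [h])) ?_
      rw [χ.tsupport_eq]
      exact (Metric.closedBall_subset_ball (by change r / 2 < r; linarith)).trans hball
    have hφ : ContDiff ℝ ∞ (fun x => p k x * (χ x : ℂ)) :=
      contDiff_mul_of_tsupport_subset ho ((hp k).mono subset_closure)
        (Complex.ofRealCLM.contDiff.comp χ.contDiff) hsupp
    have hone : ∀ x ∈ Ioo (x₀ - r / 4) (x₀ + r / 4), χ x = 1 := fun x hx =>
      χ.one_of_mem_closedBall (Metric.ball_subset_closedBall (by rwa [Real.ball_eq_Ioo]))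
    have hsub : Ioo (x₀ - r / 4) (x₀ + r / 4) ⊆ piece ξ k := by
      rw [← Real.ball_eq_Ioo]
      exact (Metric.ball_subset_ball (by linarith)).trans hball
    have hmem : x₀ ∈ Ioo (x₀ - r / 4) (x₀ + r / 4) := ⟨by linarith, by linarith⟩
    refine ⟨x₀ - r / 4, x₀ + r / 4, fun x => p k x * (χ x : ℂ), hmem, hφ,
      H.agreesOn_of_eqOn (fun _ _ _ => rfl) fun x hx _ => ?_, fun j => ?_⟩
    · rw [glueFun_eq p (hsub hx), hone x hx, Complex.ofReal_one, mul_one]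
    · have h2 : (fun x => p k x * (χ x : ℂ)) =ᶠ[𝓝 x₀] p k := by
        filter_upwards [isOpen_Ioo.mem_nhds hmem] with x hx
        rw [hone x hx, Complex.ofReal_one, mul_one]
      rw [h2.iteratedDeriv_eq, ← hjet, ← hC]
      rfl

theorem glue_eq_glue_iff (hξ : StrictMono ξ)
    (hp : ∀ k, ContDiffOn ℝ ∞ (p k) (closure (piece ξ k)))
    (hp' : ∀ k, ContDiffOn ℝ ∞ (p' k) (closure (piece ξ k))) :
    glue ξ p = glue ξ p' ↔ ∀ k, EqOn (p k) (p' k) (closure (piece ξ k)) := by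
  have H : HasRep (glue ξ p) _ 0 (glueFun ξ p) 0 := HasRep.of_pSmooth (pSmooth_glueFun hξ hp)
  have hsm := pSmooth_glueFun hξ hp'
  constructor
  · intro e k
    have hag : AgreesOn (glue ξ p) (p' k) (piece ξ k) := by
      rw [e]
      exact (HasRep.of_pSmooth hsm).agreesOn_of_eqOn (fun _ _ _ => rfl) fun x hx _ =>
        glueFun_eq p' hx
    have h1 := (H.eqOn_of_agreesOn (isOpen_piece ξ k)
      ((hp' k).continuousOn.mono subset_closure) hag).1
    refine EqOn.of_subset_closure (s := piece ξ k) (fun x hx => ?_) (hp k).continuousOn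
      (hp' k).continuousOn subset_closure subset_rfl
    rw [← glueFun_eq p hx]
    refine h1 x hx fun hxξ => ?_
    obtain ⟨s, -, rfl⟩ := Finset.mem_image.1 hxξ
    exact notMem_piece ξ s k hx
  · intro h
    refine H.eq_ofFun hsm (fun _ _ => rfl) fun x hx => ?_
    obtain ⟨k, hk⟩ := exists_mem_piece hξ (x := x) fun h => hx (by simpa using h)
    exact (glueFun_eq p hk).trans ((h k (subset_closure hk)).trans (glueFun_eq p' hk).symm)

theorem mem_closure_piece_castSucc (hξ : StrictMono ξ) (s : Fin m) :
    ξ s ∈ closure (piece ξ s.castSucc) :=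
  mem_closure_iff_nhdsWithin_neBot.2 (neBot_of_le (le_inf nhdsWithin_le_nhds
    (le_principal_iff.2 (piece_castSucc_mem_nhdsLT hξ s))))

theorem mem_closure_piece_succ (hξ : StrictMono ξ) (s : Fin m) :
    ξ s ∈ closure (piece ξ s.succ) :=
  mem_closure_iff_nhdsWithin_neBot.2 (neBot_of_le (le_inf nhdsWithin_le_nhds
    (le_principal_iff.2 (piece_succ_mem_nhdsGT hξ s))))

end glueData

end SingularODE

end

open SingularODE in
theorem theorem2p11 (n m : ℕ) (a b : Fin (n + 1) → Distr)
    (ha : ∀ i, a i ∈ spaceA) (hb : ∀ i, b i ∈ spaceA)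
    (ξ : Fin m → ℝ) (hξ : StrictMono ξ) (hI : Set.range ξ = singularSet a b)
    (hC1 : NondegenerateAtSingular a b) (hC2 : NondegenerateOnRegular a b)
    (hM : maxOrder a b ≤ (n : ℕ∞)) :
    ∃ A B D : Fin m → Matrix (Fin n) (Fin n) ℂ,
      ∀ f : ℝ → ℂ, ContDiff ℝ ∞ f →
        (∀ ψ : Distr, IsSolution a b f ψ ↔
          ∃ p : Fin (m + 1) → ℝ → ℂ,
            (∀ k, ContDiffOn ℝ ∞ (p k) (closure (piece ξ k))) ∧
            ψ = glue ξ p ∧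
            (∀ k, SolvesOnClosure a b f (piece ξ k) (p k)) ∧
            ∀ s : Fin m,
              (A s).mulVec (jet n (p s.castSucc) (closure (piece ξ s.castSucc)) (ξ s)) =
                (B s).mulVec (jet n (p s.succ) (closure (piece ξ s.succ)) (ξ s)) +
                  (D s).mulVec (jet n f Set.univ (ξ s))) ∧
        (∀ (k : Fin (m + 1)) (x₀ : ℝ), x₀ ∈ piece ξ k → ∀ C : Fin n → ℂ,
          (∃! ψ : Distr, IsSolution a b f ψ ∧ HasData ψ x₀ C) ↔
            (∀ s : Fin m, (k : ℕ) ≤ s → (B s).det ≠ 0) ∧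
              (∀ r : Fin m, (r : ℕ) < k → (A r).det ≠ 0)) := by
  obtain ⟨A, B, D, hABD⟩ := exists_interface_conditions ha hb hξ hI hC2 hM
  refine ⟨A, B, D, fun f hf => ?_⟩
  have part1 : ∀ ψ : Distr, IsSolution a b f ψ ↔
      ∃ p : Fin (m + 1) → ℝ → ℂ,
        (∀ k, ContDiffOn ℝ ∞ (p k) (closure (piece ξ k))) ∧
        ψ = glue ξ p ∧
        (∀ k, SolvesOnClosure a b f (piece ξ k) (p k)) ∧
        ∀ s : Fin m,
          (A s).mulVec (jet n (p s.castSucc) (closure (piece ξ s.castSucc)) (ξ s)) =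
            (B s).mulVec (jet n (p s.succ) (closure (piece ξ s.succ)) (ξ s)) +
              (D s).mulVec (jet n f Set.univ (ξ s)) := by
    intro ψ
    constructor
    · intro hψ
      obtain ⟨p, hp, rfl⟩ := hψ.exists_eq_glue ha hb hξ hI hC1 hC2 hM hf
      exact ⟨p, hp, rfl, (hABD f hf p hp).1 hψ⟩
    · rintro ⟨p, hp, rfl, h⟩
      exact (hABD f hf p hp).2 h
  refine ⟨part1, fun k x₀ hx₀ C => ?_⟩
  have ho := isOpen_piece ξ
  have hc := ordConnected_piece ξ
  have hd := fun j => hI ▸ disjoint_piece_range ξ j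
  have hmL := mem_closure_piece_castSucc hξ
  have hmR := mem_closure_piece_succ hξ
  rw [← existsUnique_transmission_iff (P := fun j => IsLocalSolution a b f (piece ξ j))
    (E := fun j p q => EqOn p q (closure (piece ξ j)))
    (L := fun s p => jet n p (closure (piece ξ s.castSucc)) (ξ s))
    (R := fun s p => jet n p (closure (piece ξ s.succ)) (ξ s))
    (J := fun p => jet n p (closure (piece ξ k)) x₀)
    (fun s => exists_isLocalSolution ha hb (ho _) (hc _) (hd _) hC2 hf (hmL s))
    (fun s => exists_isLocalSolution ha hb (ho _) (hc _) (hd _) hC2 hf (hmR s))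
    (exists_isLocalSolution ha hb (ho _) (hc _) (hd _) hC2 hf (subset_closure hx₀))
    (fun j => by
      obtain ⟨x, hx⟩ := piece_nonempty hξ j
      obtain ⟨p, hp, -⟩ :=
        exists_isLocalSolution ha hb (ho j) (hc j) (hd j) hC2 hf (subset_closure hx) 0
      exact ⟨p, hp⟩)
    (fun s p q hp hq => jet_eq_jet_iff ha hb (ho _) (hc _) (hd _) hC2 hp hq (hmL s))
    (fun s p q hp hq => jet_eq_jet_iff ha hb (ho _) (hc _) (hd _) hC2 hp hq (hmR s))
    (fun p q hp hq => jet_eq_jet_iff ha hb (ho _) (hc _) (hd _) hC2 hp hq (subset_closure hx₀))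
    A B (fun s => (D s).mulVec (jet n f Set.univ (ξ s))) C]
  constructor
  · rintro ⟨ψ, ⟨hψ, hψC⟩, huniq⟩
    refine ⟨?_, fun p p' hp hp' hpC hp'C => ?_⟩
    · obtain ⟨p, hp, rfl, hs, hi⟩ := (part1 ψ).1 hψ
      exact ⟨p, ⟨fun j => ⟨hp j, hs j⟩, hi⟩, (hasData_glue_iff hξ hp hx₀ C).1 hψC⟩
    · have h1 := fun j => (hp.1 j).1
      have h2 := fun j => (hp'.1 j).1
      rw [← glue_eq_glue_iff hξ h1 h2]
      exact (huniq _ ⟨(part1 _).2 ⟨p, h1, rfl, fun j => (hp.1 j).2, hp.2⟩,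
        (hasData_glue_iff hξ h1 hx₀ C).2 hpC⟩).trans (huniq _
        ⟨(part1 _).2 ⟨p', h2, rfl, fun j => (hp'.1 j).2, hp'.2⟩,
        (hasData_glue_iff hξ h2 hx₀ C).2 hp'C⟩).symm
  · rintro ⟨⟨p, hp, hpC⟩, huniq⟩
    have h1 := fun j => (hp.1 j).1
    refine ⟨glue ξ p, ⟨(part1 _).2 ⟨p, h1, rfl, fun j => (hp.1 j).2, hp.2⟩,
      (hasData_glue_iff hξ h1 hx₀ C).2 hpC⟩, ?_⟩
    rintro ψ ⟨hψ, hψC⟩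
    obtain ⟨q, hq, rfl, hs, hi⟩ := (part1 ψ).1 hψ
    exact (glue_eq_glue_iff hξ hq h1).2 (huniq q p ⟨fun j => ⟨hq j, hs j⟩, hi⟩ hp
      ((hasData_glue_iff hξ hq hx₀ C).1 hψC) hpC)
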